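/- Let $M$ be a finite-dimensional real analytic manifold (Hausdorff, second countable, without boundary) with base point $\star$, let $\pi:P\to M$ be a smooth principal $U(1)$-bundle, let $u_0\in\pi^{-1}(\star)$, and let $\mathcal A$ be the set of smooth principal connections on $P$. A loop is a continuous map $\alpha:[0,1]\to M$ with $\alpha(0)=\alpha(1)=\star$ that is piecewise analytic: there is a partition $0=t_0\le t_1\le\dots\le t_n=1$ such that $\alpha$ agrees on each $[t_i,t_{i+1}]$ with a map that is analytic on a neighbourhood of $[t_i,t_{i+1}]$. A loop $\alpha$ is thin if it is homotopic to the constant loop $\star$ by a homotopy of based loops whose image is contained in the image of $\alpha$; two loops $\alpha,\beta$ are thin-equivalent if $\alpha\beta^{-1}$ is thin. Let $Loop_\star(M)$ be the group of loops modulo the equivalence relation generated by thin equivalence, with composition of loops as multiplication. For $A\in\mathcal A$ and a loop $\alpha$ there is a unique $H_A(\alpha)\in U(1)$ (the holonomy) with $u_0=\mathcal P^A_\alpha(u_0)\,H_A(\alpha)$, where $\mathcal P^A_\alpha(u_0)$ is the end point of the $A$-horizontal lift of $\alpha$ starting at $u_0$. The Wilson function of $\alpha$ is $T_\alpha:\mathcal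 A\to\mathbb C$, $T_\alpha(A)=H_A(\alpha)$, and $Hoop_\star(M)=\{T_\alpha\}$ is the set of all Wilson functions. Then $Hoop_\star(M)$ is a group under pointwise multiplication, $T_\alpha$ depends only on the class of $\alpha$ in $Loop_\star(M)$, and the map $\tau:Loop_\star(M)\to Hoop_\star(M)$, $\alpha\mapsto T_\alpha$, is a group homomorphism whose kernel is exactly the commutator subgroup of $Loop_\star(M)$. -/

import Mathlib

open Set
open scoped Manifold ContDiff

noncomputable section

namespace LoopHoop

/-! ### Piecewise analytic loops -/

section Loops

variable {E : Type*} [NormedAddCommGroup E] [NormedSpace ℝ E]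
  {H : Type*} [TopologicalSpace H] (I : ModelWithCorners ℝ E H)
  {M : Type*} [TopologicalSpace M] [ChartedSpace H M]

/-- On the closed interval `[a, b]` the path `γ` agrees with a map that is analytic at every point
of `[a, b]` (hence on an open neighbourhood of `[a, b]`). -/
def AgreesWithAnalyticOn {x y : M} (γ : Path x y) (a b : ℝ) : Prop :=
  ∃ c : ℝ → M, (∀ s ∈ Icc a b, ContMDiffAt 𝓘(ℝ, ℝ) I ω c s) ∧
    ∀ s : unitInterval, (s : ℝ) ∈ Icc a b → γ s = c s

/-- A continuous path is piecewise analytic if there is a partition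
`0 = t 0 ≤ t 1 ≤ ⋯ ≤ t n = 1` such that the path agrees with an analytic map on each
`[t i, t (i + 1)]`. -/
def IsPiecewiseAnalytic {x y : M} (γ : Path x y) : Prop :=
  ∃ (n : ℕ) (t : ℕ → ℝ), t 0 = 0 ∧ t n = 1 ∧ (∀ i < n, t i ≤ t (i + 1)) ∧
    ∀ i < n, AgreesWithAnalyticOn I γ (t i) (t (i + 1))

theorem IsPiecewiseAnalytic.refl (x : M) : IsPiecewiseAnalytic I (Path.refl x) :=
  ⟨1, fun i => i, by simp, by simp, fun i _ => by simp,
    fun i _ => ⟨fun _ => x, fun _ _ => contMDiffAt_const, fun _ _ => rfl⟩⟩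

variable {I}

/-- Affine substitution in an analytic map. -/
theorem contMDiffAt_comp_affine {c : ℝ → M} {s k d : ℝ}
    (h : ContMDiffAt 𝓘(ℝ, ℝ) I ω c (k * s + d)) :
    ContMDiffAt 𝓘(ℝ, ℝ) I ω (fun r : ℝ => c (k * r + d)) s := by
  have h2 : ContMDiffAt 𝓘(ℝ, ℝ) 𝓘(ℝ, ℝ) ω (fun r : ℝ => k * r + d) s := by
    rw [contMDiffAt_iff_contDiffAt]
    fun_prop
  exact ContMDiffAt.comp (f := fun r : ℝ => k * r + d) s h h2

theorem IsPiecewiseAnalytic.symm {x y : M} {γ : Path x y} (h : IsPiecewiseAnalytic I γ) :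
    IsPiecewiseAnalytic I γ.symm := by
  obtain ⟨n, t, h0, h1, hm, ha⟩ := h
  refine ⟨n, fun i => 1 - t (n - i), by simp [h1], by simp [h0], fun i hi => ?_, fun i hi => ?_⟩
  · have := hm (n - (i + 1)) (by omega)
    rw [show n - (i + 1) + 1 = n - i by omega] at this
    dsimp only
    linarith
  · obtain ⟨c, hc, hγ⟩ := ha (n - (i + 1)) (by omega)
    rw [show n - (i + 1) + 1 = n - i by omega] at hc hγ
    refine ⟨fun r => c ((-1) * r + 1), fun s hs => contMDiffAt_comp_affine (hc _ ?_),
      fun s hs => ?_⟩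
    · exact ⟨by linarith [hs.2], by linarith [hs.1]⟩
    · have h3 := hγ (unitInterval.symm s)
        ⟨by rw [unitInterval.coe_symm_eq]; linarith [hs.2],
          by rw [unitInterval.coe_symm_eq]; linarith [hs.1]⟩
      rw [unitInterval.coe_symm_eq] at h3
      rw [Path.symm_apply, Function.comp_apply, h3]
      dsimp only
      congr 1
      ring

theorem IsPiecewiseAnalytic.trans {x y z : M} {γ : Path x y} {δ : Path y z}
    (hγ : IsPiecewiseAnalytic I γ) (hδ : IsPiecewiseAnalytic I δ) :
    IsPiecewiseAnalytic I (γ.trans δ) := by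
  obtain ⟨n, t, h0, h1, hm, ha⟩ := hγ
  obtain ⟨n', t', h0', h1', hm', ha'⟩ := hδ
  have ht : ∀ i ≤ n, t i ≤ 1 := fun i hi => by
    induction hi using Nat.decreasingInduction with
    | self => exact h1.le
    | of_succ k hk ih => exact (hm k hk).trans ih
  have ht' : ∀ i ≤ n', 0 ≤ t' i := fun i => by
    induction i with
    | zero => intro _; exact h0'.ge
    | succ k ih => intro hk; exact (ih (by omega)).trans (hm' k (by omega))
  -- the concatenated partition, written separately on both halves
  set T : ℕ → ℝ := fun i => if i ≤ n then t i / 2 else (t' (i - n) + 1) / 2 with hT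
  have hTl : ∀ i ≤ n, T i = t i / 2 := fun i hi => by simp [hT, hi]
  have hTr : ∀ i, T (n + i) = (t' i + 1) / 2 := fun i => by
    rcases Nat.eq_zero_or_pos i with rfl | hi
    · simp [hT, h1, h0']
    · simp only [hT]
      rw [if_neg (by omega), Nat.add_sub_cancel_left]
  have key : ∀ i < n + n', i < n ∨ ∃ j < n', i = n + j := fun i hi => by
    rcases lt_or_ge i n with h | h
    · exact Or.inl h
    · exact Or.inr ⟨i - n, by omega, by omega⟩
  refine ⟨n + n', T, by simp [hTl 0 (Nat.zero_le _), h0], by rw [hTr, h1']; norm_num,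
    fun i hi => ?_, fun i hi => ?_⟩
  · rcases key i hi with h | ⟨j, hj, rfl⟩
    · rw [hTl i h.le, hTl (i + 1) h]
      linarith [hm i h]
    · rw [hTr, add_assoc, hTr]
      linarith [hm' j hj]
  · rcases key i hi with h | ⟨j, hj, rfl⟩
    · rw [hTl i h.le, hTl (i + 1) h]
      obtain ⟨c, hc, hγ⟩ := ha i h
      refine ⟨fun r => c (2 * r + 0), fun s hs => contMDiffAt_comp_affine (hc _ ?_),
        fun s hs => ?_⟩
      · exact ⟨by linarith [hs.1], by linarith [hs.2]⟩
      · have hs2 : (s : ℝ) ≤ 1 / 2 := by linarith [hs.2, ht (i + 1) h]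
        rw [Path.trans_apply, dif_pos hs2, hγ _ ⟨by simp; linarith [hs.1], by simp; linarith [hs.2]⟩]
        simp
    · rw [hTr, add_assoc, hTr]
      obtain ⟨c, hc, hγ⟩ := ha' j hj
      refine ⟨fun r => c (2 * r + (-1)), fun s hs => contMDiffAt_comp_affine (hc _ ?_),
        fun s hs => ?_⟩
      · exact ⟨by linarith [hs.1], by linarith [hs.2]⟩
      · have hs2 : 1 / 2 ≤ (s : ℝ) := by linarith [hs.1, ht' j hj.le]
        rcases hs2.eq_or_lt with he | hlt
        · have hz : (0 : ℝ) ∈ Icc (t' j) (t' (j + 1)) :=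
            ⟨by linarith [hs.1], by linarith [ht' (j + 1) hj]⟩
          have h3 := hγ 0 (by simpa using hz)
          rw [Path.trans_apply, dif_pos he.ge]
          have h4 : (⟨2 * (s : ℝ), (unitInterval.mul_pos_mem_iff zero_lt_two).2 ⟨s.2.1, he.ge⟩⟩ :
              unitInterval) = 1 := by
            apply Subtype.ext
            simp [← he]
          rw [h4, γ.target, ← δ.source, h3, ← he]
          norm_num
        · rw [Path.trans_apply, dif_neg (not_le.2 hlt),
            hγ _ ⟨by simp; linarith [hs.1], by simp; linarith [hs.2]⟩]
          simp [sub_eq_add_neg]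

variable (I)

/-- Parametrized piecewise analytic loops based at `x`. -/
def PALoop (x : M) : Type _ := {γ : Path x x // IsPiecewiseAnalytic I γ}

end Loops

/-! ### Thin loops and thin equivalence -/

section Thin

variable {X : Type*} [TopologicalSpace X] {x : X}

/-- A loop is thin if it is homotopic to the constant loop at its base point by a homotopy (of based
loops) whose image is contained in the image of the loop. -/
def IsThin (α : Path x x) : Prop :=
  ∃ F : α.Homotopy (Path.refl x), ∀ z, F z ∈ range α

/-- Two loops `α`, `β` are thin-equivalent if `α β⁻¹` is thin. -/
def ThinEquiv (α β : Path x x) : Prop := IsThin (α.trans β.symm)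

/-- A loop in `X` with image in `S`, as a loop in `S`. -/
def liftPath (S : Set X) (p : Path x x) (h : range p ⊆ S) (hx : x ∈ S) :
    Path (⟨x, hx⟩ : S) ⟨x, hx⟩ where
  toFun t := ⟨p t, h ⟨t, rfl⟩⟩
  source' := by simp
  target' := by simp

theorem liftPath_trans {S : Set X} {p q : Path x x} (hp : range p ⊆ S) (hq : range q ⊆ S)
    (hpq : range (p.trans q) ⊆ S) (hx : x ∈ S) :
    liftPath S (p.trans q) hpq hx = (liftPath S p hp hx).trans (liftPath S q hq hx) := by
  ext t
  simp only [liftPath, Path.trans_apply, Path.coe_mk_mk]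
  split_ifs <;> rfl

/-- The class in the fundamental group of `S` of a loop with image in `S`. -/
def cls (S : Set X) (p : Path x x) (h : range p ⊆ S) (hx : x ∈ S) :
    FundamentalGroup S ⟨x, hx⟩ :=
  FundamentalGroup.fromPath (Path.Homotopic.Quotient.mk (liftPath S p h hx))

theorem cls_trans {S : Set X} {p q : Path x x} (hp : range p ⊆ S) (hq : range q ⊆ S)
    (hpq : range (p.trans q) ⊆ S) (hx : x ∈ S) :
    cls S (p.trans q) hpq hx = cls S q hq hx * cls S p hp hx := by
  rw [cls, liftPath_trans hp hq]
  rfl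

theorem cls_symm {S : Set X} {p : Path x x} (hp : range p ⊆ S)
    (hp' : range p.symm ⊆ S) (hx : x ∈ S) :
    cls S p.symm hp' hx = (cls S p hp hx)⁻¹ := rfl

theorem cls_refl {S : Set X} (hp : range (Path.refl x) ⊆ S) (hx : x ∈ S) :
    cls S (Path.refl x) hp hx = 1 := rfl

/-- Loops homotopic in `S` are homotopic in every larger set. -/
theorem cls_mono {S S' : Set X} (hSS : S ⊆ S') {p q : Path x x} (hp : range p ⊆ S)
    (hq : range q ⊆ S) (hx : x ∈ S) (h : cls S p hp hx = cls S q hq hx) :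
    cls S' p (hp.trans hSS) (hSS hx) = cls S' q (hq.trans hSS) (hSS hx) := by
  obtain ⟨F⟩ := Path.Homotopic.Quotient.exact h
  exact Path.Homotopic.Quotient.eq.2 ⟨F.map ⟨Set.inclusion hSS, continuous_inclusion hSS⟩⟩

theorem base_mem {S : Set X} {p : Path x x} (hp : range p ⊆ S) : x ∈ S := hp ⟨0, p.source⟩

theorem isThin_iff (α : Path x x) {S : Set X} (hS : range α = S) (h : range α ⊆ S) (hx : x ∈ S) :
    IsThin α ↔ cls S α h hx = 1 := by
  subst hS
  constructor
  · rintro ⟨F, hF⟩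
    refine Path.Homotopic.Quotient.eq.2 ⟨{
      toFun z := ⟨F z, hF z⟩
      map_zero_left t := Subtype.ext (by simp [liftPath])
      map_one_left t := Subtype.ext (by simp)
      prop' t s hs := Subtype.ext ?_ }⟩
    rcases hs with rfl | rfl <;> simp [liftPath]
  · intro h
    obtain ⟨F⟩ := Path.Homotopic.Quotient.exact h
    exact ⟨F.map ⟨Subtype.val, continuous_subtype_val⟩, fun z => (F z).2⟩

theorem thinEquiv_iff (α β : Path x x) :
    ThinEquiv α β ↔ cls (range α ∪ range β) α subset_union_left (base_mem subset_union_left) =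
      cls (range α ∪ range β) β subset_union_right (base_mem subset_union_left) := by
  have hr : range (α.trans β.symm) = range α ∪ range β := by
    rw [Path.trans_range, Path.symm_range]
  have hβ : range β.symm ⊆ range α ∪ range β := by rw [Path.symm_range]; exact subset_union_right
  rw [ThinEquiv, isThin_iff _ hr hr.le (base_mem hr.le),
    cls_trans (p := α) (q := β.symm) subset_union_left hβ,
    cls_symm (p := β) subset_union_right, inv_mul_eq_one, eq_comm]

theorem thinEquiv_of_cls {α β : Path x x}
    (h : ∀ (S : Set X) (hα : range α ⊆ S) (hβ : range β ⊆ S), S = range α ∪ range β →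
      cls S α hα (base_mem hα) = cls S β hβ (base_mem hα)) : ThinEquiv α β :=
  (thinEquiv_iff α β).2 (h _ subset_union_left subset_union_right rfl)

theorem ThinEquiv.cls_eq {α β : Path x x} (h : ThinEquiv α β) {S : Set X}
    (hα : range α ⊆ S) (hβ : range β ⊆ S) :
    cls S α hα (base_mem hα) = cls S β hβ (base_mem hα) :=
  cls_mono (union_subset hα hβ) _ _ _ ((thinEquiv_iff α β).1 h)

theorem ThinEquiv.trans_congr {α α' β β' : Path x x} (h : ThinEquiv α α') (h' : ThinEquiv β β') :
    ThinEquiv (α.trans β) (α'.trans β') := by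
  refine thinEquiv_of_cls fun S h1 h2 _ => ?_
  have h1' := h1
  have h2' := h2
  rw [Path.trans_range, union_subset_iff] at h1' h2'
  rw [cls_trans h1'.1 h1'.2, cls_trans h2'.1 h2'.2, h.cls_eq h1'.1 h2'.1, h'.cls_eq h1'.2 h2'.2]

theorem ThinEquiv.symm_congr {α α' : Path x x} (h : ThinEquiv α α') :
    ThinEquiv α.symm α'.symm := by
  refine thinEquiv_of_cls fun S h1 h2 _ => ?_
  have h1' := h1
  have h2' := h2
  rw [Path.symm_range] at h1' h2'
  rw [cls_symm h1', cls_symm h2', h.cls_eq h1' h2']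

theorem ThinEquiv.refl (α : Path x x) : ThinEquiv α α :=
  thinEquiv_of_cls fun _ _ _ _ => rfl

theorem thinEquiv_assoc (α β γ : Path x x) :
    ThinEquiv ((α.trans β).trans γ) (α.trans (β.trans γ)) := by
  refine thinEquiv_of_cls fun S h1 h2 _ => ?_
  have h1' := h1
  have h2' := h2
  simp only [Path.trans_range, union_subset_iff] at h1' h2'
  obtain ⟨⟨ha, hb⟩, hc⟩ := h1'
  have hab : range (α.trans β) ⊆ S := by rw [Path.trans_range]; exact union_subset ha hb
  have hbc : range (β.trans γ) ⊆ S := by rw [Path.trans_range]; exact union_subset hb hc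
  rw [cls_trans hab hc, cls_trans ha hb, cls_trans ha hbc, cls_trans hb hc, mul_assoc]

theorem thinEquiv_refl_trans (α : Path x x) : ThinEquiv ((Path.refl x).trans α) α := by
  refine thinEquiv_of_cls fun S h1 h2 _ => ?_
  have h3 := h1
  rw [Path.trans_range, union_subset_iff] at h3
  rw [cls_trans h3.1 h2, cls_refl, mul_one]

theorem thinEquiv_trans_refl (α : Path x x) : ThinEquiv (α.trans (Path.refl x)) α := by
  refine thinEquiv_of_cls fun S h1 h2 _ => ?_
  have h3 := h1
  rw [Path.trans_range, union_subset_iff] at h3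
  rw [cls_trans h2 h3.2, cls_refl, one_mul]

theorem thinEquiv_symm_trans (α : Path x x) : ThinEquiv (α.symm.trans α) (Path.refl x) := by
  refine thinEquiv_of_cls fun S h1 h2 _ => ?_
  have h3 := h1
  rw [Path.trans_range, union_subset_iff] at h3
  rw [cls_trans h3.1 h3.2, cls_symm h3.2, cls_refl, mul_inv_cancel]

end Thin

/-! ### The group of loops -/

section LoopGroup

variable {E : Type*} [NormedAddCommGroup E] [NormedSpace ℝ E]
  {H : Type*} [TopologicalSpace H] (I : ModelWithCorners ℝ E H)
  {M : Type*} [TopologicalSpace M] [ChartedSpace H M]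

/-- The group of loops: piecewise analytic loops based at `x` up to thin equivalence (that is,
up to the equivalence relation that thin equivalence generates). -/
def LoopGroup (x : M) : Type _ :=
  Quot fun α β : PALoop I x => ThinEquiv α.1 β.1

variable {I} {x : M}

/-- The class of a parametrized loop. -/
def LoopGroup.mk (α : PALoop I x) : LoopGroup I x := Quot.mk _ α

/-- The group structure: composition of loops. -/
instance : Group (LoopGroup I x) where
  mul := Quot.map₂ (fun α β => ⟨α.1.trans β.1, α.2.trans β.2⟩)
    (fun _ _ _ h => (ThinEquiv.refl _).trans_congr h)
    (fun _ _ _ h => h.trans_congr (ThinEquiv.refl _))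
  one := LoopGroup.mk ⟨Path.refl x, .refl I x⟩
  inv := Quot.map (fun α => ⟨α.1.symm, α.2.symm⟩) (fun _ _ h => h.symm_congr)
  mul_assoc := by
    rintro ⟨α⟩ ⟨β⟩ ⟨γ⟩
    exact Quot.sound (thinEquiv_assoc _ _ _)
  one_mul := by
    rintro ⟨α⟩
    exact Quot.sound (thinEquiv_refl_trans _)
  mul_one := by
    rintro ⟨α⟩
    exact Quot.sound (thinEquiv_trans_refl _)
  inv_mul_cancel := by
    rintro ⟨α⟩
    exact Quot.sound (thinEquiv_symm_trans _)

end LoopGroup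

/-! ### Principal `U(1)`-bundles, connections, holonomy -/

section Bundles

variable {E : Type*} [NormedAddCommGroup E] [NormedSpace ℝ E]
  {H : Type*} [TopologicalSpace H] (I : ModelWithCorners ℝ E H)
  {M : Type*} [TopologicalSpace M] [ChartedSpace H M]
  {F : Type*} [NormedAddCommGroup F] [NormedSpace ℝ F]
  {K : Type*} [TopologicalSpace K] (J : ModelWithCorners ℝ F K)
  {P : Type*} [TopologicalSpace P] [ChartedSpace K P] [MulAction Circle P]

/-- `π : P → M` is a smooth principal bundle with structure group `U(1) = Circle` (as the group is
abelian, left and right actions are the same): the action and the projection are smooth and there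
are smooth equivariant local trivializations. -/
structure IsPrincipalCircleBundle (π : P → M) : Prop where
  smooth_smul : ContMDiff ((𝓡 1).prod J) J ∞ (fun z : Circle × P => z.1 • z.2)
  smooth_proj : ContMDiff J I ∞ π
  locally_trivial : ∀ x : M, ∃ (U : Set M) (e : OpenPartialHomeomorph P (M × Circle)),
    IsOpen U ∧ x ∈ U ∧ e.source = π ⁻¹' U ∧ e.target = U ×ˢ univ ∧
    ContMDiffOn J (I.prod (𝓡 1)) ∞ e e.source ∧
    ContMDiffOn (I.prod (𝓡 1)) J ∞ e.symm e.target ∧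
    (∀ p ∈ e.source, (e p).1 = π p) ∧
    ∀ (g : Circle), ∀ p ∈ e.source, e (g • p) = ((e p).1, g * (e p).2)

variable (P) in
/-- A smooth principal connection on a `U(1)`-bundle with total space `P`, given by its connection
form. The Lie algebra `u(1) = iℝ` is identified with `ℝ` through `θ ↦ exp(iθ)`: the form is a smooth
`U(1)`-invariant real 1-form with value `1` on the fundamental vector field of the action. -/
structure Connection [IsManifold J ∞ P] where
  form : ∀ p : P, TangentSpace J p →L[ℝ] ℝ
  smooth_form : ContMDiff J.tangent 𝓘(ℝ, ℝ) ∞ (fun v : TangentBundle J P => form v.proj v.snd)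
  invariant : ∀ (g : Circle) (p : P) (v : TangentSpace J p),
    form (g • p) (mfderiv J J (fun q : P => g • q) p v) = form p v
  form_vertical : ∀ p : P,
    form (Circle.exp 0 • p) (mfderiv 𝓘(ℝ, ℝ) J (fun θ : ℝ => Circle.exp θ • p) 0 (1 : ℝ)) = 1

variable {J} [IsManifold J ∞ P]

/-- `u` is the horizontal lift of the loop `α` starting at `u₀`: it is continuous on `[0, 1]`, lies
over `α`, and outside a finite set of parameters it is differentiable with horizontal velocity. -/
def IsHorizontalLift (π : P → M) (A : Connection J P) {x : M} (α : Path x x) (u₀ : P)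
    (u : ℝ → P) : Prop :=
  ContinuousOn u (Icc 0 1) ∧ u 0 = u₀ ∧ (∀ s : unitInterval, π (u s) = α s) ∧
    ∃ S : Finset ℝ, ∀ t ∈ Ioo (0 : ℝ) 1, t ∉ S →
      MDifferentiableAt 𝓘(ℝ, ℝ) J u t ∧ A.form (u t) (mfderiv 𝓘(ℝ, ℝ) J u t (1 : ℝ)) = 0

/-- `g` is the holonomy of `A` around `α`: `u₀ = g • 𝒫(u₀)`, where `𝒫(u₀)` is the end point of the
horizontal lift of `α` starting at `u₀`. -/
def IsHolonomy (π : P → M) (A : Connection J P) (u₀ : P) {x : M} (α : Path x x)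
    (g : Circle) : Prop :=
  ∃ u : ℝ → P, IsHorizontalLift π A α u₀ u ∧ u₀ = g • u 1

/-- The holonomy `H_A(α) ∈ U(1)`. -/
def holonomy (π : P → M) (A : Connection J P) (u₀ : P) {x : M} (α : Path x x) : Circle :=
  Classical.epsilon (IsHolonomy π A u₀ α)

variable {I}

/-- The Wilson function `T_α` on the space of connections, `T_α(A) = (1/N) Tr H_A(α)`; here `N = 1`,
and the trace is the complex number `H_A(α)` itself. -/
def wilson (J : ModelWithCorners ℝ F K) [IsManifold J ∞ P] (π : P → M) (u₀ : P) {x : M}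
    (α : PALoop I x) : Connection J P → ℂ :=
  fun A => (holonomy π A u₀ α.1 : ℂ)

variable (I)

/-- The set of all Wilson functions of piecewise analytic loops based at `x`. -/
def Hoop (J : ModelWithCorners ℝ F K) [IsManifold J ∞ P] (π : P → M) (u₀ : P) (x : M) :
    Set (Connection J P → ℂ) :=
  range (fun α : PALoop I x => wilson J π u₀ α)

end Bundles

end LoopHoop

end

/-!
A piecewise analytic loop decomposes into finitely many edges: embedded arcs any two of which are
reparametrizations of each other or meet at most in end points. Locally this is the Puiseux
expansion, by which the germs of analytic curves through a point run along finitely many branches.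
Each edge is passed a certain number of times, counted with sign, and these counts decide
everything.

If all counts vanish, the class of the loop is a product of commutators: connecting the points of
the image to the base point turns the loop into a product of lassos, one for each passage of an
edge, and in the abelianization these cancel. Likewise the holonomy is a product of phases, one for
each passage, which reparametrizations of an edge preserve, so that it is trivial as well. The
counts of a thin loop vanish: a map to the circle that winds once around over a given edge and is
constant elsewhere on the image takes the null homotopy to the circle, where the count is a winding
number. Hence holonomy depends only on the class of the loop.

If some count is nonzero, let `ψ dh` be a 1-form supported near an interior point of the
corresponding edge. Adding it to a connection multiplies the holonomy by the exponential of `i`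
times the count times the integral of `ψ dh` over the edge, which is nontrivial for a suitable `ψ`.
-/

noncomputable section

namespace LoopHoop

open Filter Topology MeasureTheory

section RadialGerm

variable {V : Type*} [NormedAddCommGroup V]

section NormedSpace

variable [NormedSpace ℝ V]

/-- A germ at `0` of a Puiseux curve `ρ ↦ γ (ρ ^ (1 / k))`, with `γ` analytic and `γ 0 = 0`. These
parametrize the branches of an analytic curve by the distance to the branching point. -/
def IsRadialGerm (σ : ℝ → V) : Prop :=
  σ 0 = 0 ∧ ∃ k : ℕ, k ≠ 0 ∧ ∃ γ : ℝ → V, AnalyticAt ℝ γ 0 ∧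
    ∀ ρ, 0 ≤ ρ → σ ρ = γ (ρ ^ ((k : ℝ)⁻¹))

theorem tendsto_rpow_const_nhdsGT_zero {r : ℝ} (hr : 0 < r) :
    Tendsto (fun ρ : ℝ => ρ ^ r) (𝓝[>] 0) (𝓝[>] 0) := by
  refine tendsto_nhdsWithin_iff.2 ⟨?_, ?_⟩
  · have hcont := (Real.continuousAt_rpow_const 0 r (Or.inr hr.le)).tendsto
    rw [Real.zero_rpow hr.ne'] at hcont
    exact hcont.mono_left nhdsWithin_le_nhds
  · filter_upwards [self_mem_nhdsWithin] with ρ hρ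
    exact Real.rpow_pos_of_pos hρ _

theorem rpow_inv_mul_pow {ρ : ℝ} (hρ : 0 ≤ ρ) (k : ℕ) {l : ℕ} (hl : l ≠ 0) :
    (ρ ^ ((k * l : ℕ) : ℝ)⁻¹) ^ l = ρ ^ (k : ℝ)⁻¹ := by
  rw [← Real.rpow_natCast, ← Real.rpow_mul hρ]
  congr 1
  push_cast
  field_simp

theorem IsRadialGerm.exists_common_exponent {σ τ : ℝ → V} (hσ : IsRadialGerm σ)
    (hτ : IsRadialGerm τ) :
    ∃ m : ℕ, m ≠ 0 ∧ ∃ γ δ : ℝ → V, AnalyticAt ℝ γ 0 ∧ AnalyticAt ℝ δ 0 ∧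
      ∀ ρ, 0 ≤ ρ → σ ρ = γ (ρ ^ ((m : ℝ)⁻¹)) ∧ τ ρ = δ (ρ ^ ((m : ℝ)⁻¹)) := by
  obtain ⟨-, k, hk, γ, hγ, hσγ⟩ := hσ
  obtain ⟨-, l, hl, δ, hδ, hτδ⟩ := hτ
  refine ⟨k * l, mul_ne_zero hk hl, fun z => γ (z ^ l), fun z => δ (z ^ k),
    AnalyticAt.fun_comp (f := fun z : ℝ => z ^ l) (by simpa [hl] using hγ) (by fun_prop),
    AnalyticAt.fun_comp (f := fun z : ℝ => z ^ k) (by simpa [hk] using hδ) (by fun_prop),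
    fun ρ hρ => ⟨?_, ?_⟩⟩
  · simp only [hσγ ρ hρ, rpow_inv_mul_pow hρ k hl]
  · simp only [hτδ ρ hρ, mul_comm k l, rpow_inv_mul_pow hρ l hk]

theorem IsRadialGerm.eventually_eq_or_ne {σ τ : ℝ → V} (hσ : IsRadialGerm σ)
    (hτ : IsRadialGerm τ) :
    (∀ᶠ ρ in 𝓝[>] 0, σ ρ = τ ρ) ∨ ∀ᶠ ρ in 𝓝[>] 0, σ ρ ≠ τ ρ := by
  obtain ⟨m, hm, γ, δ, hγ, hδ, heq⟩ := hσ.exists_common_exponent hτ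
  have hroot := tendsto_rpow_const_nhdsGT_zero (r := (m : ℝ)⁻¹) (by positivity)
  refine (hγ.eventually_eq_or_eventually_ne hδ).imp (fun h => ?_) fun h => ?_
  · filter_upwards [hroot.eventually (h.filter_mono nhdsWithin_le_nhds), self_mem_nhdsWithin]
      with ρ h hρ
    rw [(heq ρ (le_of_lt hρ)).1, (heq ρ (le_of_lt hρ)).2, h]
  · filter_upwards [hroot.eventually (h.filter_mono (nhdsGT_le_nhdsNE 0)), self_mem_nhdsWithin]
      with ρ h hρ
    rwa [(heq ρ (le_of_lt hρ)).1, (heq ρ (le_of_lt hρ)).2]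

theorem IsRadialGerm.eventually_continuousOn [CompleteSpace V] {σ : ℝ → V}
    (hσ : IsRadialGerm σ) : ∀ᶠ ε in 𝓝[>] 0, ContinuousOn σ (Icc 0 ε) := by
  obtain ⟨-, k, hk, γ, hγ, hσγ⟩ := hσ
  have hroot : Continuous fun ρ : ℝ => ρ ^ ((k : ℝ)⁻¹) := Real.continuous_rpow_const (by positivity)
  have hroot0 : Tendsto (fun ρ : ℝ => ρ ^ ((k : ℝ)⁻¹)) (𝓝[≥] 0) (𝓝 0) := by
    simpa [Real.zero_rpow (inv_ne_zero (Nat.cast_ne_zero.2 hk))] using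
      (hroot.tendsto 0).mono_left (nhdsWithin_le_nhds (s := Ici 0))
  obtain ⟨r, hr, hsub⟩ := mem_nhdsGE_iff_exists_Ico_subset.1
    (hroot0.eventually (hγ.eventually_analyticAt.mono fun _ h => h.continuousAt))
  filter_upwards [Ioo_mem_nhdsGT hr] with ε hε
  refine ContinuousOn.congr (fun ρ hρ => ?_) fun ρ hρ => hσγ ρ hρ.1
  have hγρ : ContinuousAt γ (ρ ^ ((k : ℝ)⁻¹)) := hsub ⟨hρ.1, hρ.2.trans_lt hε.2⟩
  exact (hγρ.comp (f := fun ρ : ℝ => ρ ^ ((k : ℝ)⁻¹)) hroot.continuousAt).continuousWithinAt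

end NormedSpace

theorem eventually_deriv_ne_zero_of_not_eventually_eq {g : ℝ → ℝ} {t₀ : ℝ}
    (hg : AnalyticAt ℝ g t₀) (hne : ¬∀ᶠ t in 𝓝 t₀, g t = g t₀) :
    ∀ᶠ t in 𝓝[≠] t₀, deriv g t ≠ 0 := by
  refine hg.deriv.eventually_eq_zero_or_eventually_ne_zero.resolve_left fun hderiv => hne ?_
  obtain ⟨r, hr, hball⟩ := Metric.eventually_nhds_iff_ball.1
    (hderiv.and (hg.eventually_analyticAt.mono fun _ h => h.differentiableAt))
  filter_upwards [Metric.ball_mem_nhds t₀ hr] with t ht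
  exact Metric.isOpen_ball.is_const_of_deriv_eq_zero (convex_ball t₀ r).isPreconnected
    (fun s hs => (hball s hs).2.differentiableWithinAt) (fun s hs => (hball s hs).1) ht
    (Metric.mem_ball_self hr)

section InnerProductSpace

variable [InnerProductSpace ℝ V] [CompleteSpace V]

theorem eventually_deriv_normSq_ne_zero {c : ℝ → V} {t₀ : ℝ} (hc : AnalyticAt ℝ c t₀)
    (h0 : c t₀ = 0) (hne : ¬∀ᶠ t in 𝓝 t₀, c t = 0) :
    ∀ᶠ t in 𝓝[≠] t₀, deriv (fun s => ‖c s‖ ^ 2) t ≠ 0 := by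
  refine eventually_deriv_ne_zero_of_not_eventually_eq
    (hc.contDiffAt.norm_sq ℝ (n := ω)).analyticAt fun h => hne (h.mono fun t ht => ?_)
  simpa [h0] using ht

theorem exists_analyticAt_norm_eq_abs_pow {c : ℝ → V} {t₀ : ℝ} (hc : AnalyticAt ℝ c t₀)
    (h0 : c t₀ = 0) (hne : ¬∀ᶠ t in 𝓝 t₀, c t = 0) :
    ∃ k : ℕ, k ≠ 0 ∧ ∃ s : ℝ → ℝ, AnalyticAt ℝ s t₀ ∧ s t₀ = 0 ∧ deriv s t₀ ≠ 0 ∧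
      ∀ᶠ t in 𝓝 t₀, ‖c t‖ = |s t| ^ k := by
  obtain ⟨k, a, ha, ha0, hca⟩ := hc.exists_eventuallyEq_pow_smul_nonzero_iff.2 hne
  have hk : k ≠ 0 := by
    rintro rfl
    exact ha0 (by simpa [h0] using hca.self_of_nhds.symm)
  have hroot : AnalyticAt ℝ (fun t => ‖a t‖ ^ ((k : ℝ)⁻¹)) t₀ :=
    ((ha.contDiffAt.norm ℝ ha0).rpow_const_of_ne (n := ω) (norm_ne_zero_iff.2 ha0)).analyticAt
  have hlin : AnalyticAt ℝ (fun t : ℝ => t - t₀) t₀ := by fun_prop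
  refine ⟨k, hk, fun t => (t - t₀) * ‖a t‖ ^ ((k : ℝ)⁻¹), hlin.mul hroot, by simp, ?_, ?_⟩
  · have hd : HasDerivAt (fun t => (t - t₀) * ‖a t‖ ^ ((k : ℝ)⁻¹)) _ t₀ :=
      ((hasDerivAt_id t₀).sub_const t₀).mul hroot.differentiableAt.hasDerivAt
    rw [hd.deriv, id, sub_self, zero_mul, add_zero, one_mul]
    exact (Real.rpow_pos_of_pos (norm_pos_iff.2 ha0) _).ne'
  · filter_upwards [hca] with t ht
    rw [ht, norm_smul, norm_pow, abs_mul, abs_of_nonneg (Real.rpow_nonneg (norm_nonneg (a t)) _),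
      mul_pow, Real.rpow_inv_natCast_pow (norm_nonneg _) hk, Real.norm_eq_abs]

/-- The signed `k`-th root `s` of the norm is a local coordinate on the line, so `c` is an analytic
function of `s`, and `s = ±‖c‖ ^ (1 / k)`. -/
theorem exists_finite_isRadialGerm {c : ℝ → V} {t₀ : ℝ}
    (hc : AnalyticAt ℝ c t₀) (h0 : c t₀ = 0) (hne : ¬∀ᶠ t in 𝓝 t₀, c t = 0) :
    ∃ B : Set (ℝ → V), B.Finite ∧ (∀ σ ∈ B, IsRadialGerm σ) ∧
      ∀ᶠ t in 𝓝 t₀, ∃ σ ∈ B, c t = σ ‖c t‖ := by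
  obtain ⟨k, hk, s, hs, hs0, hds, hnorm⟩ := exists_analyticAt_norm_eq_abs_pow hc h0 hne
  have hT := hs.analyticAt_localInverse hds
  have hTs := hs.hasStrictDerivAt.eventually_left_inverse hds
  set T := hs.hasStrictDerivAt.localInverse _ _ _ hds
  rw [hs0] at hT
  have hT0 : T 0 = t₀ := hs0 ▸ hTs.self_of_nhds
  let σ : ℝ → ℝ → V := fun e ρ => c (T (e * ρ ^ ((k : ℝ)⁻¹)))
  have hσ : ∀ e, IsRadialGerm (σ e) := fun e => by
    refine ⟨by simp [σ, Real.zero_rpow (inv_ne_zero (Nat.cast_ne_zero.2 hk)), hT0, h0], k, hk,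
      fun z => c (T (e * z)), ?_, fun _ _ => rfl⟩
    refine AnalyticAt.fun_comp (f := fun z => T (e * z)) (by simpa [hT0] using hc) ?_
    exact AnalyticAt.fun_comp (f := fun z : ℝ => e * z) (by simpa using hT) (by fun_prop)
  have hroot : ∀ᶠ t in 𝓝 t₀, ‖c t‖ ^ ((k : ℝ)⁻¹) = |s t| :=
    hnorm.mono fun t ht => by rw [ht, Real.pow_rpow_inv_natCast (abs_nonneg _) hk]
  refine ⟨{σ 1, σ (-1)}, toFinite _, by simp [hσ], ?_⟩
  filter_upwards [hroot, hTs] with t ht hTt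
  rcases abs_choice (s t) with h | h
  · exact ⟨σ 1, by simp, by simp only [σ, ht, h, one_mul, hTt]⟩
  · exact ⟨σ (-1), by simp, by simp only [σ, ht, h, neg_one_mul, neg_neg, hTt]⟩

end InnerProductSpace

end RadialGerm

section Star

theorem eventually_eventuallyEq_of_isOpen {X Y : Type*} [TopologicalSpace X] {U : Set X}
    (hU : IsOpen U) {f g : X → Y} {x : X} (h : f =ᶠ[𝓝[U] x] g) :
    ∀ᶠ y in 𝓝[U] x, f =ᶠ[𝓝 y] g := by
  filter_upwards [eventually_eventually_nhdsWithin.2 h, self_mem_nhdsWithin] with y hy hyU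
  rwa [hU.nhdsWithin_eq hyU] at hy

variable {E : Type*} [NormedAddCommGroup E] [NormedSpace ℝ E]
  {H : Type*} [TopologicalSpace H] (I : ModelWithCorners ℝ E H)
  {M : Type*} [TopologicalSpace M] [ChartedSpace H M]

/-- The curve `f` has analytic one-sided germs: near every parameter it agrees on each side with an
analytic curve. This is piecewise analyticity without an explicit partition. -/
def HasAnalyticGerms (f : ℝ → M) : Prop :=
  ∀ t, (∃ c : ℝ → M, ContMDiffAt 𝓘(ℝ, ℝ) I ω c t ∧ ∀ᶠ s in 𝓝[≥] t, f s = c s) ∧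
    ∃ c : ℝ → M, ContMDiffAt 𝓘(ℝ, ℝ) I ω c t ∧ ∀ᶠ s in 𝓝[≤] t, f s = c s

variable {I} in
theorem IsPiecewiseAnalytic.exists_right_germ {x y : M} {γ : Path x y}
    (h : IsPiecewiseAnalytic I γ) (r : ℝ) :
    ∃ c : ℝ → M, ContMDiffAt 𝓘(ℝ, ℝ) I ω c r ∧ ∀ᶠ s in 𝓝[≥] r, γ.extend s = c s := by
  obtain ⟨n, t, h0, h1, -, ha⟩ := h
  rcases lt_or_ge r 0 with hr | hr
  · refine ⟨fun _ => x, contMDiffAt_const, ?_⟩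
    filter_upwards [nhdsWithin_le_nhds (Iio_mem_nhds hr)] with s hs
    exact γ.extend_of_le_zero hs.le
  rcases lt_or_ge r 1 with hr1 | hr1
  · have hex : ∃ j, r < t j := ⟨n, by rwa [h1]⟩
    classical
    have hlt := Nat.find_spec hex
    have hle : Nat.find hex ≤ n := Nat.find_min' hex (by rwa [h1])
    obtain ⟨i, hi⟩ : ∃ i, Nat.find hex = i + 1 := by
      refine Nat.exists_eq_succ_of_ne_zero fun h => ?_
      rw [h, h0] at hlt
      exact hlt.not_ge hr
    have hti : t i ≤ r := not_lt.1 (Nat.find_min hex (by omega : i < Nat.find hex))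
    rw [hi] at hlt hle
    obtain ⟨c, hc, hγ⟩ := ha i hle
    refine ⟨c, hc r ⟨hti, hlt.le⟩, ?_⟩
    filter_upwards [nhdsWithin_le_nhds (Iio_mem_nhds hlt), nhdsWithin_le_nhds (Iio_mem_nhds hr1),
      self_mem_nhdsWithin] with s hs hs1 hs0
    have hs' : s ∈ unitInterval := ⟨hr.trans hs0, hs1.le⟩
    rw [γ.extend_apply hs', hγ ⟨s, hs'⟩ ⟨hti.trans hs0, hs.le⟩]
  · refine ⟨fun _ => y, contMDiffAt_const, ?_⟩
    filter_upwards [self_mem_nhdsWithin] with s hs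
    exact γ.extend_of_one_le (hr1.trans hs)

variable {I} in
theorem IsPiecewiseAnalytic.hasAnalyticGerms {x y : M} {γ : Path x y}
    (h : IsPiecewiseAnalytic I γ) : HasAnalyticGerms I γ.extend := by
  refine fun t => ⟨h.exists_right_germ t, ?_⟩
  obtain ⟨c, hc, hγ⟩ := h.symm.exists_right_germ (-1 * t + 1)
  refine ⟨fun s => c (-1 * s + 1), contMDiffAt_comp_affine hc, ?_⟩
  have ht : Tendsto (fun s : ℝ => -1 * s + 1) (𝓝[≤] t) (𝓝[≥] (-1 * t + 1)) := by
    refine tendsto_nhdsWithin_iff.2 ⟨?_, ?_⟩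
    · exact ((by fun_prop : Continuous fun s : ℝ => -1 * s + 1).tendsto t).mono_left
        nhdsWithin_le_nhds
    · filter_upwards [self_mem_nhdsWithin] with s hs
      simp only [mem_Iic, mem_Ici] at hs ⊢
      linarith
  filter_upwards [ht.eventually hγ] with s hs
  rw [← hs, Path.extend_symm]
  congr 1
  ring

/-- The Euclidean space of the dimension of `E`: the model space of `M` with a norm whose square is
analytic. -/
abbrev EuclideanModel (E : Type*) [NormedAddCommGroup E] [NormedSpace ℝ E] : Type :=
  EuclideanSpace ℝ (Fin (Module.finrank ℝ E))

variable [FiniteDimensional ℝ E]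

/-- The chart at `p`, centred at `p` and composed with a linear isomorphism to a Euclidean space. -/
def radialChart (p q : M) : EuclideanModel E :=
  toEuclidean (extChartAt I p q - extChartAt I p p)

/-- The ball of radius `ε` about `p` in the chart `radialChart I p`; its radius is not assumed to be
small enough for the ball to be relatively compact in the chart. -/
def coordBall (p : M) (ε : ℝ) : Set M :=
  {q | q ∈ (chartAt H p).source ∧ ‖radialChart I p q‖ < ε}

@[simp] theorem radialChart_self (p : M) : radialChart I p p = 0 := by simp [radialChart]

theorem continuousOn_radialChart (p : M) :
    ContinuousOn (radialChart I p) (chartAt H p).source := by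
  have := continuousOn_extChartAt (I := I) p
  rw [extChartAt_source] at this
  exact toEuclidean.continuous.comp_continuousOn (this.sub continuousOn_const)

theorem injOn_radialChart (p : M) : InjOn (radialChart I p) (chartAt H p).source := by
  intro q hq q' hq' h
  have h2 := toEuclidean.injective h
  rw [sub_left_inj] at h2
  exact (extChartAt I p).injOn (by rwa [extChartAt_source]) (by rwa [extChartAt_source]) h2

theorem radialChart_eq_zero_iff {p q : M} (hq : q ∈ (chartAt H p).source) :
    radialChart I p q = 0 ↔ q = p := by
  rw [← radialChart_self I p]
  exact (injOn_radialChart I p).eq_iff hq (mem_chart_source H p)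

theorem isOpen_coordBall (p : M) (ε : ℝ) : IsOpen (coordBall I p ε) := by
  have := (continuousOn_radialChart I p).norm.isOpen_inter_preimage (chartAt H p).open_source
    (isOpen_Iio (a := ε))
  exact this

theorem self_mem_coordBall (p : M) {ε : ℝ} (h : 0 < ε) : p ∈ coordBall I p ε :=
  ⟨mem_chart_source H p, by simpa⟩

variable {I} in
theorem coordBall_mono {p : M} {ε δ : ℝ} (h : ε ≤ δ) : coordBall I p ε ⊆ coordBall I p δ :=
  fun _ hq => ⟨hq.1, hq.2.trans_le h⟩

theorem exists_coordBall_subset {p : M} {U : Set M} (hU : U ∈ 𝓝 p) :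
    ∃ ε > 0, coordBall I p ε ⊆ U := by
  have h1 := (continuousAt_extChartAt_symm (I := I) p).preimage_mem_nhds (t := U) (by
    rwa [extChartAt_to_inv])
  have h2 : Tendsto (fun v => toEuclidean.symm v + extChartAt I p p)
      (𝓝 (0 : EuclideanSpace ℝ (Fin (Module.finrank ℝ E)))) (𝓝 (extChartAt I p p)) := by
    have : Continuous fun v : EuclideanSpace ℝ (Fin (Module.finrank ℝ E)) =>
      toEuclidean.symm v + extChartAt I p p := by fun_prop
    simpa using this.tendsto 0
  obtain ⟨ε, hε, hb⟩ := Metric.mem_nhds_iff.1 (h2 h1)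
  refine ⟨ε, hε, fun q hq => ?_⟩
  have := hb (show radialChart I p q ∈ Metric.ball _ ε by simpa using hq.2)
  simpa [radialChart, (chartAt H p).left_inv hq.1] using this

/-- At the parameter `t` the curve `f` is analytic, lies on the branch `σ` in the chart at `p`, and
its distance to `p` in this chart has nonzero derivative. The distance enters squared, which keeps
it analytic. -/
structure RadialAt (f : ℝ → M) (p : M) (σ : ℝ → EuclideanModel E) (t : ℝ) : Prop where
  mem : f t ∈ (chartAt H p).source
  ne : f t ≠ p
  branch : radialChart I p (f t) = σ ‖radialChart I p (f t)‖
  deriv_ne : deriv (fun s => ‖radialChart I p (f s)‖ ^ 2) t ≠ 0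
  analytic : ContMDiffAt 𝓘(ℝ, ℝ) I ω f t

/-- Along the filter `l` the curve `f` sits at `p` or runs radially along one of finitely many
branches emanating from `p`. -/
def EventuallyRadial (f : ℝ → M) (p : M) (l : Filter ℝ) : Prop :=
  ∃ B : Set (ℝ → EuclideanModel E), B.Finite ∧ (∀ σ ∈ B, IsRadialGerm σ) ∧
    ∀ᶠ t in l, f t = p ∨ ∃ σ ∈ B, RadialAt I f p σ t

variable {I}

theorem radialAt_of_eventuallyEq {f c : ℝ → M} {p : M} {σ : ℝ → EuclideanModel E} {t : ℝ}
    (hfc : f =ᶠ[𝓝 t] c) (hc : ContMDiffAt 𝓘(ℝ, ℝ) I ω c t) (hs : c t ∈ (chartAt H p).source)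
    (hbranch : radialChart I p (c t) = σ ‖radialChart I p (c t)‖)
    (hderiv : deriv (fun s => ‖radialChart I p (c s)‖ ^ 2) t ≠ 0) (hne : c t ≠ p) :
    RadialAt I f p σ t where
  mem := by rwa [hfc.self_of_nhds]
  ne := by rwa [hfc.self_of_nhds]
  branch := by rwa [hfc.self_of_nhds]
  deriv_ne := by rwa [Filter.EventuallyEq.deriv_eq (hfc.mono fun s hs => by rw [hs])]
  analytic := hc.congr_of_eventuallyEq hfc

theorem EventuallyRadial.mono {f : ℝ → M} {p : M} {l l' : Filter ℝ}
    (h : EventuallyRadial I f p l) (hl : l' ≤ l) : EventuallyRadial I f p l' :=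
  let ⟨B, hB, hrad, hev⟩ := h
  ⟨B, hB, hrad, hev.filter_mono hl⟩

theorem eventuallyRadial_of_eventually_eq {f : ℝ → M} {p : M} {l : Filter ℝ}
    (h : ∀ᶠ t in l, f t = p) : EventuallyRadial I f p l :=
  ⟨∅, finite_empty, by simp, h.mono fun _ => Or.inl⟩

theorem EventuallyRadial.sup {f : ℝ → M} {p : M} {l l' : Filter ℝ}
    (h : EventuallyRadial I f p l) (h' : EventuallyRadial I f p l') :
    EventuallyRadial I f p (l ⊔ l') := by
  obtain ⟨B, hB, hrad, hev⟩ := h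
  obtain ⟨B', hB', hrad', hev'⟩ := h'
  refine ⟨B ∪ B', hB.union hB', fun σ => Or.rec (hrad σ) (hrad' σ), eventually_sup.2 ⟨?_, ?_⟩⟩
  · exact hev.mono fun t => Or.imp_right fun ⟨σ, hσ, h⟩ => ⟨σ, Or.inl hσ, h⟩
  · exact hev'.mono fun t => Or.imp_right fun ⟨σ, hσ, h⟩ => ⟨σ, Or.inr hσ, h⟩

variable [IsManifold I ω M]

variable (I) in
theorem contMDiffOn_radialChart (p : M) :
    ContMDiffOn I 𝓘(ℝ, EuclideanModel E) ω (radialChart I p) (chartAt H p).source := by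
  have hchart := contMDiffOn_extChartAt (I := I) (n := ω) (x := p)
  have hlin : ContMDiff 𝓘(ℝ, E) 𝓘(ℝ, EuclideanModel E) ω
      (fun v : E => toEuclidean (v - extChartAt I p p)) := by
    rw [contMDiff_iff_contDiff]
    fun_prop
  exact hlin.comp_contMDiffOn hchart

theorem analyticAt_radialChart_comp {p : M} {c : ℝ → M} {t : ℝ}
    (hc : ContMDiffAt 𝓘(ℝ, ℝ) I ω c t) (hp : c t ∈ (chartAt H p).source) :
    AnalyticAt ℝ (fun s => radialChart I p (c s)) t := by
  have h := (contMDiffOn_radialChart I p).contMDiffAt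
    ((chartAt H p).open_source.mem_nhds hp)
  exact (contMDiffAt_iff_contDiffAt.1 (ContMDiffAt.comp t h hc)).analyticAt

theorem exists_finite_radialAt_of_contMDiffAt {f c : ℝ → M} {t₀ : ℝ} {l : Filter ℝ}
    (hc : ContMDiffAt 𝓘(ℝ, ℝ) I ω c t₀) (hl : l ≤ 𝓝[≠] t₀) (hfc : ∀ᶠ t in l, f =ᶠ[𝓝 t] c)
    (hne : ¬∀ᶠ t in 𝓝 t₀, c t = c t₀) :
    ∃ B : Set (ℝ → EuclideanModel E), B.Finite ∧ (∀ σ ∈ B, IsRadialGerm σ) ∧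
      ∀ᶠ t in l, ∃ σ ∈ B, RadialAt I f (c t₀) σ t := by
  have hsrc : ∀ᶠ t in 𝓝 t₀, c t ∈ (chartAt H (c t₀)).source :=
    hc.continuousAt.eventually ((chartAt H (c t₀)).open_source.mem_nhds (mem_chart_source H _))
  have han := analyticAt_radialChart_comp hc (mem_chart_source H (c t₀))
  have hne' : ¬∀ᶠ t in 𝓝 t₀, radialChart I (c t₀) (c t) = 0 := fun h => hne <| by
    filter_upwards [h, hsrc] with t ht hts using (radialChart_eq_zero_iff I hts).1 ht
  obtain ⟨B, hB, hrad, hbranch⟩ := exists_finite_isRadialGerm han (radialChart_self I _) hne'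
  refine ⟨B, hB, hrad, ?_⟩
  have hnhds := hl.trans nhdsWithin_le_nhds
  filter_upwards [hfc, hnhds hsrc, hnhds hbranch,
    hnhds ((contMDiffAt_iff_contMDiffAt_nhds (by simp)).1 hc),
    hl (eventually_deriv_normSq_ne_zero han (radialChart_self I _) hne'),
    hl (han.eventually_eq_zero_or_eventually_ne_zero.resolve_left hne')]
    with t hft hts ⟨σ, hσ, hct⟩ hcan hderiv hzero
  exact ⟨σ, hσ, radialAt_of_eventuallyEq hft hcan hts hct hderiv
    fun h => hzero (by rw [h, radialChart_self])⟩

theorem HasAnalyticGerms.right {f : ℝ → M} (hf : HasAnalyticGerms I f) (t₀ : ℝ) :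
    (∀ᶠ t in 𝓝[>] t₀, f t = f t₀) ∨ ∃ B : Set (ℝ → EuclideanModel E), B.Finite ∧
      (∀ σ ∈ B, IsRadialGerm σ) ∧ ∀ᶠ t in 𝓝[>] t₀, ∃ σ ∈ B, RadialAt I f (f t₀) σ t := by
  obtain ⟨c, hc, hfc⟩ := (hf t₀).1
  have h0 : f t₀ = c t₀ := hfc.self_of_nhdsWithin self_mem_Ici
  have hfc' : f =ᶠ[𝓝[>] t₀] c := hfc.filter_mono (nhdsWithin_mono t₀ Ioi_subset_Ici_self)
  rw [h0]
  by_cases hconst : ∀ᶠ t in 𝓝 t₀, c t = c t₀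
  · exact Or.inl (hfc'.trans (nhdsWithin_le_nhds hconst))
  · exact Or.inr (exists_finite_radialAt_of_contMDiffAt hc (nhdsGT_le_nhdsNE t₀)
      (eventually_eventuallyEq_of_isOpen isOpen_Ioi hfc') hconst)

theorem HasAnalyticGerms.left {f : ℝ → M} (hf : HasAnalyticGerms I f) (t₀ : ℝ) :
    (∀ᶠ t in 𝓝[<] t₀, f t = f t₀) ∨ ∃ B : Set (ℝ → EuclideanModel E), B.Finite ∧
      (∀ σ ∈ B, IsRadialGerm σ) ∧ ∀ᶠ t in 𝓝[<] t₀, ∃ σ ∈ B, RadialAt I f (f t₀) σ t := by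
  obtain ⟨c, hc, hfc⟩ := (hf t₀).2
  have h0 : f t₀ = c t₀ := hfc.self_of_nhdsWithin self_mem_Iic
  have hfc' : f =ᶠ[𝓝[<] t₀] c := hfc.filter_mono (nhdsWithin_mono t₀ Iio_subset_Iic_self)
  rw [h0]
  by_cases hconst : ∀ᶠ t in 𝓝 t₀, c t = c t₀
  · exact Or.inl (hfc'.trans (nhdsWithin_le_nhds hconst))
  · exact Or.inr (exists_finite_radialAt_of_contMDiffAt hc (nhdsLT_le_nhdsNE t₀)
      (eventually_eventuallyEq_of_isOpen isOpen_Iio hfc') hconst)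

theorem HasAnalyticGerms.eventuallyRadial_nhds {f : ℝ → M} (hf : HasAnalyticGerms I f)
    (t₀ : ℝ) : EventuallyRadial I f (f t₀) (𝓝 t₀) := by
  have hside : ∀ {l : Filter ℝ}, ((∀ᶠ t in l, f t = f t₀) ∨
      ∃ B : Set (ℝ → EuclideanModel E), B.Finite ∧ (∀ σ ∈ B, IsRadialGerm σ) ∧
        ∀ᶠ t in l, ∃ σ ∈ B, RadialAt I f (f t₀) σ t) → EventuallyRadial I f (f t₀) l := by
    rintro l (h | ⟨B, hB, hrad, h⟩)
    · exact eventuallyRadial_of_eventually_eq h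
    · exact ⟨B, hB, hrad, h.mono fun _ => Or.inr⟩
  rw [← nhdsNE_sup_pure, ← nhdsLT_sup_nhdsGT]
  exact ((hside (hf.left t₀)).sup (hside (hf.right t₀))).sup
    (eventuallyRadial_of_eventually_eq (eventually_pure.2 rfl))

theorem HasAnalyticGerms.eventuallyRadial_comap [T2Space M] {f : ℝ → M}
    (hf : HasAnalyticGerms I f) (hfc : Continuous f) (p : M) {K : Set ℝ} (hK : IsCompact K) :
    EventuallyRadial I f p (𝓟 K ⊓ comap f (𝓝 p)) := by
  refine hK.induction_on (p := fun s => EventuallyRadial I f p (𝓟 s ⊓ comap f (𝓝 p))) ?_ ?_ ?_ ?_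
  · exact eventuallyRadial_of_eventually_eq (by simp)
  · exact fun s t hst h => h.mono (inf_le_inf_right _ (principal_mono.2 hst))
  · intro s t hs ht
    rw [← sup_principal, inf_sup_right]
    exact hs.sup ht
  · intro t₀ _
    by_cases h0 : f t₀ = p
    · obtain ⟨B, hB, hrad, h⟩ := h0 ▸ hf.eventuallyRadial_nhds t₀
      exact ⟨_, mem_nhdsWithin_of_mem_nhds h, B, hB, hrad,
        mem_inf_of_left (mem_principal_self _)⟩
    · obtain ⟨u, hu, v, hv, huv⟩ := Filter.disjoint_iff.1 (disjoint_nhds_nhds.2 h0)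
      refine ⟨_, mem_nhdsWithin_of_mem_nhds (hfc.continuousAt.preimage_mem_nhds hu),
        eventuallyRadial_of_eventually_eq ?_⟩
      filter_upwards [mem_inf_of_left (mem_principal_self (f ⁻¹' u)),
        mem_inf_of_right (preimage_mem_comap hv)] with t htu htv
      exact (huv.ne_of_mem htu htv rfl).elim

variable (I) in
/-- In the coordinate ball of radius `ε` around `p` the image of `f` is a star with centre `p` and
branches in `B`. The radius is small enough for two branches to coincide or to be disjoint away
from `p`. -/
structure IsStar (f : ℝ → M) (p : M) (ε : ℝ) (B : Set (ℝ → EuclideanModel E)) : Prop where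
  pos : 0 < ε
  finite : B.Finite
  zero : ∀ σ ∈ B, σ 0 = 0
  cont : ∀ σ ∈ B, ContinuousOn σ (Icc 0 ε)
  eq_or_ne : ∀ σ ∈ B, ∀ τ ∈ B, (∀ ρ ∈ Ioc 0 ε, σ ρ = τ ρ) ∨ ∀ ρ ∈ Ioc 0 ε, σ ρ ≠ τ ρ
  closure_subset : closure (coordBall I p ε) ⊆ (chartAt H p).source
  radial : ∀ t ∈ Icc (0 : ℝ) 1, f t ∈ coordBall I p ε → f t = p ∨ ∃ σ ∈ B, RadialAt I f p σ t

theorem eventually_forall_Ioc_eq_or_ne {V : Type*} [NormedAddCommGroup V] [NormedSpace ℝ V]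
    {σ τ : ℝ → V} (hσ : IsRadialGerm σ) (hτ : IsRadialGerm τ) :
    ∀ᶠ ε in 𝓝[>] (0 : ℝ), (∀ ρ ∈ Ioc 0 ε, σ ρ = τ ρ) ∨ ∀ ρ ∈ Ioc 0 ε, σ ρ ≠ τ ρ := by
  have hIoc : ∀ {q : ℝ → Prop}, (∀ᶠ ρ in 𝓝[>] 0, q ρ) →
      ∀ᶠ ε in 𝓝[>] (0 : ℝ), ∀ ρ ∈ Ioc 0 ε, q ρ := by
    intro q hq
    obtain ⟨r, hr, hrq⟩ := mem_nhdsGT_iff_exists_Ioo_subset.1 hq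
    filter_upwards [Ioo_mem_nhdsGT hr] with ε hε ρ hρ
    exact hrq ⟨hρ.1, hρ.2.trans_lt hε.2⟩
  exact (hσ.eventually_eq_or_ne hτ).elim (fun h => (hIoc h).mono fun _ => Or.inl)
    fun h => (hIoc h).mono fun _ => Or.inr

theorem exists_isStar [T2Space M] {f : ℝ → M} (hf : HasAnalyticGerms I f)
    (hfc : Continuous f) (p : M) : ∃ ε B, IsStar I f p ε B := by
  have : LocallyCompactSpace M := Manifold.locallyCompact_of_finiteDimensional I
  obtain ⟨B, hB, hrad, h⟩ := hf.eventuallyRadial_comap hfc p isCompact_Icc (K := Icc 0 1)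
  rw [inf_comm, eventually_inf_principal, eventually_comap] at h
  obtain ⟨C, hC, hCclosed, hCsrc⟩ := exists_mem_nhds_isClosed_subset
    ((chartAt H p).open_source.mem_nhds (mem_chart_source H p))
  obtain ⟨δ, hδ, hball⟩ := exists_coordBall_subset I (inter_mem hC h)
  have hcont : ∀ᶠ ε in 𝓝[>] (0 : ℝ), ∀ σ ∈ B, ContinuousOn σ (Icc 0 ε) :=
    (eventually_all_finite hB).2 fun σ hσ => (hrad σ hσ).eventually_continuousOn
  have hsep : ∀ᶠ ε in 𝓝[>] (0 : ℝ), ∀ σ ∈ B, ∀ τ ∈ B,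
      (∀ ρ ∈ Ioc 0 ε, σ ρ = τ ρ) ∨ ∀ ρ ∈ Ioc 0 ε, σ ρ ≠ τ ρ :=
    (eventually_all_finite hB).2 fun σ hσ => (eventually_all_finite hB).2 fun τ hτ =>
      eventually_forall_Ioc_eq_or_ne (hrad σ hσ) (hrad τ hτ)
  obtain ⟨ε, ⟨hεcont, hεsep⟩, hε⟩ := ((hcont.and hsep).and (Ioo_mem_nhdsGT hδ)).exists
  have hsub := (coordBall_mono hε.2.le).trans hball
  exact ⟨ε, B, hε.1, hB, fun σ hσ => (hrad σ hσ).1, hεcont, hεsep,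
    (closure_minimal (hsub.trans inter_subset_left) hCclosed).trans hCsrc,
    fun t ht ht' => (hsub ht').2 t rfl ht⟩

end Star

section Reparametrization

/-- `φ` maps `[c, d]` to `[a, b]`, end points to end points, and `f ∘ φ = f` on `[c, d]`: the two
restrictions of `f` are reparametrizations of each other, possibly with opposite orientations. -/
structure IsReparam {X : Type*} (f : ℝ → X) (a b c d : ℝ) (φ : ℝ → ℝ) : Prop where
  cont : ContinuousOn φ (Icc c d)
  mapsTo : MapsTo φ (Icc c d) (Icc a b)
  mapsTo_Ioo : MapsTo φ (Ioo c d) (Ioo a b)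
  diff : ∀ τ ∈ Ioo c d, DifferentiableAt ℝ φ τ
  comp : ∀ τ ∈ Icc c d, f (φ τ) = f τ
  ends : (φ c = a ∧ φ d = b) ∨ (φ c = b ∧ φ d = a)

theorem exists_continuousOn_lift_of_image_subset {X Y Z : Type*} [TopologicalSpace X]
    [TopologicalSpace Y] [T2Space Y] [TopologicalSpace Z] [Nonempty X] {f : X → Y} {g : Z → Y}
    {K : Set X} {s : Set Z} (hK : IsCompact K) (hf : ContinuousOn f K) (hinj : InjOn f K)
    (hg : ContinuousOn g s) (hsub : g '' s ⊆ f '' K) :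
    ∃ φ : Z → X, ContinuousOn φ s ∧ MapsTo φ s K ∧ EqOn (f ∘ φ) g s := by
  choose! φ hφ hfφ using fun z (hz : z ∈ s) => hsub (mem_image_of_mem g hz)
  have : CompactSpace K := isCompact_iff_compactSpace.1 hK
  have hemb : IsEmbedding (K.domRestrict f) :=
    (hf.domRestrict.isClosedEmbedding (injOn_iff_injective.1 hinj)).isEmbedding
  refine ⟨φ, ?_, hφ, hfφ⟩
  rw [continuousOn_iff_continuous_domRestrict] at hg ⊢
  have hlift : Continuous (MapsTo.restrict φ _ _ hφ) := by
    rw [hemb.continuous_iff]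
    convert hg using 1
    ext z
    exact hfφ z z.2
  exact continuous_subtype_val.comp hlift

theorem differentiableAt_of_comp_eventuallyEq {𝕜 : Type*} [NontriviallyNormedField 𝕜]
    [CompleteSpace 𝕜] {g h φ : 𝕜 → 𝕜} {g' s : 𝕜} (hg : HasStrictDerivAt g g' (φ s))
    (hg' : g' ≠ 0) (hφ : ContinuousAt φ s) (hh : DifferentiableAt 𝕜 h s)
    (heq : g ∘ φ =ᶠ[𝓝 s] h) : DifferentiableAt 𝕜 φ s := by
  have hinv := hφ.eventually (hg.eventually_left_inverse hg')
  have hderiv := (hg.to_localInverse hg').hasDerivAt.differentiableAt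
  rw [show g (φ s) = h s from heq.self_of_nhds] at hderiv
  refine (hderiv.comp s hh).congr_of_eventuallyEq ?_
  filter_upwards [hinv, heq] with z hz hz'
  rw [Function.comp_apply, ← hz', Function.comp_apply, hz]

theorem image_Icc_subset_uIcc_of_injOn {R : ℝ → ℝ} {a b : ℝ} (hab : a ≤ b)
    (hR : ContinuousOn R (Icc a b)) (hinj : InjOn R (Icc a b)) :
    R '' Icc a b ⊆ uIcc (R a) (R b) := by
  have ha := left_mem_Icc.2 hab
  have hb := right_mem_Icc.2 hab
  rintro _ ⟨τ, hτ, rfl⟩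
  rcases hR.strictMonoOn_of_injOn_Icc' hab hinj with h | h
  · exact Icc_subset_uIcc ⟨h.monotoneOn ha hτ hτ.1, h.monotoneOn hτ hb hτ.2⟩
  · exact Icc_subset_uIcc' ⟨h.antitoneOn hτ hb hτ.2, h.antitoneOn ha hτ hτ.1⟩

theorem image_Ioo_subset_of_disjoint_ends {R : ℝ → ℝ} {a b c d : ℝ} (hab : a < b)
    (hR : ContinuousOn R (Icc a b)) (hR' : ContinuousOn R (Ioo c d)) (hinj : InjOn R (Icc a b))
    (ha : R a ∉ R '' Ioo c d) (hb : R b ∉ R '' Ioo c d)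
    (hne : (R '' Ioo a b ∩ R '' Ioo c d).Nonempty) : R '' Ioo c d ⊆ R '' Ioo a b := by
  obtain ⟨y, hy, hy'⟩ := hne
  have hconn : OrdConnected (R '' Ioo c d) := (isPreconnected_Ioo.image R hR').ordConnected
  have hconn' : OrdConnected (R '' Icc a b) := (isPreconnected_Icc.image R hR).ordConnected
  have hyu := image_Icc_subset_uIcc_of_injOn hab.le hR hinj (image_mono Ioo_subset_Icc_self hy)
  intro z hz
  have hzu : z ∈ uIcc (R a) (R b) := by
    by_contra hzu
    have hend : R a ∈ uIcc y z ∨ R b ∈ uIcc y z := by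
      simp only [mem_uIcc] at hyu hzu ⊢
      grind
    exact hend.elim (fun h => ha (hconn.uIcc_subset hy' hz h))
      fun h => hb (hconn.uIcc_subset hy' hz h)
  obtain ⟨τ, hτ, rfl⟩ := hconn'.uIcc_subset (mem_image_of_mem R (left_mem_Icc.2 hab.le))
    (mem_image_of_mem R (right_mem_Icc.2 hab.le)) hzu
  refine ⟨τ, ⟨lt_of_le_of_ne hτ.1 ?_, lt_of_le_of_ne hτ.2 ?_⟩, rfl⟩
  · rintro rfl; exact ha hz
  · rintro rfl; exact hb hz

theorem exists_reparam_real {R : ℝ → ℝ} {a b c d : ℝ} (hab : a < b) (hcd : c < d)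
    (hR : ContinuousOn R (Icc a b)) (hR' : ContinuousOn R (Icc c d))
    (hinj : InjOn R (Icc a b)) (hinj' : InjOn R (Icc c d))
    (ha : R a ∉ R '' Ioo c d) (hb : R b ∉ R '' Ioo c d)
    (hc : R c ∉ R '' Ioo a b) (hd : R d ∉ R '' Ioo a b)
    (hne : (R '' Ioo a b ∩ R '' Ioo c d).Nonempty) :
    ∃ φ : ℝ → ℝ, ContinuousOn φ (Icc c d) ∧ MapsTo φ (Icc c d) (Icc a b) ∧
      MapsTo φ (Ioo c d) (Ioo a b) ∧ (∀ τ ∈ Icc c d, R (φ τ) = R τ) ∧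
      ((φ c = a ∧ φ d = b) ∨ (φ c = b ∧ φ d = a)) := by
  have hsub := image_Ioo_subset_of_disjoint_ends hab hR (hR'.mono Ioo_subset_Icc_self) hinj
    ha hb hne
  have hsub' : R '' Icc c d ⊆ R '' Icc a b := by
    rw [← closure_Ioo hcd.ne] at hR' ⊢
    exact hR'.image_closure.trans (closure_minimal (hsub.trans (image_mono Ioo_subset_Icc_self))
      (isCompact_Icc.image_of_continuousOn hR).isClosed)
  obtain ⟨φ, hφc, hφ, hRφ⟩ :=
    exists_continuousOn_lift_of_image_subset isCompact_Icc hR hinj hR' hsub'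
  have hIoo : MapsTo φ (Ioo c d) (Ioo a b) := by
    intro τ hτ
    obtain ⟨τ', hτ', h⟩ := hsub (mem_image_of_mem R hτ)
    have hτI := Ioo_subset_Icc_self hτ
    rwa [hinj (hφ hτI) (Ioo_subset_Icc_self hτ') ((hRφ hτI).trans h.symm)]
  have hend : ∀ τ ∈ Icc c d, R τ ∉ R '' Ioo a b → φ τ = a ∨ φ τ = b := by
    intro τ hτ hn
    by_contra! h
    exact hn ⟨φ τ, ⟨lt_of_le_of_ne (hφ hτ).1 h.1.symm, lt_of_le_of_ne (hφ hτ).2 h.2⟩, hRφ hτ⟩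
  have hcI := left_mem_Icc.2 hcd.le
  have hdI := right_mem_Icc.2 hcd.le
  have hφne : φ c ≠ φ d := fun h => hcd.ne <| hinj' hcI hdI <| by
    rw [← hRφ hcI, ← hRφ hdI, Function.comp_apply, Function.comp_apply, h]
  refine ⟨φ, hφc, hφ, hIoo, hRφ, ?_⟩
  rcases hend c hcI hc with h | h <;> rcases hend d hdI hd with h' | h' <;> grind

end Reparametrization

section Decomposition

theorem eq_of_finite_cover_of_eq_or_ne {ι X Y : Type*} [TopologicalSpace X] [PreconnectedSpace X]
    [TopologicalSpace Y] [T2Space Y] {B : Set ι} (hB : B.Finite) {g : X → Y} {F : ι → X → Y}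
    (hg : Continuous g) (hF : ∀ i ∈ B, Continuous (F i))
    (hsep : ∀ i ∈ B, ∀ j ∈ B, F i = F j ∨ ∀ x, F i x ≠ F j x)
    (hcover : ∀ x, ∃ i ∈ B, g x = F i x) {i : ι} (hi : i ∈ B) {x₀ : X} (hx₀ : g x₀ = F i x₀) :
    g = F i := by
  have hcompl : {x | g x = F i x}ᶜ = ⋃ j ∈ {j ∈ B | ∀ x, F i x ≠ F j x}, {x | g x = F j x} := by
    ext x
    simp only [mem_compl_iff, mem_ofPred_eq, mem_iUnion₂, exists_prop]
    refine ⟨fun hne => ?_, fun ⟨j, hj, hgj⟩ hgi => hj.2 x (hgi.symm.trans hgj)⟩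
    obtain ⟨j, hj, hgj⟩ := hcover x
    refine ⟨j, ⟨hj, (hsep i hi j hj).resolve_left fun h => hne ?_⟩, hgj⟩
    rw [hgj, h]
  have hclopen : IsClopen {x | g x = F i x} := by
    refine ⟨isClosed_eq hg (hF i hi), isClosed_compl_iff.1 ?_⟩
    rw [hcompl]
    exact (hB.subset (sep_subset _ _)).isClosed_biUnion fun j hj => isClosed_eq hg (hF j hj.1)
  exact funext (eq_univ_iff_forall.1 (hclopen.eq_univ ⟨x₀, hx₀⟩))

theorem injOn_Icc_of_deriv_ne_zero {g : ℝ → ℝ} {a b : ℝ} (hg : ContinuousOn g (Icc a b))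
    (hderiv : ∀ τ ∈ Ioo a b, deriv g τ ≠ 0) : InjOn g (Icc a b) := by
  have hlt : ∀ τ ∈ Icc a b, ∀ τ' ∈ Icc a b, τ < τ' → g τ ≠ g τ' := by
    intro τ hτ τ' hτ' h heq
    obtain ⟨c, hc, hc0⟩ := exists_deriv_eq_zero h (hg.mono (Icc_subset_Icc hτ.1 hτ'.2)) heq
    exact hderiv c (Ioo_subset_Ioo hτ.1 hτ'.2 hc) hc0
  intro τ hτ τ' hτ' heq
  by_contra hne
  rcases lt_or_gt_of_ne hne with h | h
  · exact hlt τ hτ τ' hτ' h heq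
  · exact hlt τ' hτ' τ hτ h heq.symm

variable {E : Type*} [NormedAddCommGroup E] [NormedSpace ℝ E]
  {H : Type*} [TopologicalSpace H] (I : ModelWithCorners ℝ E H)
  {M : Type*} [TopologicalSpace M] [ChartedSpace H M]

/-- On `[a, b]` the curve `f` is injective, and it is analytic and immersive inside. Immersivity is
expressed by a function on the manifold that increases along the curve. -/
structure IsEdge (f : ℝ → M) (a b : ℝ) : Prop where
  inj : InjOn f (Icc a b)
  analytic : ∀ τ ∈ Ioo a b, ContMDiffAt 𝓘(ℝ, ℝ) I ω f τ
  immersive : ∀ τ ∈ Ioo a b, ∃ h : M → ℝ, ContMDiffAt I 𝓘(ℝ, ℝ) ω h (f τ) ∧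
    0 < deriv (fun s => h (f s)) τ

variable [FiniteDimensional ℝ E]

/-- The restriction of `f` to `[a, b]` runs monotonically along the branch `σ` of the star
at `p`. -/
structure IsArc (f : ℝ → M) (p : M) (σ : ℝ → EuclideanModel E)
    (a b : ℝ) : Prop where
  mem : ∀ τ ∈ Icc a b, f τ ∈ (chartAt H p).source
  branch : ∀ τ ∈ Icc a b, radialChart I p (f τ) = σ ‖radialChart I p (f τ)‖
  inj : InjOn (fun τ => ‖radialChart I p (f τ)‖) (Icc a b)
  radial : ∀ τ ∈ Ioo a b, RadialAt I f p σ τ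

variable {I}

theorem norm_radialChart_le_of_mem_closure {p q : M} {r : ℝ}
    (hq : q ∈ closure (coordBall I p r)) (hs : q ∈ (chartAt H p).source) :
    ‖radialChart I p q‖ ≤ r := by
  by_contra! hlt
  have hopen := (continuousOn_radialChart I p).norm.isOpen_inter_preimage
    (chartAt H p).open_source (isOpen_Ioi (a := r))
  obtain ⟨z, hz, hz'⟩ := mem_closure_iff.1 hq _ hopen ⟨hs, hlt⟩
  exact lt_asymm hz.2 hz'.2

theorem IsArc.continuousOn {f : ℝ → M} (hfc : Continuous f) {p : M} {a b : ℝ}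
    {σ : ℝ → EuclideanModel E} (h : IsArc I f p σ a b) :
    ContinuousOn (fun τ => ‖radialChart I p (f τ)‖) (Icc a b) :=
  ((continuousOn_radialChart I p).comp hfc.continuousOn h.mem).norm

theorem IsArc.eq_of_norm_eq {f : ℝ → M} {p : M} {a b c d : ℝ}
    {σ : ℝ → EuclideanModel E} (h : IsArc I f p σ a b)
    (h' : IsArc I f p σ c d) {τ τ' : ℝ} (hτ : τ ∈ Icc a b) (hτ' : τ' ∈ Icc c d)
    (he : ‖radialChart I p (f τ)‖ = ‖radialChart I p (f τ')‖) : f τ = f τ' := by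
  refine injOn_radialChart I p (h.mem τ hτ) (h'.mem τ' hτ') ?_
  rw [h.branch τ hτ, h'.branch τ' hτ', he]

theorem IsStar.finite_sphere {f : ℝ → M} {p : M} {ε r : ℝ}
    {B : Set (ℝ → EuclideanModel E)} (hS : IsStar I f p ε B)
    (hr0 : 0 < r) (hr : r < ε) :
    {q | q ∈ f '' Icc 0 1 ∧ q ∈ (chartAt H p).source ∧ ‖radialChart I p q‖ = r}.Finite := by
  refine Finite.of_finite_image (f := radialChart I p) ?_
    ((injOn_radialChart I p).mono fun q hq => hq.2.1)
  refine (hS.finite.image fun σ => σ r).subset ?_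
  rintro _ ⟨_, ⟨⟨t, ht, rfl⟩, hq, hqr⟩, rfl⟩
  obtain h | ⟨σ, hσ, h⟩ := hS.radial t ht ⟨hq, hqr ▸ hr⟩
  · rw [h, radialChart_self, norm_zero] at hqr
    exact (hr0.ne hqr).elim
  · exact ⟨σ, hσ, by rw [h.branch, hqr]⟩

theorem mapsTo_coordBall_of_norm_ne {f : ℝ → M} (hfc : Continuous f) {p : M} {r a b m : ℝ}
    (hsrc : closure (coordBall I p r) ⊆ (chartAt H p).source)
    (hne : ∀ τ ∈ Ioo a b, f τ ∈ (chartAt H p).source → ‖radialChart I p (f τ)‖ ≠ r)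
    (hm : m ∈ Ioo a b) (hmr : f m ∈ coordBall I p r) :
    MapsTo f (Ioo a b) (coordBall I p r) := by
  have hopen : IsOpen (f ⁻¹' coordBall I p r) := (isOpen_coordBall I p r).preimage hfc
  refine isPreconnected_Ioo.subset_of_closure_inter_subset hopen ⟨m, hm, hmr⟩ ?_
  rintro τ ⟨hτ, hτab⟩
  have hτcl : f τ ∈ closure (coordBall I p r) := hfc.closure_preimage_subset _ hτ
  exact ⟨hsrc hτcl, lt_of_le_of_ne (norm_radialChart_le_of_mem_closure hτcl (hsrc hτcl))
    (hne τ hτab (hsrc hτcl))⟩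

theorem IsStar.radialAt_of_radialAt {f : ℝ → M} (hfc : Continuous f) {p : M} {ε a b m : ℝ}
    {B : Set (ℝ → EuclideanModel E)} (hS : IsStar I f p ε B) (hab : Ioo a b ⊆ Icc 0 1)
    (hin : MapsTo f (Ioo a b) (coordBall I p ε)) (hne : ∀ τ ∈ Ioo a b, f τ ≠ p)
    {σ : ℝ → EuclideanModel E} (hσ : σ ∈ B) (hm : m ∈ Ioo a b) (hmσ : RadialAt I f p σ m) :
    ∀ τ ∈ Ioo a b, RadialAt I f p σ τ := by
  have hrad : ∀ τ ∈ Ioo a b, ∃ σ' ∈ B, RadialAt I f p σ' τ := fun τ hτ =>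
    (hS.radial τ (hab hτ) (hin hτ)).resolve_left (hne τ hτ)
  have : PreconnectedSpace (Ioo a b) := isPreconnected_iff_preconnectedSpace.1 isPreconnected_Ioo
  let g : Ioo a b → EuclideanModel E := fun τ => radialChart I p (f τ)
  have hg : Continuous g := continuousOn_iff_continuous_domRestrict.1
    ((continuousOn_radialChart I p).comp hfc.continuousOn fun τ hτ => (hin hτ).1)
  have hnorm : ∀ τ, ‖g τ‖ ∈ Ioc 0 ε := fun τ => by
    refine ⟨norm_pos_iff.2 fun h => hne τ τ.2 ?_, (hin τ.2).2.le⟩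
    exact (radialChart_eq_zero_iff I (hin τ.2).1).1 h
  have hbranch : g = fun τ => σ ‖g τ‖ := by
    refine eq_of_finite_cover_of_eq_or_ne hS.finite (F := fun σ' τ => σ' ‖g τ‖) hg
      (fun σ' hσ' => ?_) (fun σ' hσ' σ'' hσ'' => ?_) (fun τ => ?_) hσ (x₀ := ⟨m, hm⟩) hmσ.branch
    · exact (hS.cont σ' hσ').comp_continuous hg.norm fun τ => Ioc_subset_Icc_self (hnorm τ)
    · exact (hS.eq_or_ne σ' hσ' σ'' hσ'').imp (fun h => funext fun τ => h _ (hnorm τ))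
        fun h τ => h _ (hnorm τ)
    · exact (hrad τ τ.2).imp fun _ => And.imp_right RadialAt.branch
  intro τ hτ
  obtain ⟨σ', -, h⟩ := hrad τ hτ
  exact ⟨h.mem, h.ne, congrFun hbranch ⟨τ, hτ⟩, h.deriv_ne, h.analytic⟩

theorem IsStar.isArc {f : ℝ → M} (hfc : Continuous f) {p : M} {ε r : ℝ}
    {B : Set (ℝ → EuclideanModel E)} (hS : IsStar I f p ε B) (hr : r < ε) {a b m : ℝ}
    (hab : Ioo a b ⊆ Icc 0 1) (hne : ∀ τ ∈ Ioo a b, f τ ≠ p)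
    (hnorm : ∀ τ ∈ Ioo a b, f τ ∈ (chartAt H p).source → ‖radialChart I p (f τ)‖ ≠ r)
    (hm : m ∈ Ioo a b) (hmr : f m ∈ coordBall I p r) {σ : ℝ → EuclideanModel E} (hσ : σ ∈ B)
    (hmσ : RadialAt I f p σ m) : IsArc I f p σ a b := by
  have hlt : a < b := hm.1.trans hm.2
  have hsrc : closure (coordBall I p r) ⊆ (chartAt H p).source :=
    (closure_mono (coordBall_mono hr.le)).trans hS.closure_subset
  have hin := mapsTo_coordBall_of_norm_ne hfc hsrc hnorm hm hmr
  have hrad := hS.radialAt_of_radialAt hfc hab (hin.mono_right (coordBall_mono hr.le)) hne hσ hm hmσ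
  have hcl : ∀ τ ∈ Icc a b, f τ ∈ closure (coordBall I p r) := by
    rw [← closure_Ioo hlt.ne]
    exact hin.closure hfc
  have hmem : ∀ τ ∈ Icc a b, f τ ∈ (chartAt H p).source := fun τ hτ => hsrc (hcl τ hτ)
  have hcont : ContinuousOn (fun τ => radialChart I p (f τ)) (Icc a b) :=
    (continuousOn_radialChart I p).comp hfc.continuousOn hmem
  have hσcont : ContinuousOn (fun τ => σ ‖radialChart I p (f τ)‖) (Icc a b) :=
    (hS.cont σ hσ).comp hcont.norm fun τ hτ => ⟨norm_nonneg _,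
      (norm_radialChart_le_of_mem_closure (hcl τ hτ) (hmem τ hτ)).trans hr.le⟩
  have hbranch : EqOn (fun τ => radialChart I p (f τ)) (fun τ => σ ‖radialChart I p (f τ)‖)
      (Icc a b) :=
    EqOn.of_subset_closure (fun τ hτ => (hrad τ hτ).branch) hcont hσcont Ioo_subset_Icc_self
      (closure_Ioo hlt.ne).ge
  have hinj : InjOn (fun τ => ‖radialChart I p (f τ)‖ ^ 2) (Icc a b) :=
    injOn_Icc_of_deriv_ne_zero (hcont.norm.pow 2) fun τ hτ => (hrad τ hτ).deriv_ne
  exact ⟨hmem, hbranch, fun τ hτ τ' hτ' h => hinj hτ hτ' (congrArg (· ^ 2) h), hrad⟩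

variable (I) in
/-- A finite set `T` of centres of stars for `f`, with radii `ε` and branches `B`, such that the
concentric balls of half the radius cover the image of `f`. -/
structure IsStarCover (f : ℝ → M) (T : Set M) (ε : M → ℝ)
    (B : M → Set (ℝ → EuclideanModel E)) : Prop where
  finite : T.Finite
  star : ∀ p ∈ T, IsStar I f p (ε p) (B p)
  cover : ∀ τ ∈ Icc (0 : ℝ) 1, ∃ p ∈ T, f τ ∈ coordBall I p (ε p / 2)

variable (I) in
/-- The points at which a curve is cut into edges: its end points, the centres of the stars, and the
points where it crosses one of the spheres of half the radius. -/
def starVertices (f : ℝ → M) (T : Set M) (ε : M → ℝ) : Set M :=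
  {f 0, f 1} ∪ ⋃ p ∈ T, ({p} ∪ {q | q ∈ f '' Icc 0 1 ∧ q ∈ (chartAt H p).source ∧
    ‖radialChart I p q‖ = ε p / 2})

section StarCover

variable {f : ℝ → M} {T : Set M} {ε : M → ℝ} {B : M → Set (ℝ → EuclideanModel E)} {a b : ℝ}

theorem mem_starVertices_of_mem {p : M} (hp : p ∈ T) : p ∈ starVertices I f T ε :=
  Or.inr (mem_iUnion₂.2 ⟨p, hp, Or.inl rfl⟩)

theorem mem_starVertices_of_norm_eq {p : M} (hp : p ∈ T) {τ : ℝ} (hτ : τ ∈ Icc (0 : ℝ) 1)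
    (hsrc : f τ ∈ (chartAt H p).source) (hnorm : ‖radialChart I p (f τ)‖ = ε p / 2) :
    f τ ∈ starVertices I f T ε :=
  Or.inr (mem_iUnion₂.2 ⟨p, hp, Or.inr ⟨mem_image_of_mem f hτ, hsrc, hnorm⟩⟩)

theorem IsStarCover.finite_starVertices (hC : IsStarCover I f T ε B) :
    (starVertices I f T ε).Finite :=
  (toFinite _).union <| hC.finite.biUnion fun p hp => (finite_singleton p).union <|
    (hC.star p hp).finite_sphere (half_pos (hC.star p hp).pos) (half_lt_self (hC.star p hp).pos)

theorem IsStarCover.exists_radialAt (hC : IsStarCover I f T ε B) {τ : ℝ}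
    (hτ : τ ∈ Icc (0 : ℝ) 1) (hτV : f τ ∉ starVertices I f T ε) :
    ∃ p ∈ T, f τ ∈ coordBall I p (ε p / 2) ∧ ∃ σ ∈ B p, RadialAt I f p σ τ := by
  obtain ⟨p, hp, hτp⟩ := hC.cover τ hτ
  have hhalf := half_le_self (hC.star p hp).pos.le
  exact ⟨p, hp, hτp, ((hC.star p hp).radial τ hτ (coordBall_mono hhalf hτp)).resolve_left
    fun h => hτV (h ▸ mem_starVertices_of_mem hp)⟩

theorem IsStarCover.isArc (hC : IsStarCover I f T ε B) (hfc : Continuous f)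
    (hab : Ioo a b ⊆ Icc 0 1) (hV : ∀ τ ∈ Ioo a b, f τ ∉ starVertices I f T ε) {m : ℝ}
    (hm : m ∈ Ioo a b) {p : M} (hp : p ∈ T) (hmp : f m ∈ coordBall I p (ε p / 2))
    {σ : ℝ → EuclideanModel E} (hσ : σ ∈ B p) (hmσ : RadialAt I f p σ m) :
    IsArc I f p σ a b :=
  (hC.star p hp).isArc hfc (half_lt_self (hC.star p hp).pos) hab
    (fun τ hτ h => hV τ hτ (h ▸ mem_starVertices_of_mem hp))
    (fun τ hτ hsrc h => hV τ hτ (mem_starVertices_of_norm_eq hp (hab hτ) hsrc h)) hm hmp hσ hmσ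

end StarCover

variable [IsManifold I ω M]

theorem RadialAt.hasStrictDerivAt {f : ℝ → M} {p : M}
    {σ : ℝ → EuclideanModel E} {t : ℝ} (h : RadialAt I f p σ t) :
    HasStrictDerivAt (fun s => ‖radialChart I p (f s)‖ ^ 2)
      (deriv (fun s => ‖radialChart I p (f s)‖ ^ 2) t) t := by
  have := analyticAt_radialChart_comp h.analytic h.mem
  exact ((this.contDiffAt.norm_sq ℝ (n := ω)).analyticAt).hasStrictDerivAt

theorem IsArc.isEdge {f : ℝ → M} {p : M} {a b : ℝ}
    {σ : ℝ → EuclideanModel E} (h : IsArc I f p σ a b) :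
    IsEdge I f a b where
  inj τ hτ τ' hτ' he := h.inj hτ hτ' (by dsimp only; rw [he])
  analytic τ hτ := (h.radial τ hτ).analytic
  immersive τ hτ := by
    have hr := h.radial τ hτ
    have hs : ContMDiffAt I 𝓘(ℝ, ℝ) ω (fun q => ‖radialChart I p q‖ ^ 2) (f τ) := by
      have h1 := ((contMDiffOn_radialChart I p).contMDiffAt
        ((chartAt H p).open_source.mem_nhds hr.mem))
      have h2 : ContMDiff 𝓘(ℝ, EuclideanModel E) 𝓘(ℝ, ℝ) ω
          (fun v : EuclideanModel E => ‖v‖ ^ 2) :=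
        (contDiff_norm_sq ℝ).contMDiff
      exact ContMDiffAt.comp (f τ) h2.contMDiffAt h1
    rcases hr.deriv_ne.lt_or_gt with hlt | hgt
    · refine ⟨fun q => -‖radialChart I p q‖ ^ 2, hs.neg, ?_⟩
      rw [deriv.fun_neg]
      linarith
    · exact ⟨_, hs, hgt⟩

theorem IsArc.exists_isReparam {f : ℝ → M} (hfc : Continuous f) {p : M} {a b c d : ℝ}
    {σ : ℝ → EuclideanModel E} (h : IsArc I f p σ a b) (h' : IsArc I f p σ c d)
    {V : Set M} (ha : f a ∈ V) (hb : f b ∈ V) (hc : f c ∈ V) (hd : f d ∈ V)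
    (hV : ∀ τ ∈ Ioo a b, f τ ∉ V) (hV' : ∀ τ ∈ Ioo c d, f τ ∉ V)
    {τ τ' : ℝ} (hτ : τ ∈ Ioo a b) (hτ' : τ' ∈ Ioo c d) (heq : f τ = f τ') :
    ∃ φ, IsReparam f a b c d φ := by
  have hab : a < b := hτ.1.trans hτ.2
  have hcd : c < d := hτ'.1.trans hτ'.2
  have hR : ∀ {a b c d z : ℝ}, IsArc I f p σ a b → IsArc I f p σ c d →
      (∀ τ ∈ Ioo c d, f τ ∉ V) → z ∈ Icc a b → f z ∈ V →
      ‖radialChart I p (f z)‖ ∉ (fun τ => ‖radialChart I p (f τ)‖) '' Ioo c d := by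
    rintro a b c d z h h' hV' hz hzV ⟨s, hs, hs'⟩
    exact hV' s hs (h'.eq_of_norm_eq h (Ioo_subset_Icc_self hs) hz hs' ▸ hzV)
  obtain ⟨φ, hφc, hφ, hφIoo, hRφ, hends⟩ := exists_reparam_real hab hcd (h.continuousOn hfc)
    (h'.continuousOn hfc) h.inj h'.inj (hR h h' hV' (left_mem_Icc.2 hab.le) ha)
    (hR h h' hV' (right_mem_Icc.2 hab.le) hb) (hR h' h hV (left_mem_Icc.2 hcd.le) hc)
    (hR h' h hV (right_mem_Icc.2 hcd.le) hd)
    ⟨_, mem_image_of_mem _ hτ, τ', hτ', by dsimp only; rw [heq]⟩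
  refine ⟨φ, hφc, hφ, hφIoo, fun s hs => ?_,
    fun s hs => h.eq_of_norm_eq h' (hφ hs) hs (hRφ s hs), hends⟩
  have hrad := h.radial _ (hφIoo hs)
  refine differentiableAt_of_comp_eventuallyEq hrad.hasStrictDerivAt hrad.deriv_ne
    (hφc.continuousAt (Icc_mem_nhds hs.1 hs.2))
    (h'.radial s hs).hasStrictDerivAt.hasDerivAt.differentiableAt ?_
  filter_upwards [Icc_mem_nhds hs.1 hs.2] with z hz
  exact congrArg (· ^ 2) (hRφ z hz)

variable (I) in
/-- A partition of `[0, 1]` such that `f` is constant or an edge on each piece, and such that an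
edge is disjoint from each other piece or a reparametrization of it. -/
structure IsEdgePartition (f : ℝ → M) (n : ℕ) (t : ℕ → ℝ) : Prop where
  zero : t 0 = 0
  one : t n = 1
  lt : ∀ i < n, t i < t (i + 1)
  const_or_edge : ∀ i < n, (∀ τ ∈ Icc (t i) (t (i + 1)), f τ = f (t i)) ∨
    IsEdge I f (t i) (t (i + 1))
  disjoint_or : ∀ i < n, IsEdge I f (t i) (t (i + 1)) → ∀ j < n,
    Disjoint (f '' Ioo (t i) (t (i + 1))) (f '' Icc (t j) (t (j + 1))) ∨
    (IsEdge I f (t j) (t (j + 1)) ∧ ∃ φ, IsReparam f (t i) (t (i + 1)) (t j) (t (j + 1)) φ)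

theorem exists_sorted_partition {α : Type*} [LinearOrder α] {s : Finset α} {a b : α}
    (ha : IsLeast (s : Set α) a) (hb : IsGreatest (s : Set α) b) :
    ∃ (n : ℕ) (t : ℕ → α), t 0 = a ∧ t n = b ∧ (∀ i < n, t i < t (i + 1)) ∧
      (∀ i, t i ∈ s) ∧ ∀ i < n, Disjoint (Ioo (t i) (t (i + 1))) s := by
  obtain ⟨n, hn⟩ : ∃ n, s.card = n + 1 :=
    Nat.exists_eq_succ_of_ne_zero (Finset.card_ne_zero_of_mem ha.1)
  let e := s.orderIsoOfFin hn
  let index : ℕ → Fin (n + 1) := fun i => ⟨min i n, by omega⟩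
  have hbot : ∀ k, index 0 ≤ k := fun k => Fin.le_def.2 (by simp [index])
  have htop : ∀ k, k ≤ index n := fun k => Fin.le_def.2 (by simp only [index]; omega)
  refine ⟨n, fun i => e (index i), ?_, ?_, fun i hi => ?_, fun i => (e _).2, fun i hi => ?_⟩
  · refine le_antisymm ?_ (ha.2 (e _).2)
    have := e.monotone (hbot (e.symm ⟨a, ha.1⟩))
    rwa [e.apply_symm_apply] at this
  · refine le_antisymm (hb.2 (e _).2) ?_
    have := e.monotone (htop (e.symm ⟨b, hb.1⟩))
    rwa [e.apply_symm_apply] at this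
  · exact e.strictMono (Fin.lt_def.2 (by simp only [index]; omega))
  · rw [Set.disjoint_left]
    rintro r ⟨hlt, hlt'⟩ hr
    obtain ⟨k, hk⟩ := e.surjective ⟨r, hr⟩
    obtain rfl : (e k : α) = r := congrArg Subtype.val hk
    have hik := Fin.lt_def.1 (e.lt_iff_lt.1 hlt)
    have hki := Fin.lt_def.1 (e.lt_iff_lt.1 hlt')
    simp only [index] at hik hki
    omega

theorem eventually_notMem_frontier_of_isOpen {X : Type*} [TopologicalSpace X] {U s : Set X}
    (hU : IsOpen U) {x : X} (h : (∀ᶠ y in 𝓝[U] x, y ∈ s) ∨ ∀ᶠ y in 𝓝[U] x, y ∉ s) :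
    ∀ᶠ y in 𝓝[U] x, y ∉ frontier s := by
  rcases h with h | h <;>
    filter_upwards [eventually_eventually_nhdsWithin.2 h, self_mem_nhdsWithin] with y hy hyU <;>
    rw [hU.nhdsWithin_eq hyU] at hy
  · exact fun hfr => hfr.2 (mem_interior_iff_mem_nhds.2 hy)
  · rw [← frontier_compl]
    exact fun hfr => hfr.2 (mem_interior_iff_mem_nhds.2 hy)

theorem finite_inter_frontier_of_one_sided {K s : Set ℝ} (hK : IsCompact K)
    (hleft : ∀ t ∈ K, (∀ᶠ r in 𝓝[<] t, r ∈ s) ∨ ∀ᶠ r in 𝓝[<] t, r ∉ s)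
    (hright : ∀ t ∈ K, (∀ᶠ r in 𝓝[>] t, r ∈ s) ∨ ∀ᶠ r in 𝓝[>] t, r ∉ s) :
    (K ∩ frontier s).Finite := by
  have hcodiscrete : (frontier s)ᶜ ∈ codiscreteWithin K := by
    refine mem_codiscreteWithin_iff_forall_mem_nhdsNE.2 fun t ht => ?_
    refine mem_of_superset ?_ subset_union_left
    rw [← nhdsLT_sup_nhdsGT]
    exact eventually_sup.2 ⟨eventually_notMem_frontier_of_isOpen isOpen_Iio (hleft t ht),
      eventually_notMem_frontier_of_isOpen isOpen_Ioi (hright t ht)⟩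
  simpa [sdiff_compl] using hK.finite_sdiff_of_mem_codiscreteWithin hcodiscrete

theorem HasAnalyticGerms.frontier_preimage_finite [T1Space M] {f : ℝ → M}
    (hf : HasAnalyticGerms I f) (hfc : Continuous f) {V : Set M} (hV : V.Finite) :
    (Icc 0 1 ∩ frontier (f ⁻¹' V)).Finite := by
  have hside : ∀ {t : ℝ} {l : Filter ℝ}, l ≤ 𝓝 t → ((∀ᶠ r in l, f r = f t) ∨
      ∃ B : Set (ℝ → EuclideanModel E), B.Finite ∧ (∀ σ ∈ B, IsRadialGerm σ) ∧
        ∀ᶠ r in l, ∃ σ ∈ B, RadialAt I f (f t) σ r) →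
      (∀ᶠ r in l, r ∈ f ⁻¹' V) ∨ ∀ᶠ r in l, r ∉ f ⁻¹' V := by
    rintro t l hl (h | ⟨B, -, -, h⟩)
    · by_cases ht : f t ∈ V
      · exact Or.inl (h.mono fun r hr => by rwa [mem_preimage, hr])
      · exact Or.inr (h.mono fun r hr => by rwa [mem_preimage, hr])
    · have hiso : ∀ᶠ r in 𝓝 t, f r ∉ V \ {f t} :=
        (hV.sdiff.isClosed.isOpen_compl.preimage hfc).mem_nhds (by simp)
      refine Or.inr ?_
      filter_upwards [h, hl hiso] with r ⟨σ, _, hr⟩ hrV hr'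
      exact hrV ⟨hr', hr.ne⟩
  exact finite_inter_frontier_of_one_sided isCompact_Icc
    (fun t _ => hside nhdsWithin_le_nhds (hf.left t))
    fun t _ => hside nhdsWithin_le_nhds (hf.right t)

theorem eq_or_forall_notMem_of_disjoint_frontier {X : Type*} [TopologicalSpace X] [T1Space X]
    {f : ℝ → X} (hfc : Continuous f) {V : Set X} (hV : V.Finite) {a b : ℝ} (hab : a < b)
    (hdisj : Disjoint (Ioo a b) (frontier (f ⁻¹' V))) :
    (∀ τ ∈ Icc a b, f τ = f a) ∨ ∀ τ ∈ Ioo a b, f τ ∉ V := by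
  have hcl : IsClosed (f ⁻¹' V) := hV.isClosed.preimage hfc
  rw [or_iff_not_imp_right]
  intro hmeet
  push Not at hmeet
  obtain ⟨m, hm, hmV⟩ := hmeet
  have hint : ∀ τ ∈ Ioo a b, τ ∈ f ⁻¹' V → τ ∈ interior (f ⁻¹' V) := fun τ hτ hτV => by
    by_contra hni
    exact Set.disjoint_left.1 hdisj hτ ⟨subset_closure hτV, hni⟩
  have hsub : Ioo a b ⊆ interior (f ⁻¹' V) :=
    isPreconnected_Ioo.subset_of_closure_inter_subset isOpen_interior ⟨m, hm, hint m hm hmV⟩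
      fun τ hτ => hint τ hτ.2 (closure_minimal interior_subset hcl hτ.1)
  have hmaps : MapsTo f (Icc a b) V := by
    rw [← closure_Ioo hab.ne]
    exact closure_minimal (hsub.trans interior_subset) hcl
  exact fun τ hτ => isPreconnected_Icc.constant_of_mapsTo hV.isDiscrete hfc.continuousOn hmaps hτ
    (left_mem_Icc.2 hab.le)

theorem HasAnalyticGerms.exists_partition [T1Space M] {f : ℝ → M}
    (hf : HasAnalyticGerms I f) (hfc : Continuous f) {V : Set M} (hV : V.Finite) (h0 : f 0 ∈ V)
    (h1 : f 1 ∈ V) : ∃ (n : ℕ) (t : ℕ → ℝ), t 0 = 0 ∧ t n = 1 ∧ (∀ i < n, t i < t (i + 1)) ∧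
      (∀ i, t i ∈ Icc (0 : ℝ) 1 ∧ f (t i) ∈ V) ∧
      ∀ i < n, (∀ τ ∈ Icc (t i) (t (i + 1)), f τ = f (t i)) ∨
        ∀ τ ∈ Ioo (t i) (t (i + 1)), f τ ∉ V := by
  classical
  have hcl : IsClosed (f ⁻¹' V) := hV.isClosed.preimage hfc
  have hfin := hf.frontier_preimage_finite hfc hV
  let s : Finset ℝ := insert 0 (insert 1 hfin.toFinset)
  have hs : ∀ r ∈ s, r ∈ Icc (0 : ℝ) 1 ∧ f r ∈ V := by
    simp only [s, Finset.mem_insert, Finite.mem_toFinset]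
    rintro r (rfl | rfl | h)
    · exact ⟨by simp, h0⟩
    · exact ⟨by simp, h1⟩
    · exact ⟨h.1, hcl.frontier_subset h.2⟩
  obtain ⟨n, t, ht0, htn, hlt, hmem, hdisj⟩ := exists_sorted_partition (s := s) (a := 0) (b := 1)
    ⟨by simp [s], fun r hr => (hs r hr).1.1⟩ ⟨by simp [s], fun r hr => (hs r hr).1.2⟩
  refine ⟨n, t, ht0, htn, hlt, fun i => hs _ (hmem i), fun i hi =>
    eq_or_forall_notMem_of_disjoint_frontier hfc hV (hlt i hi) ?_⟩
  refine Set.disjoint_left.2 fun r hr hfr => Set.disjoint_left.1 (hdisj i hi) hr ?_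
  have hr01 : r ∈ Icc (0 : ℝ) 1 :=
    ⟨(hs _ (hmem i)).1.1.trans hr.1.le, hr.2.le.trans (hs _ (hmem (i + 1))).1.2⟩
  simp [s, hr01, hfr]

theorem exists_isStarCover [T2Space M] {f : ℝ → M} (hf : HasAnalyticGerms I f)
    (hfc : Continuous f) : ∃ T ε B, IsStarCover I f T ε B := by
  choose ε B hS using exists_isStar hf hfc
  obtain ⟨T, -, hT⟩ := (isCompact_Icc.image (s := Icc (0 : ℝ) 1) hfc).elim_nhds_subcover
    (fun p => coordBall I p (ε p / 2))
    (fun p _ => (isOpen_coordBall I p _).mem_nhds (self_mem_coordBall I p (half_pos (hS p).pos)))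
  exact ⟨T, ε, B, T.finite_toSet, fun p _ => hS p, fun τ hτ => by
    simpa using hT (mem_image_of_mem f hτ)⟩

section StarCover

variable {f : ℝ → M} {T : Set M} {ε : M → ℝ} {B : M → Set (ℝ → EuclideanModel E)} {a b c d : ℝ}

theorem IsStarCover.isEdge (hC : IsStarCover I f T ε B) (hfc : Continuous f) (hlt : a < b)
    (hab : Ioo a b ⊆ Icc 0 1) (hV : ∀ τ ∈ Ioo a b, f τ ∉ starVertices I f T ε) :
    IsEdge I f a b := by
  obtain ⟨m, hm⟩ := nonempty_Ioo.2 hlt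
  obtain ⟨p, hp, hmp, σ, hσ, hmσ⟩ := hC.exists_radialAt (hab hm) (hV m hm)
  exact (hC.isArc hfc hab hV hm hp hmp hσ hmσ).isEdge

theorem IsStarCover.exists_isReparam (hC : IsStarCover I f T ε B) (hfc : Continuous f)
    (hab : Icc a b ⊆ Icc 0 1) (hcd : Icc c d ⊆ Icc 0 1)
    (hV : ∀ τ ∈ Ioo a b, f τ ∉ starVertices I f T ε)
    (hV' : ∀ τ ∈ Ioo c d, f τ ∉ starVertices I f T ε)
    (ha : f a ∈ starVertices I f T ε) (hb : f b ∈ starVertices I f T ε)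
    (hc : f c ∈ starVertices I f T ε) (hd : f d ∈ starVertices I f T ε)
    {τ τ' : ℝ} (hτ : τ ∈ Ioo a b) (hτ' : τ' ∈ Ioo c d) (heq : f τ = f τ') :
    ∃ φ, IsReparam f a b c d φ := by
  have hab' := Ioo_subset_Icc_self.trans hab
  have hcd' := Ioo_subset_Icc_self.trans hcd
  obtain ⟨p, hp, hτp, σ, hσ, hτσ⟩ := hC.exists_radialAt (hab' hτ) (hV τ hτ)
  have hτ'p : f τ' ∈ coordBall I p (ε p / 2) := heq ▸ hτp
  have hτ'σ : RadialAt I f p σ τ' := by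
    have hhalf := half_le_self (hC.star p hp).pos.le
    obtain h | ⟨σ', -, h⟩ := (hC.star p hp).radial τ' (hcd' hτ') (coordBall_mono hhalf hτ'p)
    · exact (hτσ.ne (heq.trans h)).elim
    · exact ⟨h.mem, h.ne, heq ▸ hτσ.branch, h.deriv_ne, h.analytic⟩
  exact (hC.isArc hfc hab' hV hτ hp hτp hσ hτσ).exists_isReparam hfc
    (hC.isArc hfc hcd' hV' hτ' hp hτ'p hσ hτ'σ) ha hb hc hd hV hV' hτ hτ' heq

end StarCover

theorem exists_isEdgePartition [T2Space M] {f : ℝ → M} (hf : HasAnalyticGerms I f)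
    (hfc : Continuous f) : ∃ n t, IsEdgePartition I f n t := by
  obtain ⟨T, ε, B, hC⟩ := exists_isStarCover hf hfc
  obtain ⟨n, t, ht0, htn, hlt, htV, hpiece⟩ :=
    hf.exists_partition hfc hC.finite_starVertices (Or.inl (by simp)) (Or.inl (by simp))
  have hsub : ∀ i, Icc (t i) (t (i + 1)) ⊆ Icc 0 1 := fun i =>
    Icc_subset_Icc (htV i).1.1 (htV (i + 1)).1.2
  have hedge : ∀ i < n, (∀ τ ∈ Ioo (t i) (t (i + 1)), f τ ∉ starVertices I f T ε) →
      IsEdge I f (t i) (t (i + 1)) := fun i hi =>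
    hC.isEdge hfc (hlt i hi) (Ioo_subset_Icc_self.trans (hsub i))
  refine ⟨n, t, ht0, htn, hlt, fun i hi => (hpiece i hi).imp_right (hedge i hi),
    fun i hi he j hj => ?_⟩
  have hav : ∀ τ ∈ Ioo (t i) (t (i + 1)), f τ ∉ starVertices I f T ε := by
    have hr := right_mem_Icc.2 (hlt i hi).le
    refine (hpiece i hi).resolve_left fun h => (hlt i hi).ne' ?_
    exact he.inj hr (left_mem_Icc.2 (hlt i hi).le) (h _ hr)
  rw [or_iff_not_imp_left, Set.not_disjoint_iff]
  rintro ⟨_, ⟨τ, hτ, rfl⟩, τ', hτ', heq⟩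
  have hτ'V : f τ' ∉ starVertices I f T ε := heq ▸ hav τ hτ
  have hav' : ∀ τ ∈ Ioo (t j) (t (j + 1)), f τ ∉ starVertices I f T ε :=
    (hpiece j hj).resolve_left fun h => hτ'V (h τ' hτ' ▸ (htV j).2)
  have hτ'Ioo : τ' ∈ Ioo (t j) (t (j + 1)) := by
    refine ⟨lt_of_le_of_ne hτ'.1 fun h => hτ'V ?_, lt_of_le_of_ne hτ'.2 fun h => hτ'V ?_⟩
    · exact h ▸ (htV j).2
    · exact h ▸ (htV (j + 1)).2
  exact ⟨hedge j hj hav', hC.exists_isReparam hfc (hsub i) (hsub j) hav hav' (htV i).2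
    (htV (i + 1)).2 (htV j).2 (htV (j + 1)).2 hτ hτ'Ioo heq.symm⟩

end Decomposition

section Counting

variable {X : Type*}

open Classical in
/-- `1` or `-1` if the restriction of `f` to `[c, d]` is an orientation preserving, respectively
reversing, reparametrization of the restriction to `[a, b]`, and `0` if it is no
reparametrization. -/
def edgeSign (f : ℝ → X) (a b c d : ℝ) : ℤ :=
  if ∃ φ, IsReparam f a b c d φ ∧ φ c = a ∧ φ d = b then 1
  else if ∃ φ, IsReparam f a b c d φ then -1 else 0

/-- The number of times that `f` runs through the edge `[t i, t (i + 1)]`, counted with sign. -/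
def edgeCount (f : ℝ → X) (n : ℕ) (t : ℕ → ℝ) (i : ℕ) : ℤ :=
  ∑ j ∈ Finset.range n, edgeSign f (t i) (t (i + 1)) (t j) (t (j + 1))

theorem edgeSign_eq_zero {f : ℝ → X} {a b c d : ℝ} (h : ¬∃ φ, IsReparam f a b c d φ) :
    edgeSign f a b c d = 0 := by
  rw [edgeSign, if_neg, if_neg h]
  exact fun ⟨φ, hφ, _⟩ => h ⟨φ, hφ⟩

theorem zpow_finset_sum {ι G : Type*} [CommGroup G] (a : G) (s : Finset ι) (k : ι → ℤ) :
    a ^ ∑ j ∈ s, k j = ∏ j ∈ s, a ^ k j := by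
  classical
  induction s using Finset.induction_on with
  | empty => simp
  | insert j s hj ih => rw [Finset.sum_insert hj, Finset.prod_insert hj, zpow_add, ih]

theorem div_eq_zpow_edgeSign {f : ℝ → X} {a b c d : ℝ} {G : Type*} [CommGroup G] (g : ℝ → G)
    (hg : ∀ φ, IsReparam f a b c d φ → g (φ d) / g (φ c) = g d / g c)
    (h : ∃ φ, IsReparam f a b c d φ) : g d / g c = (g b / g a) ^ edgeSign f a b c d := by
  by_cases hpos : ∃ φ, IsReparam f a b c d φ ∧ φ c = a ∧ φ d = b
  · obtain ⟨φ, hφ, hφc, hφd⟩ := hpos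
    rw [edgeSign, if_pos ⟨φ, hφ, hφc, hφd⟩, zpow_one, ← hg φ hφ, hφc, hφd]
  · rw [edgeSign, if_neg hpos, if_pos h]
    obtain ⟨φ, hφ⟩ := h
    rcases hφ.ends with ⟨hφc, hφd⟩ | ⟨hφc, hφd⟩
    · exact (hpos ⟨φ, hφ, hφc, hφd⟩).elim
    · rw [← hg φ hφ, hφc, hφd, zpow_neg_one, inv_div]

variable {E : Type*} [NormedAddCommGroup E] [NormedSpace ℝ E]
  {H : Type*} [TopologicalSpace H] {I : ModelWithCorners ℝ E H}
  {M : Type*} [TopologicalSpace M] [ChartedSpace H M]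
  {f : ℝ → M} {n : ℕ} {t : ℕ → ℝ} (hP : IsEdgePartition I f n t)

include hP

theorem IsEdgePartition.mid_mem {i : ℕ} (hi : i < n) :
    (t i + t (i + 1)) / 2 ∈ Ioo (t i) (t (i + 1)) := by
  have := hP.lt i hi
  constructor <;> linarith

theorem IsEdgePartition.mem_Icc {i : ℕ} (hi : i ≤ n) : t i ∈ Icc (0 : ℝ) 1 := by
  constructor
  · induction i with
    | zero => exact hP.zero.ge
    | succ k ih => exact (ih (by omega)).trans (hP.lt k (by omega)).le
  · induction hi using Nat.decreasingInduction with
    | self => exact hP.one.le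
    | of_succ k hk ih => exact (hP.lt k hk).le.trans ih

theorem IsEdgePartition.Icc_subset {i : ℕ} (hi : i < n) : Icc (t i) (t (i + 1)) ⊆ Icc 0 1 :=
  Icc_subset_Icc (hP.mem_Icc hi.le).1 (hP.mem_Icc (i := i + 1) hi).2

theorem IsEdgePartition.not_disjoint_of_isReparam {i j : ℕ} (hj : j < n) {φ : ℝ → ℝ}
    (hφ : IsReparam f (t i) (t (i + 1)) (t j) (t (j + 1)) φ) :
    ¬Disjoint (f '' Ioo (t i) (t (i + 1))) (f '' Icc (t j) (t (j + 1))) := by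
  rw [Set.not_disjoint_iff]
  have hm := hP.mid_mem hj
  exact ⟨_, ⟨_, hφ.mapsTo_Ioo hm, rfl⟩, _, Ioo_subset_Icc_self hm,
    (hφ.comp _ (Ioo_subset_Icc_self hm)).symm⟩

theorem IsEdgePartition.isEdge_of_isReparam {i j : ℕ} (hi : i < n) (hj : j < n)
    (he : IsEdge I f (t i) (t (i + 1))) {φ : ℝ → ℝ}
    (hφ : IsReparam f (t i) (t (i + 1)) (t j) (t (j + 1)) φ) : IsEdge I f (t j) (t (j + 1)) :=
  ((hP.disjoint_or i hi he j hj).resolve_left (hP.not_disjoint_of_isReparam hj hφ)).1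

theorem IsEdgePartition.image_eq_of_isReparam {i j : ℕ} (hi : i < n) (hj : j < n)
    (he : IsEdge I f (t i) (t (i + 1))) {φ : ℝ → ℝ}
    (hφ : IsReparam f (t i) (t (i + 1)) (t j) (t (j + 1)) φ) :
    f '' Ioo (t j) (t (j + 1)) = f '' Ioo (t i) (t (i + 1)) := by
  have hsub : ∀ {a b c d : ℝ} {φ : ℝ → ℝ}, IsReparam f a b c d φ →
      f '' Ioo c d ⊆ f '' Ioo a b := by
    rintro a b c d φ hφ _ ⟨τ, hτ, rfl⟩
    exact ⟨φ τ, hφ.mapsTo_Ioo hτ, hφ.comp τ (Ioo_subset_Icc_self hτ)⟩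
  refine (hsub hφ).antisymm ?_
  rcases hP.disjoint_or j hj (hP.isEdge_of_isReparam hi hj he hφ) i hi with h | ⟨-, ψ, hψ⟩
  · have hm := hP.mid_mem hj
    exact (Set.disjoint_left.1 h ⟨_, hm, rfl⟩ (image_mono Ioo_subset_Icc_self
      (hsub hφ ⟨_, hm, rfl⟩))).elim
  · exact hsub hψ

theorem IsEdgePartition.div_eq_prod {G : Type*} [CommGroup G] (g : ℝ → G) :
    g 1 / g 0 = ∏ j ∈ Finset.range n, g (t (j + 1)) / g (t j) := by
  rw [Finset.prod_range_div (fun j => g (t j)), hP.one, hP.zero]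

theorem IsEdgePartition.isReparam_of_image_eq {i j : ℕ} (hi : i < n) (hj : j < n)
    (he : IsEdge I f (t i) (t (i + 1)))
    (himage : f '' Ioo (t j) (t (j + 1)) = f '' Ioo (t i) (t (i + 1))) :
    IsEdge I f (t j) (t (j + 1)) ∧ ∃ φ, IsReparam f (t i) (t (i + 1)) (t j) (t (j + 1)) φ := by
  refine (hP.disjoint_or i hi he j hj).resolve_left fun hdisj => ?_
  have hmid := mem_image_of_mem f (hP.mid_mem hj)
  exact Set.disjoint_left.1 hdisj (himage ▸ hmid) (image_mono Ioo_subset_Icc_self hmid)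

theorem IsEdgePartition.prod_div_eq_zpow_edgeCount {G : Type*} [CommGroup G] (g : ℝ → G) {i : ℕ}
    (hi : i < n) (he : IsEdge I f (t i) (t (i + 1)))
    (hg : ∀ j < n, ∀ φ, IsReparam f (t i) (t (i + 1)) (t j) (t (j + 1)) φ →
      g (φ (t (j + 1))) / g (φ (t j)) = g (t (j + 1)) / g (t j)) {s : Finset ℕ}
    (hs : ∀ j, j ∈ s ↔ j < n ∧ f '' Ioo (t j) (t (j + 1)) = f '' Ioo (t i) (t (i + 1))) :
    ∏ j ∈ s, g (t (j + 1)) / g (t j) = (g (t (i + 1)) / g (t i)) ^ edgeCount f n t i := by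
  have hsubset : s ⊆ Finset.range n := fun j hj => Finset.mem_range.2 ((hs j).1 hj).1
  have hcount : edgeCount f n t i =
      ∑ j ∈ s, edgeSign f (t i) (t (i + 1)) (t j) (t (j + 1)) := by
    refine (Finset.sum_subset hsubset fun j hj hjs => edgeSign_eq_zero fun ⟨φ, hφ⟩ => hjs ?_).symm
    rw [Finset.mem_range] at hj
    exact (hs j).2 ⟨hj, hP.image_eq_of_isReparam hi hj he hφ⟩
  rw [hcount, zpow_finset_sum]
  refine Finset.prod_congr rfl fun j hj => ?_
  obtain ⟨hjn, himage⟩ := (hs j).1 hj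
  exact div_eq_zpow_edgeSign g (hg j hjn) (hP.isReparam_of_image_eq hi hjn he himage).2

theorem IsEdgePartition.div_eq_zpow_edgeCount {G : Type*} [CommGroup G] (g : ℝ → G) {i : ℕ}
    (hi : i < n) (he : IsEdge I f (t i) (t (i + 1)))
    (hg : ∀ j < n, ∀ φ, IsReparam f (t i) (t (i + 1)) (t j) (t (j + 1)) φ →
      g (φ (t (j + 1))) / g (φ (t j)) = g (t (j + 1)) / g (t j))
    (hd : ∀ j < n, Disjoint (f '' Ioo (t i) (t (i + 1))) (f '' Icc (t j) (t (j + 1))) →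
      g (t (j + 1)) = g (t j)) :
    g 1 / g 0 = (g (t (i + 1)) / g (t i)) ^ edgeCount f n t i := by
  classical
  rw [hP.div_eq_prod, ← hP.prod_div_eq_zpow_edgeCount g hi he hg (s := (Finset.range n).filter
    fun j => f '' Ioo (t j) (t (j + 1)) = f '' Ioo (t i) (t (i + 1))) (by simp)]
  refine (Finset.prod_filter_of_ne fun j hj hne => ?_).symm
  rw [Finset.mem_range] at hj
  obtain hdisj | ⟨-, φ, hφ⟩ := hP.disjoint_or i hi he j hj
  · exact (hne (div_eq_one.2 (hd j hj hdisj))).elim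
  · exact hP.image_eq_of_isReparam hi hj he hφ

/-- The increments are grouped by the track of their edge: those over the track of the `i`-th edge
multiply to the `edgeCount f n t i`-th power of a single increment. -/
theorem IsEdgePartition.eq_of_edgeCount_eq_zero {G : Type*} [CommGroup G] (g : ℝ → G)
    (hcount : ∀ i < n, IsEdge I f (t i) (t (i + 1)) → edgeCount f n t i = 0)
    (hconst : ∀ i < n, (∀ τ ∈ Icc (t i) (t (i + 1)), f τ = f (t i)) → g (t (i + 1)) = g (t i))
    (hg : ∀ i < n, ∀ j < n, IsEdge I f (t i) (t (i + 1)) →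
      ∀ φ, IsReparam f (t i) (t (i + 1)) (t j) (t (j + 1)) φ →
      g (φ (t (j + 1))) / g (φ (t j)) = g (t (j + 1)) / g (t j)) : g 1 = g 0 := by
  classical
  let track : ℕ → Set M := fun j => f '' Ioo (t j) (t (j + 1))
  rw [← div_eq_one, hP.div_eq_prod, ← Finset.prod_fiberwise_of_maps_to (g := track)
    (t := (Finset.range n).image track) fun j hj => Finset.mem_image_of_mem track hj]
  refine Finset.prod_eq_one fun K hK => ?_
  obtain ⟨i, hi, rfl⟩ := Finset.mem_image.1 hK
  rw [Finset.mem_range] at hi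
  by_cases he : IsEdge I f (t i) (t (i + 1))
  · rw [hP.prod_div_eq_zpow_edgeCount g hi he (fun j hj => hg i hi j hj he) (by simp [track]),
      hcount i hi he, zpow_zero]
  · refine Finset.prod_eq_one fun j hj => div_eq_one.2 ?_
    obtain ⟨hjn, himage⟩ : j < n ∧ track j = track i := by simpa using hj
    exact hconst j hjn ((hP.const_or_edge j hjn).resolve_right fun hej =>
      he (hP.isReparam_of_image_eq hjn hi hej himage.symm).1)

theorem IsEdgePartition.continuousOn {Y : Type*} [TopologicalSpace Y] {g : ℝ → Y}
    (hg : ∀ i < n, ContinuousOn g (Icc (t i) (t (i + 1)))) : ContinuousOn g (Icc 0 1) := by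
  have hinit : ∀ k ≤ n, ContinuousOn g (Icc 0 (t k)) := by
    intro k
    induction k with
    | zero => intro _; simp [hP.zero]
    | succ k ih =>
      intro hk
      rw [← Icc_union_Icc_eq_Icc (hP.mem_Icc (i := k) (by omega)).1 (hP.lt k (by omega)).le]
      exact (ih (by omega)).union_of_isClosed (hg k (by omega)) isClosed_Icc isClosed_Icc
  simpa [hP.one] using hinit n le_rfl

end Counting

section Winding

variable {X : Type*}

/-- The affine function that runs from `0` to `2π` on `[a, b]`. -/
def windingAngle (a b s : ℝ) : ℝ := 2 * Real.pi * ((s - a) / (b - a))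

theorem continuous_windingAngle (a b : ℝ) : Continuous (windingAngle a b) := by
  unfold windingAngle
  fun_prop

theorem windingAngle_left (a b : ℝ) : windingAngle a b a = 0 := by simp [windingAngle]

theorem windingAngle_right {a b : ℝ} (hab : a < b) : windingAngle a b b = 2 * Real.pi := by
  rw [windingAngle, div_self (sub_pos.2 hab).ne', mul_one]

open Classical in
/-- The map to the circle that winds once along `f` restricted to `[a, b]` and collapses the
rest. It detects how often a path runs through `f` restricted to `[a, b]`. -/
def windingMap (f : ℝ → X) (a b : ℝ) (y : X) : Circle :=
  if h : ∃ s ∈ Icc a b, f s = y then Circle.exp (windingAngle a b h.choose) else 1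

theorem windingMap_apply {f : ℝ → X} {a b s : ℝ} (hf : InjOn f (Icc a b)) (hs : s ∈ Icc a b) :
    windingMap f a b (f s) = Circle.exp (windingAngle a b s) := by
  have h : ∃ s' ∈ Icc a b, f s' = f s := ⟨s, hs, rfl⟩
  rw [windingMap, dif_pos h, hf h.choose_spec.1 hs h.choose_spec.2]

theorem windingMap_eq_one {f : ℝ → X} {a b : ℝ} (hab : a < b) (hf : InjOn f (Icc a b)) {y : X}
    (hy : y ∉ f '' Ioo a b) : windingMap f a b y = 1 := by
  by_cases h : ∃ s ∈ Icc a b, f s = y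
  · obtain ⟨s, hs, rfl⟩ := h
    rw [windingMap_apply hf hs]
    rcases hs.1.eq_or_lt with rfl | has
    · rw [windingAngle_left, Circle.exp_zero]
    rcases hs.2.eq_or_lt with rfl | hsb
    · rw [windingAngle_right hab, Circle.exp_two_pi]
    · exact (hy ⟨s, ⟨has, hsb⟩, rfl⟩).elim
  · rw [windingMap, dif_neg h]

theorem sub_eq_sub_of_exp_eq {c d : ℝ} (hcd : c ≤ d) {θ ψ : ℝ → ℝ}
    (hθ : ContinuousOn θ (Icc c d)) (hψ : ContinuousOn ψ (Icc c d))
    (hexp : ∀ τ ∈ Icc c d, Circle.exp (θ τ) = Circle.exp (ψ τ)) : θ d - ψ d = θ c - ψ c := by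
  have hone : ∀ τ ∈ Icc c d, Circle.exp (θ τ - ψ τ) = 1 := fun τ hτ => by
    rw [Circle.exp_sub, hexp τ hτ, div_self']
  exact Circle.isCoveringMap_exp.constOn_of_comp (g := fun τ => θ τ - ψ τ) isPreconnected_Icc
    (hθ.sub hψ) (fun τ hτ τ' hτ' => (hone τ hτ).trans (hone τ' hτ').symm)
    (right_mem_Icc.2 hcd) (left_mem_Icc.2 hcd)

section Thin

variable [TopologicalSpace X] [T2Space X] {x : X} {α : Path x x}

/-- The image of `α` carries the quotient topology, so `w` is continuous on the image, which
contains the homotopy. -/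
theorem IsThin.homotopicRel_const {Y : Type*} [TopologicalSpace Y] (hα : IsThin α) {w : X → Y}
    (hw : Continuous fun s => w (α s)) :
    (⟨fun s => w (α s), hw⟩ : C(unitInterval, Y)).HomotopicRel
      (ContinuousMap.const unitInterval (w x)) {0, 1} := by
  obtain ⟨F, hF⟩ := hα
  have hquot : IsQuotientMap (rangeFactorization α) :=
    (Continuous.isClosedMap (by fun_prop)).isQuotientMap (by fun_prop)
      rangeFactorization_surjective
  have hrange : Continuous fun y : range α => w y := hquot.continuous_iff.2 hw
  exact ⟨{
    toFun z := w (F z)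
    continuous_toFun := hrange.comp (F.continuous.subtype_mk hF)
    map_zero_left s := by simp
    map_one_left s := by simp
    prop' s z hz := by rcases hz with rfl | rfl <;> simp }⟩

theorem IsThin.exists_lift (hα : IsThin α) {w : X → Circle} (hw : Continuous fun s => w (α s)) :
    ∃ θ : ℝ → ℝ, Continuous θ ∧ (∀ τ, Circle.exp (θ τ) = w (α.extend τ)) ∧ θ 1 = θ 0 := by
  obtain ⟨e, he⟩ := Circle.exp_surjective (w x)
  have h0 : w (α 0) = Circle.exp e := by rw [α.source, he]
  let Θ := Circle.isCoveringMap_exp.liftPath ⟨fun s => w (α s), hw⟩ e h0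
  have hΘ0 : Θ 0 = e := Circle.isCoveringMap_exp.liftPath_zero _ e h0
  have hΘ1 : Θ 1 = e := by
    have := Circle.isCoveringMap_exp.liftPath_apply_one_eq_of_homotopicRel
      (hα.homotopicRel_const hw) e h0 he.symm
    rwa [Circle.isCoveringMap_exp.liftPath_const he.symm] at this
  refine ⟨fun τ => Θ (projIcc 0 1 zero_le_one τ), Θ.continuous.comp continuous_projIcc,
    fun τ => congrFun (Circle.isCoveringMap_exp.liftPath_lifts _ e h0) _, ?_⟩
  simp only [projIcc_right, projIcc_left]
  exact hΘ1.trans hΘ0.symm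

end Thin

section EdgePartition

variable {E : Type*} [NormedAddCommGroup E] [NormedSpace ℝ E]
  {H : Type*} [TopologicalSpace H] {I : ModelWithCorners ℝ E H}
  {M : Type*} [TopologicalSpace M] [ChartedSpace H M]
  {f : ℝ → M} {n : ℕ} {t : ℕ → ℝ} {i j : ℕ}

theorem IsEdgePartition.windingMap_eq_one_of_disjoint (hP : IsEdgePartition I f n t) (hi : i < n)
    (he : IsEdge I f (t i) (t (i + 1)))
    (hdisj : Disjoint (f '' Ioo (t i) (t (i + 1))) (f '' Icc (t j) (t (j + 1)))) :
    ∀ τ ∈ Icc (t j) (t (j + 1)), windingMap f (t i) (t (i + 1)) (f τ) = 1 := fun _ hτ =>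
  windingMap_eq_one (hP.lt i hi) he.inj fun h =>
    Set.disjoint_left.1 hdisj h (mem_image_of_mem f hτ)

theorem windingMap_eq_exp_of_isReparam {a b c d : ℝ} {φ : ℝ → ℝ} (he : IsEdge I f a b)
    (hφ : IsReparam f a b c d φ) {τ : ℝ} (hτ : τ ∈ Icc c d) :
    windingMap f a b (f τ) = Circle.exp (windingAngle a b (φ τ)) := by
  rw [← hφ.comp τ hτ, windingMap_apply he.inj (hφ.mapsTo hτ)]

theorem IsEdgePartition.continuousOn_windingMap (hP : IsEdgePartition I f n t) (hi : i < n)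
    (he : IsEdge I f (t i) (t (i + 1))) :
    ContinuousOn (fun τ => windingMap f (t i) (t (i + 1)) (f τ)) (Icc 0 1) := by
  refine hP.continuousOn fun j hj => ?_
  rcases hP.disjoint_or i hi he j hj with hdisj | ⟨-, φ, hφ⟩
  · exact continuousOn_const.congr (hP.windingMap_eq_one_of_disjoint hi he hdisj)
  · exact ((Circle.exp.continuous.comp (continuous_windingAngle _ _)).comp_continuousOn
      hφ.cont).congr fun τ hτ => windingMap_eq_exp_of_isReparam he hφ hτ

/-- Along each passage through the edge the lift `θ` increases or decreases by `2π`, elsewhere it is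
constant. -/
theorem IsEdgePartition.edgeCount_eq_zero_of_lift (hP : IsEdgePartition I f n t) (hi : i < n)
    (he : IsEdge I f (t i) (t (i + 1))) {θ : ℝ → ℝ} (hθ : Continuous θ)
    (hlift : ∀ τ, Circle.exp (θ τ) = windingMap f (t i) (t (i + 1)) (f τ)) (hends : θ 1 = θ 0) :
    edgeCount f n t i = 0 := by
  set a := t i
  set b := t (i + 1)
  have hab : a < b := hP.lt i hi
  have hincr : ∀ j < n, ∀ φ, IsReparam f a b (t j) (t (j + 1)) φ →
      θ (t (j + 1)) - θ (t j) =
        windingAngle a b (φ (t (j + 1))) - windingAngle a b (φ (t j)) := fun j hj φ hφ => by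
    rw [sub_eq_sub_iff_sub_eq_sub]
    exact sub_eq_sub_of_exp_eq (hP.lt j hj).le hθ.continuousOn
      ((continuous_windingAngle a b).comp_continuousOn hφ.cont)
      fun τ hτ => (hlift τ).trans (windingMap_eq_exp_of_isReparam he hφ hτ)
  have hself : θ b - θ a = 2 * Real.pi := by
    have := sub_eq_sub_of_exp_eq hab.le hθ.continuousOn
      (continuous_windingAngle a b).continuousOn
      fun τ hτ => (hlift τ).trans (windingMap_apply he.inj hτ)
    rw [windingAngle_right hab, windingAngle_left] at this
    linarith
  have hreparam : ∀ j < n, ∀ φ, IsReparam f a b (t j) (t (j + 1)) φ →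
      θ (φ (t (j + 1))) - θ (φ (t j)) = θ (t (j + 1)) - θ (t j) := fun j hj φ hφ => by
    rw [hincr j hj φ hφ]
    rcases hφ.ends with ⟨h, h'⟩ | ⟨h, h'⟩ <;> rw [h, h', windingAngle_left, windingAngle_right hab]
    <;> linarith
  have hconst : ∀ j < n, Disjoint (f '' Ioo a b) (f '' Icc (t j) (t (j + 1))) →
      θ (t (j + 1)) = θ (t j) := fun j hj hdisj => by
    have := sub_eq_sub_of_exp_eq (hP.lt j hj).le hθ.continuousOn (continuousOn_const (c := 0))
      fun τ hτ => by
        rw [hlift τ, hP.windingMap_eq_one_of_disjoint hi he hdisj τ hτ, Circle.exp_zero]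
    simpa only [sub_zero] using this
  have hcount := hP.div_eq_zpow_edgeCount (fun τ => Multiplicative.ofAdd (θ τ)) hi he
    (fun j hj φ hφ => congrArg Multiplicative.ofAdd (hreparam j hj φ hφ))
    fun j hj hdisj => congrArg Multiplicative.ofAdd (hconst j hj hdisj)
  replace hcount : θ 1 - θ 0 = edgeCount f n t i • (θ b - θ a) :=
    congrArg Multiplicative.toAdd hcount
  rw [hends, sub_self, hself, eq_comm, smul_eq_zero] at hcount
  exact hcount.resolve_right (by positivity)

theorem IsThin.edgeCount_eq_zero [T2Space M] {x : M} {α : Path x x} (hα : IsThin α)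
    (hP : IsEdgePartition I α.extend n t) (hi : i < n)
    (he : IsEdge I α.extend (t i) (t (i + 1))) : edgeCount α.extend n t i = 0 := by
  have hw : Continuous fun s => windingMap α.extend (t i) (t (i + 1)) (α s) :=
    ((hP.continuousOn_windingMap hi he).comp_continuous continuous_subtype_val
      fun s : unitInterval => s.2).congr fun s => by simp
  obtain ⟨θ, hθ, hlift, hends⟩ := hα.exists_lift hw
  exact hP.edgeCount_eq_zero_of_lift hi he hθ hlift hends

end EdgePartition

end Winding

section Lasso

variable {X : Type*} [TopologicalSpace X]

theorem homotopic_of_continuous_uncurry {a b : X} {p : unitInterval → Path a b}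
    (hp : Continuous ↿p) : (p 0).Homotopic (p 1) :=
  ⟨{
    toFun z := p z.1 z.2
    continuous_toFun := hp
    map_zero_left _ := rfl
    map_one_left _ := rfl
    prop' r z hz := by rcases hz with rfl | rfl <;> simp }⟩

theorem homotopic_trans_symm_cast {a y y' y'' : X} (p : Path a y) (q : Path a y') (r : Path a y'')
    (h : y = y') (h' : y' = y'') :
    ((p.trans (q.symm.cast h rfl)).trans (q.trans (r.symm.cast h' rfl))).Homotopic
      (p.trans (r.symm.cast (h.trans h') rfl)) := by
  subst h h'
  simp only [Path.cast_rfl_rfl]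
  rw [← Path.Homotopic.Quotient.eq]
  simp only [Path.Homotopic.Quotient.mk_trans, Path.Homotopic.Quotient.mk_symm]
  rw [Path.Homotopic.Quotient.trans_assoc,
    ← Path.Homotopic.Quotient.trans_assoc (Path.Homotopic.Quotient.mk q).symm,
    Path.Homotopic.Quotient.symm_trans, Path.Homotopic.Quotient.refl_trans]

variable {x : X} (α : Path x x)

/-- The base point of the image of a loop. -/
def rangeBase : range α := ⟨x, 0, α.source⟩

/-- The points of a loop as points of its image. -/
def rangePoint (t : ℝ) : range α := ⟨α.extend t, projIcc 0 1 zero_le_one t, rfl⟩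

theorem continuous_rangePoint : Continuous (rangePoint α) :=
  α.extend.continuous.subtype_mk _

/-- The initial part of a loop up to the parameter `s`, as a path in the image of the loop. -/
def initialPath (s : ℝ) : Path (rangeBase α) (rangePoint α s) where
  toFun z := rangePoint α (s * z)
  continuous_toFun := (continuous_rangePoint α).comp (by fun_prop)
  source' := Subtype.ext (by simp [rangePoint, rangeBase])
  target' := by simp

/-- Run along the loop up to the parameter `s`, and back from another parameter
of the same point. -/
def lasso (s s' : ℝ) (h : α.extend s = α.extend s') : Path (rangeBase α) (rangeBase α) :=
  (initialPath α s).trans ((initialPath α s').symm.cast (Subtype.ext h) rfl)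

theorem lasso_trans {s s' s'' : ℝ} (h : α.extend s = α.extend s')
    (h' : α.extend s' = α.extend s'') :
    ((lasso α s s' h).trans (lasso α s' s'' h')).Homotopic (lasso α s s'' (h.trans h')) :=
  homotopic_trans_symm_cast _ _ _ _ _

theorem lasso_homotopic {c d : ℝ} (hcd : c ≤ d) {φ ψ : ℝ → ℝ} (hφ : ContinuousOn φ (Icc c d))
    (hψ : ContinuousOn ψ (Icc c d)) (h : ∀ τ ∈ Icc c d, α.extend (φ τ) = α.extend (ψ τ)) :
    (lasso α (φ c) (ψ c) (h c (left_mem_Icc.2 hcd))).Homotopic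
      (lasso α (φ d) (ψ d) (h d (right_mem_Icc.2 hcd))) := by
  let l : unitInterval → ℝ := fun r => AffineMap.lineMap c d (r : ℝ)
  have hlmem : ∀ r, l r ∈ Icc c d := fun r => by
    rw [← segment_eq_Icc hcd]
    exact lineMap_mem_segment ℝ c d r.2
  have hl : Continuous l := AffineMap.lineMap_continuous.comp continuous_subtype_val
  have hinitial : ∀ {χ : ℝ → ℝ}, ContinuousOn χ (Icc c d) →
      Continuous ↿fun r => initialPath α (χ (l r)) := fun hχ =>
    (continuous_rangePoint α).comp (((hχ.comp_continuous hl hlmem).comp continuous_fst).mul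
      (continuous_subtype_val.comp continuous_snd))
  have hlasso : Continuous
      ↿fun r : unitInterval => lasso α (φ (l r)) (ψ (l r)) (h _ (hlmem r)) :=
    Path.trans_continuous_family _ (hinitial hφ)
      (fun r => (initialPath α (ψ (l r))).symm.cast (Subtype.ext (h _ (hlmem r))) rfl)
      (Path.symm_continuous_family _ (hinitial hψ))
  simpa [l] using homotopic_of_continuous_uncurry hlasso

end Lasso

section Commutator

variable {E : Type*} [NormedAddCommGroup E] [NormedSpace ℝ E]
  {H : Type*} [TopologicalSpace H] {I : ModelWithCorners ℝ E H}
  {M : Type*} [TopologicalSpace M] [ChartedSpace H M] {x : M}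

theorem IsPiecewiseAnalytic.cast {x y x' y' : M} {γ : Path x y} (h : IsPiecewiseAnalytic I γ)
    (hx : x' = x) (hy : y' = y) : IsPiecewiseAnalytic I (γ.cast hx hy) := by
  subst hx hy
  exact h

theorem IsPiecewiseAnalytic.map_initialPath {α : Path x x} (h : IsPiecewiseAnalytic I α) {s : ℝ}
    (hs : s ∈ Icc (0 : ℝ) 1) :
    IsPiecewiseAnalytic I ((initialPath α s).map continuous_subtype_val) := by
  have hval : ∀ z : unitInterval,
      (initialPath α s).map continuous_subtype_val z = α.extend (s * z) := fun z => rfl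
  rcases hs.1.eq_or_lt with rfl | hs0
  · refine ⟨1, fun i => i, by simp, by simp, fun i _ => by simp,
      fun i _ => ⟨fun _ => x, fun _ _ => contMDiffAt_const, fun z _ => ?_⟩⟩
    rw [hval, zero_mul, Path.extend_zero]
  obtain ⟨n, t, h0, h1, hm, ha⟩ := h
  refine ⟨n, fun i => min (t i / s) 1, by simp [h0], ?_, fun i hi => ?_, fun i hi => ?_⟩
  · change min (t n / s) 1 = 1
    rw [h1, min_eq_right]
    exact (one_le_div hs0).2 hs.2
  · exact min_le_min_right _ (div_le_div_of_nonneg_right (hm i hi) hs0.le)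
  rcases le_or_gt s (t i) with hle | hlt
  · refine ⟨fun _ => α.extend s, fun _ _ => contMDiffAt_const, fun z hz => ?_⟩
    have hz1 : 1 ≤ (z : ℝ) := min_eq_right ((one_le_div hs0).2 hle) ▸ hz.1
    rw [hval, le_antisymm z.2.2 hz1, mul_one]
  · obtain ⟨c, hc, hγ⟩ := ha i hi
    have hmaps : ∀ r ∈ Icc (min (t i / s) 1) (min (t (i + 1) / s) 1),
        s * r ∈ Icc (t i) (t (i + 1)) := fun r hr => by
      rw [min_eq_left ((div_le_one hs0).2 hlt.le)] at hr
      exact ⟨(div_le_iff₀' hs0).1 hr.1, (le_div_iff₀' hs0).1 (hr.2.trans (min_le_left _ _))⟩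
    refine ⟨fun r => c (s * r + 0), fun r hr => contMDiffAt_comp_affine (hc _ ?_), fun z hz => ?_⟩
    · rw [add_zero]
      exact hmaps r hr
    · have hmem : s * (z : ℝ) ∈ unitInterval :=
        ⟨mul_nonneg hs0.le z.2.1, mul_le_one₀ hs.2 z.2.1 z.2.2⟩
      rw [hval, Path.extend_apply _ hmem, hγ ⟨_, hmem⟩ (hmaps z hz)]
      simp only [add_zero]

theorem IsPiecewiseAnalytic.map_lasso {α : Path x x} (h : IsPiecewiseAnalytic I α) {s s' : ℝ}
    (hs : s ∈ Icc (0 : ℝ) 1) (hs' : s' ∈ Icc (0 : ℝ) 1) (he : α.extend s = α.extend s') :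
    IsPiecewiseAnalytic I ((lasso α s s' he).map continuous_subtype_val) := by
  rw [lasso, Path.map_trans]
  exact (h.map_initialPath hs).trans ((h.map_initialPath hs').symm.cast he rfl)

theorem LoopGroup.mk_eq_of_homotopic (α : PALoop I x) {p q : Path (rangeBase α.1) (rangeBase α.1)}
    (hp : IsPiecewiseAnalytic I (p.map continuous_subtype_val))
    (hq : IsPiecewiseAnalytic I (q.map continuous_subtype_val)) (h : p.Homotopic q) :
    LoopGroup.mk (I := I) (x := x) ⟨p.map continuous_subtype_val, hp⟩ =
      LoopGroup.mk (x := x) ⟨q.map continuous_subtype_val, hq⟩ := by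
  -- The homotopy stays in the image of `α`, so it becomes thin after composition with `α`.
  refine mul_right_cancel (b := LoopGroup.mk α)
    (Quot.sound (thinEquiv_of_cls fun S hpα hqα _ => ?_))
  have htrans : ∀ r : Path x x, range (r.trans α.1) ⊆ S → range r ⊆ S ∧ range α.1 ⊆ S :=
    fun r hr => by rwa [Path.trans_range, union_subset_iff] at hr
  obtain ⟨hpS, hαS⟩ := htrans _ hpα
  obtain ⟨hqS, -⟩ := htrans _ hqα
  dsimp only
  rw [cls_trans (x := x) hpS hαS, cls_trans (x := x) hqS hαS]
  congr 1
  exact Path.Homotopic.Quotient.eq.2 (h.map ⟨Set.inclusion hαS, continuous_inclusion hαS⟩)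

/-- The class of a lasso in the loop group. It measures the difference between two ways of reaching
the same point along `α`. -/
def lassoClass (α : PALoop I x) {s s' : ℝ} (hs : s ∈ Icc (0 : ℝ) 1) (hs' : s' ∈ Icc (0 : ℝ) 1)
    (h : α.1.extend s = α.1.extend s') : LoopGroup I x :=
  LoopGroup.mk ⟨(lasso α.1 s s' h).map continuous_subtype_val, α.2.map_lasso hs hs' h⟩

theorem lassoClass_mul (α : PALoop I x) {s s' s'' : ℝ} (hs : s ∈ Icc (0 : ℝ) 1)
    (hs' : s' ∈ Icc (0 : ℝ) 1) (hs'' : s'' ∈ Icc (0 : ℝ) 1)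
    (h : α.1.extend s = α.1.extend s') (h' : α.1.extend s' = α.1.extend s'') :
    lassoClass α hs hs' h * lassoClass α hs' hs'' h' = lassoClass α hs hs'' (h.trans h') := by
  have htrans : IsPiecewiseAnalytic I (((lasso α.1 s s' h).trans (lasso α.1 s' s'' h')).map
      continuous_subtype_val) := by
    rw [Path.map_trans]
    exact (α.2.map_lasso hs hs' h).trans (α.2.map_lasso hs' hs'' h')
  rw [lassoClass, lassoClass, lassoClass, ← LoopGroup.mk_eq_of_homotopic α htrans
    (α.2.map_lasso hs hs'' (h.trans h')) (lasso_trans α.1 h h')]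
  exact congrArg (LoopGroup.mk (I := I) (x := x))
    (Subtype.ext (Path.map_trans _ _ continuous_subtype_val).symm)

theorem lassoClass_self (α : PALoop I x) {s : ℝ} (hs : s ∈ Icc (0 : ℝ) 1) :
    lassoClass α hs hs rfl = 1 :=
  mul_eq_left.1 (lassoClass_mul α hs hs hs rfl rfl)

theorem lassoClass_one_zero (α : PALoop I x) (h : α.1.extend 1 = α.1.extend 0) :
    lassoClass α (right_mem_Icc.2 zero_le_one) (left_mem_Icc.2 zero_le_one) h =
      LoopGroup.mk α := by
  rw [← mul_one (LoopGroup.mk α), lassoClass]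
  refine congrArg (LoopGroup.mk (I := I)) (Subtype.ext (Path.ext (funext fun z => ?_)))
  change ((lasso α.1 1 0 h) z : M) = (α.1.trans (Path.refl x)) z
  rw [lasso, Path.trans_apply, Path.trans_apply]
  split_ifs with hz
  · change α.1.extend (1 * _) = _
    rw [one_mul, Path.extend_apply]
  · change α.1.extend (0 * _) = x
    rw [zero_mul, Path.extend_zero]

theorem lassoClass_eq_of_continuousOn (α : PALoop I x) {c d : ℝ} (hcd : c ≤ d) {φ ψ : ℝ → ℝ}
    (hφ : ContinuousOn φ (Icc c d)) (hψ : ContinuousOn ψ (Icc c d))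
    (hφI : MapsTo φ (Icc c d) (Icc 0 1)) (hψI : MapsTo ψ (Icc c d) (Icc 0 1))
    (h : ∀ τ ∈ Icc c d, α.1.extend (φ τ) = α.1.extend (ψ τ)) :
    lassoClass α (hφI (left_mem_Icc.2 hcd)) (hψI (left_mem_Icc.2 hcd))
        (h c (left_mem_Icc.2 hcd)) =
      lassoClass α (hφI (right_mem_Icc.2 hcd)) (hψI (right_mem_Icc.2 hcd))
        (h d (right_mem_Icc.2 hcd)) :=
  LoopGroup.mk_eq_of_homotopic α _ _ (lasso_homotopic α.1 hcd hφ hψ h)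

theorem exists_lasso_potential (α : PALoop I x) :
    ∃ g : ℝ → Abelianization (LoopGroup I x), ∀ s s' (hs : s ∈ Icc (0 : ℝ) 1)
      (hs' : s' ∈ Icc (0 : ℝ) 1) (h : α.1.extend s = α.1.extend s'),
      g s = Abelianization.of (lassoClass α hs hs' h) * g s' := by
  classical
  set f := α.1.extend
  let ρ : M → ℝ := Function.invFunOn f (Icc 0 1)
  have hρ : ∀ s ∈ Icc (0 : ℝ) 1, ρ (f s) ∈ Icc (0 : ℝ) 1 := fun s hs =>
    Function.invFunOn_apply_mem hs
  have hfρ : ∀ s ∈ Icc (0 : ℝ) 1, f s = f (ρ (f s)) := fun s hs =>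
    (Function.invFunOn_apply_eq hs).symm
  refine ⟨fun s => if hs : s ∈ Icc (0 : ℝ) 1 then
    Abelianization.of (lassoClass α hs (hρ s hs) (hfρ s hs)) else 1, fun s s' hs hs' h => ?_⟩
  dsimp only
  rw [dif_pos hs, dif_pos hs', ← map_mul, lassoClass_mul]
  congr! 3

theorem mem_commutator_of_edgeCount_eq_zero (α : PALoop I x) {n : ℕ} {t : ℕ → ℝ}
    (hP : IsEdgePartition I α.1.extend n t)
    (hcount : ∀ i < n, IsEdge I α.1.extend (t i) (t (i + 1)) → edgeCount α.1.extend n t i = 0) :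
    LoopGroup.mk α ∈ commutator (LoopGroup I x) := by
  obtain ⟨g, hg⟩ := exists_lasso_potential α
  have hends : g 1 = g 0 := by
    refine hP.eq_of_edgeCount_eq_zero g hcount (fun i hi hconst => ?_) fun i hi j hj _ φ hφ => ?_
    · have hle := (hP.lt i hi).le
      have hti := hP.mem_Icc hi.le
      have hlasso := lassoClass_eq_of_continuousOn α hle (φ := fun τ => τ) (ψ := fun _ => t i)
        continuousOn_id continuousOn_const (hP.Icc_subset hi) (fun _ _ => hti) hconst
      rw [hg _ _ (hP.mem_Icc hi) hti (hconst _ (right_mem_Icc.2 hle)), ← hlasso,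
        lassoClass_self, map_one, one_mul]
    · have hle := (hP.lt j hj).le
      have hφI : MapsTo φ (Icc (t j) (t (j + 1))) (Icc 0 1) := fun τ hτ =>
        hP.Icc_subset hi (hφ.mapsTo hτ)
      have hlasso := lassoClass_eq_of_continuousOn α hle (ψ := fun τ => τ) hφ.cont continuousOn_id
        hφI (hP.Icc_subset hj) hφ.comp
      have hleft := left_mem_Icc.2 hle
      have hright := right_mem_Icc.2 hle
      rw [hg _ _ (hφI hleft) (hP.Icc_subset hj hleft) (hφ.comp _ hleft),
        hg _ _ (hφI hright) (hP.Icc_subset hj hright) (hφ.comp _ hright), hlasso,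
        mul_div_mul_left_eq_div]
  have hloop : α.1.extend 1 = α.1.extend 0 := by simp
  rw [hg 1 0 (right_mem_Icc.2 zero_le_one) (left_mem_Icc.2 zero_le_one) hloop, mul_eq_right,
    lassoClass_one_zero] at hends
  rwa [← Abelianization.ker_of, MonoidHom.mem_ker]

end Commutator

section Velocity

variable {F : Type*} [NormedAddCommGroup F] [NormedSpace ℝ F]
  {K : Type*} [TopologicalSpace K] {J : ModelWithCorners ℝ F K}
  {P : Type*} [TopologicalSpace P] [ChartedSpace K P]

theorem mfderiv_comp_real {u : ℝ → P} {φ : ℝ → ℝ} {t s : ℝ} (hs : φ t = s)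
    (hu : MDifferentiableAt 𝓘(ℝ, ℝ) J u s) (hφ : DifferentiableAt ℝ φ t) (r : ℝ) :
    (mfderiv 𝓘(ℝ, ℝ) J (fun s => u (φ s)) t r : F) =
      (r * deriv φ t) • (mfderiv 𝓘(ℝ, ℝ) J u s (1 : ℝ) : F) := by
  subst hs
  have hchain : mfderiv 𝓘(ℝ, ℝ) J (fun s => u (φ s)) t =
      (mfderiv 𝓘(ℝ, ℝ) J u (φ t)).comp (mfderiv 𝓘(ℝ, ℝ) 𝓘(ℝ, ℝ) φ t) :=
    mfderiv_comp (g := u) (f := φ) t hu hφ.mdifferentiableAt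
  have hφ' : mfderiv 𝓘(ℝ, ℝ) 𝓘(ℝ, ℝ) φ t r = (r * deriv φ t) • (1 : ℝ) := by
    rw [mfderiv_eq_fderiv, smul_eq_mul, mul_one]
    exact (fderiv_eq_deriv_mul (f := φ)).trans (mul_comm _ _)
  rw [hchain]
  exact (congrArg (mfderiv 𝓘(ℝ, ℝ) J u (φ t)) hφ').trans (map_smul _ _ (1 : ℝ))

variable [MulAction Circle P]

theorem contMDiff_exp_smul
    (hs : ContMDiff ((𝓡 1).prod J) J ∞ (fun z : Circle × P => z.1 • z.2)) :
    ContMDiff (𝓘(ℝ, ℝ).prod J) J ∞ (fun z : ℝ × P => Circle.exp z.1 • z.2) :=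
  hs.comp ((contMDiff_circleExp.comp contMDiff_fst).prodMk contMDiff_snd)

variable [IsManifold J ∞ P]

/-- The value of a connection on the velocity of a curve; it vanishes where the curve is horizontal.
-/
def Connection.along (A : Connection J P) (u : ℝ → P) (t : ℝ) : ℝ :=
  A.form (u t) (mfderiv 𝓘(ℝ, ℝ) J u t (1 : ℝ))

theorem Connection.form_congr (A : Connection J P) {p q : P} (h : p = q) (v : F) :
    A.form p v = A.form q v := by rw [h]

theorem Connection.along_congr (A : Connection J P) {u v : ℝ → P} {t : ℝ} (h : u =ᶠ[𝓝 t] v) :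
    A.along u t = A.along v t := by
  rw [Connection.along, Connection.along, h.mfderiv_eq]
  exact A.form_congr h.self_of_nhds _

theorem Connection.form_mfderiv_exp_smul
    (hs : ContMDiff ((𝓡 1).prod J) J ∞ (fun z : Circle × P => z.1 • z.2))
    (A : Connection J P) (q : P) (a r : ℝ) :
    A.form (Circle.exp a • q) (mfderiv 𝓘(ℝ, ℝ) J (fun θ : ℝ => Circle.exp θ • q) a r) = r := by
  have hd : MDifferentiableAt 𝓘(ℝ, ℝ) J (fun θ : ℝ => Circle.exp θ • (Circle.exp a • q)) 0 :=
    ((contMDiff_exp_smul hs).comp (contMDiff_id.prodMk contMDiff_const)).mdifferentiableAt (by simp)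
  have heq : (fun θ : ℝ => Circle.exp θ • q) =
      fun θ : ℝ => Circle.exp (θ - a) • (Circle.exp a • q) := by
    funext θ
    simp [smul_smul]
  have hscale : (mfderiv 𝓘(ℝ, ℝ) J (fun θ : ℝ => Circle.exp θ • q) a r : F) =
      r • (mfderiv 𝓘(ℝ, ℝ) J (fun θ : ℝ => Circle.exp θ • (Circle.exp a • q)) 0 (1 : ℝ) : F) := by
    have hshift := mfderiv_comp_real (J := J) (φ := fun θ : ℝ => θ - a) (sub_self a) hd
      (by fun_prop) r
    rw [deriv_sub_const, deriv_id'', mul_one] at hshift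
    rw [heq]
    exact hshift
  have hbase : Circle.exp a • q = Circle.exp 0 • Circle.exp a • q := by
    rw [Circle.exp_zero, one_smul]
  have hvert : A.form (Circle.exp a • q)
      (mfderiv 𝓘(ℝ, ℝ) J (fun θ : ℝ => Circle.exp θ • (Circle.exp a • q)) 0 (1 : ℝ)) = 1 :=
    (A.form_congr hbase _).trans (A.form_vertical (Circle.exp a • q))
  refine (congrArg (A.form (Circle.exp a • q)) hscale).trans ?_
  refine (map_smul (A.form (Circle.exp a • q)) r _).trans ?_
  exact (congrArg (r * ·) hvert).trans (mul_one r)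

theorem Connection.along_exp_smul
    (hs : ContMDiff ((𝓡 1).prod J) J ∞ (fun z : Circle × P => z.1 • z.2))
    (A : Connection J P) {u : ℝ → P} {t : ℝ} (hu : MDifferentiableAt 𝓘(ℝ, ℝ) J u t) {θ : ℝ → ℝ}
    {θ' : ℝ} (hθ : HasDerivAt θ θ' t) :
    MDifferentiableAt 𝓘(ℝ, ℝ) J (fun s => Circle.exp (θ s) • u s) t ∧
      A.along (fun s => Circle.exp (θ s) • u s) t = A.along u t + θ' := by
  have hΦ : MDifferentiableAt (𝓘(ℝ, ℝ).prod J) J (fun z : ℝ × P => Circle.exp z.1 • z.2)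
      (θ t, u t) := (contMDiff_exp_smul hs).mdifferentiableAt (by simp)
  have hθm : MDifferentiableAt 𝓘(ℝ, ℝ) 𝓘(ℝ, ℝ) θ t :=
    hθ.differentiableAt.mdifferentiableAt
  have hpair : MDifferentiableAt 𝓘(ℝ, ℝ) (𝓘(ℝ, ℝ).prod J) (fun s => (θ s, u s)) t :=
    hθm.prodMk hu
  have hcomp : (fun s => Circle.exp (θ s) • u s) =
    (fun z : ℝ × P => Circle.exp z.1 • z.2) ∘ fun s => (θ s, u s) := rfl
  refine ⟨by rw [hcomp]; exact MDifferentiableAt.comp t hΦ hpair, ?_⟩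
  have hd : mfderiv 𝓘(ℝ, ℝ) J (fun s => Circle.exp (θ s) • u s) t (1 : ℝ) =
      mfderiv 𝓘(ℝ, ℝ) J (fun a : ℝ => Circle.exp a • u t) (θ t) θ' +
      mfderiv J J (fun q : P => Circle.exp (θ t) • q) (u t) (mfderiv 𝓘(ℝ, ℝ) J u t (1 : ℝ)) := by
    have hθ1 : mfderiv 𝓘(ℝ, ℝ) 𝓘(ℝ, ℝ) θ t (1 : ℝ) = θ' := by
      rw [mfderiv_eq_fderiv]
      exact (fderiv_apply_one_eq_deriv (f := θ)).trans hθ.deriv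
    rw [hcomp, mfderiv_comp t hΦ hpair, mfderiv_prodMk hθm hu]
    refine (mfderiv_prod_eq_add_apply hΦ).trans ?_
    congr 1
    exact congrArg _ hθ1
  have hangle := A.form_mfderiv_exp_smul hs (u t) (θ t) θ'
  have hinv := A.invariant (Circle.exp (θ t)) (u t) (mfderiv 𝓘(ℝ, ℝ) J u t (1 : ℝ))
  rw [Connection.along, hd]
  refine (map_add (A.form (Circle.exp (θ t) • u t)) _ _).trans ?_
  rw [hangle, hinv, add_comm]
  rfl

theorem Connection.along_smul
    (hs : ContMDiff ((𝓡 1).prod J) J ∞ (fun z : Circle × P => z.1 • z.2))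
    (A : Connection J P) {u : ℝ → P} {t : ℝ} (hu : MDifferentiableAt 𝓘(ℝ, ℝ) J u t) (g : Circle) :
    MDifferentiableAt 𝓘(ℝ, ℝ) J (fun s => g • u s) t ∧
      A.along (fun s => g • u s) t = A.along u t := by
  obtain ⟨a, rfl⟩ := Circle.exp_surjective g
  simpa using A.along_exp_smul hs hu (hasDerivAt_const t a)

theorem Connection.along_comp (A : Connection J P) {u : ℝ → P} {φ : ℝ → ℝ} {t : ℝ}
    (hu : MDifferentiableAt 𝓘(ℝ, ℝ) J u (φ t)) (hφ : DifferentiableAt ℝ φ t) :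
    MDifferentiableAt 𝓘(ℝ, ℝ) J (fun s => u (φ s)) t ∧
      A.along (fun s => u (φ s)) t = deriv φ t * A.along u (φ t) := by
  have hφm := hφ.mdifferentiableAt
  refine ⟨MDifferentiableAt.comp t hu hφm, ?_⟩
  have hd := mfderiv_comp_real rfl hu hφ 1
  rw [one_mul] at hd
  refine (congrArg (A.form (u (φ t))) hd).trans ?_
  exact map_smul (A.form (u (φ t))) _ _

theorem Connection.continuousOn_along (A : Connection J P) {u : ℝ → P} {s : Set ℝ} (hs : IsOpen s)
    (hu : ContMDiffOn 𝓘(ℝ, ℝ) J ∞ u s) : ContinuousOn (A.along u) s := by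
  have htangent := hu.continuousOn_tangentMapWithin (by simp) hs.uniqueMDiffOn
  have hunit : Continuous fun t : ℝ => (⟨t, (1 : ℝ)⟩ : TangentBundle 𝓘(ℝ, ℝ) ℝ) := by
    have hpair : Continuous fun t : ℝ => ((t, (1 : ℝ)) : ModelProd ℝ ℝ) :=
      continuous_id.prodMk continuous_const
    exact (tangentBundleModelSpaceHomeomorph 𝓘(ℝ, ℝ)).symm.continuous.comp hpair
  have hform := A.smooth_form.continuous.comp_continuousOn
    (htangent.comp (s := s) hunit.continuousOn fun t ht => ht)
  refine hform.congr fun t ht => ?_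
  simp only [Function.comp_apply, tangentMapWithin, Connection.along]
  rw [mfderivWithin_of_isOpen hs ht]
  rfl

end Velocity

section Fibres

variable {E : Type*} [NormedAddCommGroup E] [NormedSpace ℝ E]
  {H : Type*} [TopologicalSpace H] {I : ModelWithCorners ℝ E H}
  {M : Type*} [TopologicalSpace M] [ChartedSpace H M]
  {F : Type*} [NormedAddCommGroup F] [NormedSpace ℝ F]
  {K : Type*} [TopologicalSpace K] {J : ModelWithCorners ℝ F K}
  {P : Type*} [TopologicalSpace P] [ChartedSpace K P] [MulAction Circle P]
  {π : P → M} (hπ : IsPrincipalCircleBundle I J π)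

include hπ

theorem IsPrincipalCircleBundle.continuous_const_smul (g : Circle) :
    Continuous fun p : P => g • p :=
  hπ.smooth_smul.continuous.comp (continuous_const.prodMk continuous_id)

theorem IsPrincipalCircleBundle.proj_smul [T2Space M] (g : Circle) (p : P) : π (g • p) = π p := by
  obtain ⟨a, rfl⟩ := Circle.exp_surjective g
  have hcont : Continuous fun a : ℝ => Circle.exp a • p :=
    (contMDiff_exp_smul hπ.smooth_smul).continuous.comp (continuous_id.prodMk continuous_const)
  have hπc := hπ.smooth_proj.continuous
  suffices h : {a : ℝ | π (Circle.exp a • p) = π p} = univ from h.ge (mem_univ a)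
  refine IsClopen.eq_univ ⟨isClosed_eq (hπc.comp hcont) continuous_const, ?_⟩ ⟨0, by simp⟩
  rw [isOpen_iff_mem_nhds]
  intro a ha
  obtain ⟨U, e, -, hx, hsrc, -, -, -, hfst, hsm⟩ := hπ.locally_trivial (π p)
  have hq : Circle.exp a • p ∈ e.source := by
    rw [hsrc, mem_preimage, show π (Circle.exp a • p) = π p from ha]
    exact hx
  filter_upwards [hcont.continuousAt.preimage_mem_nhds (e.open_source.mem_nhds hq)] with b hb
  have htriv := hsm (Circle.exp (b - a)) _ hq
  rw [smul_smul, ← Circle.exp_add, sub_add_cancel] at htriv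
  change π (Circle.exp b • p) = π p
  rw [← hfst _ hb, htriv, hfst _ hq]
  exact ha

theorem IsPrincipalCircleBundle.exists_smul_eq [T2Space M] {p q : P} (h : π p = π q) :
    ∃ g : Circle, q = g • p := by
  obtain ⟨U, e, -, hx, hsrc, -, -, -, hfst, hsm⟩ := hπ.locally_trivial (π p)
  have hp : p ∈ e.source := by rw [hsrc]; exact hx
  have hq : q ∈ e.source := by rw [hsrc, mem_preimage, ← h]; exact hx
  have hg : ((e q).2 / (e p).2) • p ∈ e.source := by
    rw [hsrc, mem_preimage, hπ.proj_smul]; exact hx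
  refine ⟨(e q).2 / (e p).2, e.injOn hq hg ?_⟩
  rw [hsm _ p hp, div_mul_cancel, hfst p hp, h, ← hfst q hq]

theorem IsPrincipalCircleBundle.smul_left_injective (p : P) :
    Function.Injective fun g : Circle => g • p := by
  intro g g' h
  obtain ⟨U, e, -, hx, hsrc, -, -, -, -, hsm⟩ := hπ.locally_trivial (π p)
  have hp : p ∈ e.source := by rw [hsrc]; exact hx
  have hphase := congrArg (fun q => (e q).2) h
  simp only [hsm _ p hp] at hphase
  exact mul_right_cancel hphase

theorem IsPrincipalCircleBundle.surjective : Function.Surjective π := by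
  intro y
  obtain ⟨U, e, -, hx, -, htgt, -, -, hfst, -⟩ := hπ.locally_trivial y
  have ht : ((y, 1) : M × Circle) ∈ e.target := by rw [htgt]; exact ⟨hx, mem_univ _⟩
  refine ⟨e.symm (y, 1), ?_⟩
  rw [← hfst _ (e.map_target ht), e.right_inv ht]

theorem IsPrincipalCircleBundle.exists_local_phase (y : M) :
    ∃ (U : Set M) (z : P → ℂ), IsOpen U ∧ y ∈ U ∧ ContMDiffOn J 𝓘(ℝ, ℂ) ∞ z (π ⁻¹' U) ∧
      (∀ p, ‖z p‖ = 1) ∧ ∀ (g : Circle), ∀ p ∈ π ⁻¹' U, z (g • p) = g * z p := by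
  obtain ⟨U, e, hU, hx, hsrc, -, he, -, -, hsm⟩ := hπ.locally_trivial y
  refine ⟨U, fun p => ((e p).2 : ℂ), hU, hx, ?_, fun p => Circle.norm_coe _, fun g p hp => ?_⟩
  · rw [← hsrc]
    have : Fact (Module.finrank ℝ ℂ = 1 + 1) := finrank_real_complex_fact'
    have hc : ContMDiff (𝓡 1) 𝓘(ℝ, ℂ) ∞ (fun z : Circle => (z : ℂ)) :=
      contMDiff_coe_sphere (E := ℂ) (n := 1)
    exact hc.comp_contMDiffOn (contMDiff_snd.comp_contMDiffOn he)
  · rw [← hsrc] at hp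
    simp only [hsm g p hp, Circle.coe_mul]

end Fibres

section Intervals

theorem interval_induction {Q : ℝ → ℝ → Prop}
    (htrans : ∀ a b c, a ≤ b → b ≤ c → Q a b → Q b c → Q a c)
    (hloc : ∀ t ∈ Icc (0 : ℝ) 1, ∃ N ∈ 𝓝 t, ∀ a b, a ≤ b → Icc a b ⊆ N → Q a b) : Q 0 1 := by
  choose! N hN hQ using hloc
  obtain ⟨t, ht0, hmono, ⟨n, hn⟩, hsub⟩ := exists_monotone_Icc_subset_open_cover_unitInterval
    (c := fun s : unitInterval => {r : unitInterval | (r : ℝ) ∈ interior (N s)})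
    (fun s => isOpen_interior.preimage continuous_subtype_val)
    (fun s _ => mem_iUnion.2 ⟨s, mem_interior_iff_mem_nhds.2 (hN s s.2)⟩)
  have hstep : ∀ k, Q (t k) (t (k + 1)) := fun k => by
    obtain ⟨s, hs⟩ := hsub k
    refine hQ s s.2 _ _ (hmono (Nat.le_succ k)) fun r hr => interior_subset ?_
    exact hs (a := ⟨r, (t k).2.1.trans hr.1, hr.2.trans (t (k + 1)).2.2⟩) hr
  have hinit : ∀ k, Q 0 (t (k + 1)) := fun k => by
    induction k with
    | zero => simpa [ht0] using hstep 0
    | succ k ih => exact htrans _ _ _ (t (k + 1)).2.1 (hmono (Nat.le_succ _)) ih (hstep _)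
  simpa [hn (n + 1) (by omega)] using hinit n

theorem eq_of_hasDerivAt_zero_off_finite {V : Type*} [NormedAddCommGroup V] [NormedSpace ℝ V]
    [CompleteSpace V] {g : ℝ → V} {a b : ℝ} (hg : ContinuousOn g (Icc a b)) {S : Set ℝ}
    (hS : S.Finite) (hd : ∀ t ∈ Ioo a b, t ∉ S → HasDerivAt g 0 t) {t : ℝ} (ht : t ∈ Icc a b) :
    g t = g a := by
  have hint := integral_eq_of_hasDerivAt_off_countable_of_le g (fun _ => 0) ht.1 hS.countable
    (hg.mono (Icc_subset_Icc_right ht.2))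
    (fun s hs => hd s ⟨hs.1.1, hs.1.2.trans_le ht.2⟩ hs.2) (by simp)
  rw [intervalIntegral.integral_zero] at hint
  exact sub_eq_zero.1 hint.symm

end Intervals

section Lifts

variable {M : Type*} {F : Type*} [NormedAddCommGroup F] [NormedSpace ℝ F]
  {K : Type*} [TopologicalSpace K] {J : ModelWithCorners ℝ F K}
  {P : Type*} [TopologicalSpace P] [ChartedSpace K P] [MulAction Circle P] [IsManifold J ∞ P]
  {π : P → M} {A : Connection J P} {f : ℝ → M} {u v : ℝ → P} {a b c d : ℝ}

/-- Horizontal lifts of the restriction of a curve `f` to `[a, b]`. -/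
structure IsLiftOn (π : P → M) (A : Connection J P) (f : ℝ → M) (a b : ℝ) (u : ℝ → P) : Prop where
  cont : ContinuousOn u (Icc a b)
  proj : ∀ t ∈ Icc a b, π (u t) = f t
  horizontal : ∃ S : Set ℝ, S.Finite ∧ ∀ t ∈ Ioo a b, t ∉ S →
    MDifferentiableAt 𝓘(ℝ, ℝ) J u t ∧ A.along u t = 0

theorem IsLiftOn.congr (h : IsLiftOn π A f a b u) {f' : ℝ → M} (hf : ∀ t ∈ Icc a b, f' t = f t) :
    IsLiftOn π A f' a b u :=
  ⟨h.cont, fun t ht => (h.proj t ht).trans (hf t ht).symm, h.horizontal⟩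

theorem IsLiftOn.mono (h : IsLiftOn π A f a b u) (hac : a ≤ c) (hdb : d ≤ b) :
    IsLiftOn π A f c d u := by
  obtain ⟨S, hS, hh⟩ := h.horizontal
  exact ⟨h.cont.mono (Icc_subset_Icc hac hdb), fun t ht => h.proj t (Icc_subset_Icc hac hdb ht),
    S, hS, fun t ht => hh t (Ioo_subset_Ioo hac hdb ht)⟩

theorem IsLiftOn.glue (hab : a ≤ b) (hbc : b ≤ c) (hu : IsLiftOn π A f a b u)
    (hv : IsLiftOn π A f b c v) (huv : u b = v b) :
    IsLiftOn π A f a c (fun t => if t ≤ b then u t else v t) := by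
  obtain ⟨S, hS, hh⟩ := hu.horizontal
  obtain ⟨T, hT, hh'⟩ := hv.horizontal
  have heu : EqOn (fun t => if t ≤ b then u t else v t) u (Iic b) := fun t ht => if_pos ht
  have hev : EqOn (fun t => if t ≤ b then u t else v t) v (Ici b) := fun t ht => by
    rcases (mem_Ici.1 ht).eq_or_lt with rfl | h
    · simp [huv]
    · exact if_neg (not_le.2 h)
  refine ⟨?_, fun t ht => ?_, S ∪ T ∪ {b}, (hS.union hT).union (finite_singleton b),
    fun t ht htS => ?_⟩
  · rw [← Icc_union_Icc_eq_Icc hab hbc]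
    exact (hu.cont.congr (heu.mono fun t ht => ht.2)).union_of_isClosed
      (hv.cont.congr (hev.mono fun t ht => ht.1)) isClosed_Icc isClosed_Icc
  · rcases le_total t b with h | h
    · exact (congrArg π (heu h)).trans (hu.proj t ⟨ht.1, h⟩)
    · exact (congrArg π (hev h)).trans (hv.proj t ⟨h, ht.2⟩)
  · simp only [mem_union, mem_singleton_iff, not_or] at htS
    rcases lt_or_gt_of_ne htS.2 with h | h
    · have he : (fun t => if t ≤ b then u t else v t) =ᶠ[𝓝 t] u :=
        eventuallyEq_of_mem (Iio_mem_nhds h) (heu.mono Iio_subset_Iic_self)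
      obtain ⟨hdiff, hzero⟩ := hh t ⟨ht.1, h⟩ htS.1.1
      exact ⟨hdiff.congr_of_eventuallyEq he, (A.along_congr he).trans hzero⟩
    · have he : (fun t => if t ≤ b then u t else v t) =ᶠ[𝓝 t] v :=
        eventuallyEq_of_mem (Ioi_mem_nhds h) (hev.mono Ioi_subset_Ici_self)
      obtain ⟨hdiff, hzero⟩ := hh' t ⟨h, ht.2⟩ htS.1.2
      exact ⟨hdiff.congr_of_eventuallyEq he, (A.along_congr he).trans hzero⟩

theorem IsLiftOn.comp (h : IsLiftOn π A f a b u) {φ : ℝ → ℝ} (hc : ContinuousOn φ (Icc c d))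
    (hm : MapsTo φ (Icc c d) (Icc a b)) (hm' : MapsTo φ (Ioo c d) (Ioo a b))
    (hi : InjOn φ (Ioo c d)) (hd : ∀ t ∈ Ioo c d, DifferentiableAt ℝ φ t) :
    IsLiftOn π A (fun t => f (φ t)) c d (fun t => u (φ t)) := by
  obtain ⟨S, hS, hh⟩ := h.horizontal
  refine ⟨h.cont.comp hc hm, fun t ht => h.proj _ (hm ht), Ioo c d ∩ φ ⁻¹' S, ?_,
    fun t ht htS => ?_⟩
  · refine Finite.of_finite_image (f := φ) (hS.subset ?_) (hi.mono inter_subset_left)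
    rintro _ ⟨t, ht, rfl⟩
    exact ht.2
  · obtain ⟨hdiff, hzero⟩ := hh (φ t) (hm' ht) fun h => htS ⟨ht, h⟩
    obtain ⟨hdiff', halong⟩ := A.along_comp hdiff (hd t ht)
    exact ⟨hdiff', by rw [halong, hzero, mul_zero]⟩

variable {E : Type*} [NormedAddCommGroup E] [NormedSpace ℝ E]
  {H : Type*} [TopologicalSpace H] {I : ModelWithCorners ℝ E H}
  [TopologicalSpace M]

theorem isHorizontalLift_iff {x : M} {α : Path x x} {u₀ : P} :
    IsHorizontalLift π A α u₀ u ↔ IsLiftOn π A α.extend 0 1 u ∧ u 0 = u₀ := by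
  constructor
  · rintro ⟨hcont, hstart, hproj, S, hS⟩
    refine ⟨⟨hcont, fun t ht => ?_, S, S.finite_toSet,
      fun t ht htS => hS t ht (by simpa using htS)⟩, hstart⟩
    rw [α.extend_apply ht]
    exact hproj ⟨t, ht⟩
  · rintro ⟨⟨hcont, hproj, S, hfin, hS⟩, hstart⟩
    refine ⟨hcont, hstart, fun s => ?_, hfin.toFinset, fun t ht htS => hS t ht (by simpa using htS)⟩
    rw [hproj s s.2, Path.extend_apply]

variable [ChartedSpace H M] [T2Space M] (hπ : IsPrincipalCircleBundle I J π)

include hπ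

theorem IsLiftOn.smul (h : IsLiftOn π A f a b u) (g : Circle) :
    IsLiftOn π A f a b (fun t => g • u t) := by
  obtain ⟨S, hS, hh⟩ := h.horizontal
  refine ⟨(hπ.continuous_const_smul g).comp_continuousOn h.cont, fun t ht => ?_, S, hS,
    fun t ht htS => ?_⟩
  · rw [hπ.proj_smul, h.proj t ht]
  · obtain ⟨hdiff, hzero⟩ := hh t ht htS
    obtain ⟨hdiff', halong⟩ := A.along_smul hπ.smooth_smul hdiff g
    exact ⟨hdiff', halong.trans hzero⟩

omit [IsManifold J ∞ P] in
theorem IsPrincipalCircleBundle.exists_eventually_transition_eq_div {s : Set ℝ} {t₀ : ℝ}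
    (ht₀ : t₀ ∈ s) (hu : ContinuousWithinAt u s t₀) {G : ℝ → Circle}
    (hG : ∀ t ∈ s, v t = G t • u t) :
    ∃ z : P → ℂ, ContMDiffAt J 𝓘(ℝ, ℂ) ∞ z (u t₀) ∧ ContMDiffAt J 𝓘(ℝ, ℂ) ∞ z (v t₀) ∧
      z (u t₀) ≠ 0 ∧ ∀ᶠ t in 𝓝[s] t₀, (G t : ℂ) = z (v t) / z (u t) := by
  obtain ⟨U, z, hU, hmem, hz, hnorm, hsmul⟩ := hπ.exists_local_phase (π (u t₀))
  have hU' : IsOpen (π ⁻¹' U) := hU.preimage hπ.smooth_proj.continuous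
  have hz₀ : ∀ p, z p ≠ 0 := fun p => norm_ne_zero_iff.1 (by rw [hnorm]; exact one_ne_zero)
  have hmem' : π (v t₀) ∈ U := by rwa [hG t₀ ht₀, hπ.proj_smul]
  refine ⟨z, hz.contMDiffAt (hU'.mem_nhds hmem), hz.contMDiffAt (hU'.mem_nhds hmem'), hz₀ _, ?_⟩
  filter_upwards [self_mem_nhdsWithin, hu.preimage_mem_nhdsWithin (hU'.mem_nhds hmem)] with t ht htU
  rw [hG t ht, hsmul _ _ htU, mul_div_cancel_right₀ _ (hz₀ _)]

omit [IsManifold J ∞ P] in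
theorem IsPrincipalCircleBundle.continuousWithinAt_transition {s : Set ℝ} {t₀ : ℝ} (ht₀ : t₀ ∈ s)
    (hu : ContinuousWithinAt u s t₀) (hv : ContinuousWithinAt v s t₀) {G : ℝ → Circle}
    (hG : ∀ t ∈ s, v t = G t • u t) : ContinuousWithinAt (fun t => (G t : ℂ)) s t₀ := by
  obtain ⟨z, hzu, hzv, hz₀, hGz⟩ := hπ.exists_eventually_transition_eq_div ht₀ hu hG
  exact ((hzv.continuousAt.comp_continuousWithinAt hv).div
    (hzu.continuousAt.comp_continuousWithinAt hu) hz₀).congr_of_eventuallyEq hGz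
      (hGz.self_of_nhdsWithin ht₀)

omit [IsManifold J ∞ P] in
theorem IsPrincipalCircleBundle.differentiableAt_transition {s : Set ℝ} {t₀ : ℝ} (hs : s ∈ 𝓝 t₀)
    (hu : MDifferentiableAt 𝓘(ℝ, ℝ) J u t₀) (hv : MDifferentiableAt 𝓘(ℝ, ℝ) J v t₀)
    {G : ℝ → Circle} (hG : ∀ t ∈ s, v t = G t • u t) :
    DifferentiableAt ℝ (fun t => (G t : ℂ)) t₀ := by
  obtain ⟨z, hzu, hzv, hz₀, hGz⟩ := hπ.exists_eventually_transition_eq_div (mem_of_mem_nhds hs)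
    hu.continuousAt.continuousWithinAt hG
  rw [nhdsWithin_eq_nhds.2 hs] at hGz
  have hzu' : DifferentiableAt ℝ (fun t => z (u t)) t₀ :=
    mdifferentiableAt_iff_differentiableAt.1
      (MDifferentiableAt.comp t₀ (hzu.mdifferentiableAt (by simp)) hu)
  have hzv' : DifferentiableAt ℝ (fun t => z (v t)) t₀ :=
    mdifferentiableAt_iff_differentiableAt.1
      (MDifferentiableAt.comp t₀ (hzv.mdifferentiableAt (by simp)) hv)
  exact (hzv'.fun_div hzu' hz₀).congr_of_eventuallyEq hGz

omit hπ in
theorem exists_angle_hasDerivAt {G : ℝ → Circle} {t₀ : ℝ}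
    (hG : DifferentiableAt ℝ (fun t => (G t : ℂ)) t₀) :
    ∃ (θ : ℝ → ℝ) (θ' : ℝ), (∀ t, G t = Circle.exp (θ t) * G t₀) ∧ HasDerivAt θ θ' t₀ := by
  have hquot : DifferentiableAt ℝ (fun t => ((G t / G t₀ : Circle) : ℂ)) t₀ := by
    simpa only [Circle.coe_div] using hG.div_const (G t₀ : ℂ)
  have hlog := hquot.hasDerivAt.clog_real (by simp)
  refine ⟨fun t => Complex.arg ((G t / G t₀ : Circle) : ℂ), _, fun t => ?_,
    (Complex.imCLM.hasFDerivAt.comp_hasDerivAt t₀ hlog).congr_of_eventuallyEq ?_⟩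
  · rw [Circle.exp_arg, div_mul_cancel]
  · exact Eventually.of_forall fun t => by simp [Complex.log_im]

theorem IsPrincipalCircleBundle.hasDerivAt_transition_of_horizontal {s : Set ℝ} {t₀ : ℝ}
    (hs : s ∈ 𝓝 t₀) (hu : MDifferentiableAt 𝓘(ℝ, ℝ) J u t₀) (hu₀ : A.along u t₀ = 0)
    (hv : MDifferentiableAt 𝓘(ℝ, ℝ) J v t₀) (hv₀ : A.along v t₀ = 0) {G : ℝ → Circle}
    (hG : ∀ t ∈ s, v t = G t • u t) : HasDerivAt (fun t => (G t : ℂ)) 0 t₀ := by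
  obtain ⟨θ, θ', hGθ, hθ'⟩ := exists_angle_hasDerivAt
    (hπ.differentiableAt_transition hs hu hv hG)
  have hvθ : v =ᶠ[𝓝 t₀] fun t => Circle.exp (θ t) • (G t₀ • u t) := by
    filter_upwards [hs] with t ht
    rw [hG t ht, hGθ t, smul_smul]
  obtain ⟨hdiff, halong⟩ := A.along_smul hπ.smooth_smul hu (G t₀)
  have hθ₀ : θ' = 0 := by
    rwa [A.along_congr hvθ, (A.along_exp_smul hπ.smooth_smul hdiff hθ').2, halong, hu₀,
      zero_add] at hv₀
  subst hθ₀
  have hexp := (hθ'.ofReal_comp.mul_const Complex.I).cexp.mul_const (G t₀ : ℂ)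
  simp only [Complex.ofReal_zero, zero_mul, mul_zero] at hexp
  refine hexp.congr_of_eventuallyEq (Eventually.of_forall fun t => ?_)
  dsimp only
  rw [hGθ t, Circle.coe_mul, Circle.coe_exp]

theorem IsLiftOn.exists_eq_smul (hu : IsLiftOn π A f a b u) (hv : IsLiftOn π A f a b v) :
    ∃ g : Circle, ∀ t ∈ Icc a b, v t = g • u t := by
  have hex : ∀ t ∈ Icc a b, ∃ g : Circle, v t = g • u t := fun t ht =>
    hπ.exists_smul_eq ((hu.proj t ht).trans (hv.proj t ht).symm)
  choose! G hG using hex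
  obtain ⟨S, hS, hh⟩ := hu.horizontal
  obtain ⟨T, hT, hh'⟩ := hv.horizontal
  have hcont : ContinuousOn (fun t => (G t : ℂ)) (Icc a b) := fun t ht =>
    hπ.continuousWithinAt_transition ht (hu.cont t ht) (hv.cont t ht) hG
  have hderiv : ∀ t ∈ Ioo a b, t ∉ S ∪ T → HasDerivAt (fun t => (G t : ℂ)) 0 t :=
    fun t ht htS => by
      rw [mem_union, not_or] at htS
      obtain ⟨hudiff, hu₀⟩ := hh t ht htS.1
      obtain ⟨hvdiff, hv₀⟩ := hh' t ht htS.2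
      exact hπ.hasDerivAt_transition_of_horizontal (Icc_mem_nhds ht.1 ht.2) hudiff hu₀ hvdiff hv₀ hG
  refine ⟨G a, fun t ht => ?_⟩
  have hconst := eq_of_hasDerivAt_zero_off_finite hcont (hS.union hT) hderiv ht
  rw [hG t ht, Circle.ext hconst]

omit [IsManifold J ∞ P] [T2Space M] in
theorem IsPrincipalCircleBundle.exists_smooth_lift {k : ℝ → M} {t₀ : ℝ} {s : Set ℝ}
    (hs : s ∈ 𝓝 t₀) (hk : ContMDiffOn 𝓘(ℝ, ℝ) I ∞ k s) :
    ∃ δ > 0, ∃ w : ℝ → P, ContMDiffOn 𝓘(ℝ, ℝ) J ∞ w (Ioo (t₀ - δ) (t₀ + δ)) ∧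
      ∀ t ∈ Ioo (t₀ - δ) (t₀ + δ), π (w t) = k t := by
  obtain ⟨U, e, hU, hx, -, htgt, -, he, hfst, -⟩ := hπ.locally_trivial (k t₀)
  obtain ⟨δ, hδ, hball⟩ := Metric.mem_nhds_iff.1
    (inter_mem hs ((hk.contMDiffAt hs).continuousAt.preimage_mem_nhds (hU.mem_nhds hx)))
  rw [Real.ball_eq_Ioo] at hball
  have hmaps : MapsTo (fun t => (k t, (1 : Circle))) (Ioo (t₀ - δ) (t₀ + δ)) e.target :=
    fun t ht => by
      rw [htgt]
      exact ⟨(hball ht).2, mem_univ _⟩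
  refine ⟨δ, hδ, fun t => e.symm (k t, 1),
    he.comp ((hk.mono fun t ht => (hball ht).1).prodMk contMDiffOn_const) hmaps, fun t ht => ?_⟩
  rw [← hfst _ (e.map_target (hmaps ht)), e.right_inv (hmaps ht)]

theorem IsPrincipalCircleBundle.exists_local_lift (A : Connection J P) {k : ℝ → M} {t₀ : ℝ}
    {s : Set ℝ} (hs : s ∈ 𝓝 t₀) (hk : ContMDiffOn 𝓘(ℝ, ℝ) I ∞ k s) :
    ∃ N ∈ 𝓝 t₀, ∃ u : ℝ → P, ∀ a b, Icc a b ⊆ N → IsLiftOn π A k a b u := by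
  obtain ⟨δ, hδ, w, hw, hproj⟩ := hπ.exists_smooth_lift hs hk
  have ht₀ : t₀ ∈ Ioo (t₀ - δ) (t₀ + δ) := ⟨by linarith, by linarith⟩
  have halong := A.continuousOn_along isOpen_Ioo hw
  -- Rotating `w` by the angle `θ` adds `θ'` to the value of the connection along `w`.
  let θ : ℝ → ℝ := fun t => -∫ r in t₀..t, A.along w r
  have hθ : ∀ t ∈ Ioo (t₀ - δ) (t₀ + δ), HasDerivAt θ (-A.along w t) t := fun t ht =>
    (intervalIntegral.integral_hasDerivAt_right
      (halong.mono (ordConnected_Ioo.uIcc_subset ht₀ ht)).intervalIntegrable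
      (halong.stronglyMeasurableAtFilter isOpen_Ioo t ht)
      (halong.continuousAt (isOpen_Ioo.mem_nhds ht))).neg
  have hmain : ∀ t ∈ Ioo (t₀ - δ) (t₀ + δ),
      MDifferentiableAt 𝓘(ℝ, ℝ) J (fun r => Circle.exp (θ r) • w r) t ∧
        A.along (fun r => Circle.exp (θ r) • w r) t = 0 := fun t ht => by
    have hwdiff := (hw.contMDiffAt (isOpen_Ioo.mem_nhds ht)).mdifferentiableAt (by simp)
    obtain ⟨hdiff, hrot⟩ := A.along_exp_smul hπ.smooth_smul hwdiff (hθ t ht)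
    exact ⟨hdiff, by rw [hrot, add_neg_cancel]⟩
  refine ⟨_, isOpen_Ioo.mem_nhds ht₀, fun r => Circle.exp (θ r) • w r, fun a b hsub => ?_⟩
  refine ⟨fun t ht => (hmain t (hsub ht)).1.continuousAt.continuousWithinAt, fun t ht => ?_,
    ∅, finite_empty, fun t ht _ => hmain t (hsub (Ioo_subset_Icc_self ht))⟩
  rw [hπ.proj_smul, hproj t (hsub ht)]

omit hπ [TopologicalSpace M] [ChartedSpace H M] [T2Space M] in
/-- Every point over `f a` is the initial point of a horizontal lift of `f` over `[a, b]`. In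
contrast to the mere existence of a lift, this property can be glued along adjacent intervals. -/
def HasLiftsOn (π : P → M) (A : Connection J P) (f : ℝ → M) (a b : ℝ) : Prop :=
  ∀ p, π p = f a → ∃ u, IsLiftOn π A f a b u ∧ u a = p

theorem IsLiftOn.hasLiftsOn (hab : a ≤ b) (hu : IsLiftOn π A f a b u) : HasLiftsOn π A f a b := by
  intro p hp
  obtain ⟨g, hg⟩ := hπ.exists_smul_eq (p := u a) (q := p)
    ((hu.proj a (left_mem_Icc.2 hab)).trans hp.symm)
  exact ⟨_, hu.smul hπ g, hg.symm⟩

omit hπ [TopologicalSpace M] [ChartedSpace H M] [T2Space M] in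
theorem HasLiftsOn.trans (hab : a ≤ b) (hbc : b ≤ c) (h : HasLiftsOn π A f a b)
    (h' : HasLiftsOn π A f b c) : HasLiftsOn π A f a c := by
  intro p hp
  obtain ⟨u, hu, rfl⟩ := h p hp
  obtain ⟨v, hv, hvb⟩ := h' (u b) (hu.proj b (right_mem_Icc.2 hab))
  exact ⟨_, hu.glue hab hbc hv hvb.symm, if_pos hab⟩

theorem IsPrincipalCircleBundle.exists_hasLiftsOn_of_eventuallyEq [IsManifold I ω M]
    (A : Connection J P) {f k : ℝ → M} {t₀ : ℝ} {s : Set ℝ} (hk : ContMDiffAt 𝓘(ℝ, ℝ) I ω k t₀)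
    (hfk : f =ᶠ[𝓝[s] t₀] k) :
    ∃ N ∈ 𝓝 t₀, ∀ a b, a ≤ b → Icc a b ⊆ N → Icc a b ⊆ s → HasLiftsOn π A f a b := by
  obtain ⟨S, hS, hkS⟩ := (contMDiffAt_iff_contMDiffOn_nhds (by simp)).1 hk
  obtain ⟨N, hN, u, hu⟩ := hπ.exists_local_lift A hS (hkS.of_le le_top)
  obtain ⟨N', hN', heq⟩ := mem_nhdsWithin_iff_exists_mem_nhds_inter.1 hfk
  refine ⟨N ∩ N', inter_mem hN hN', fun a b hab hsub hs => IsLiftOn.hasLiftsOn hπ hab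
    ((hu a b fun t ht => (hsub ht).1).congr fun t ht => heq ⟨(hsub ht).2, hs ht⟩)⟩

theorem IsPrincipalCircleBundle.hasLiftsOn [IsManifold I ω M] (A : Connection J P) {f : ℝ → M}
    (hf : HasAnalyticGerms I f) : HasLiftsOn π A f 0 1 := by
  refine interval_induction (fun a b c => HasLiftsOn.trans) fun t₀ _ => ?_
  obtain ⟨⟨k, hk, hfk⟩, k', hk', hfk'⟩ := hf t₀
  obtain ⟨N, hN, hright⟩ := hπ.exists_hasLiftsOn_of_eventuallyEq A hk hfk
  obtain ⟨N', hN', hleft⟩ := hπ.exists_hasLiftsOn_of_eventuallyEq A hk' hfk'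
  have hright' : ∀ a b, a ≤ b → t₀ ≤ a → Icc a b ⊆ N → HasLiftsOn π A f a b :=
    fun a b hab h hsub => hright a b hab hsub fun t ht => h.trans ht.1
  have hleft' : ∀ a b, a ≤ b → b ≤ t₀ → Icc a b ⊆ N' → HasLiftsOn π A f a b :=
    fun a b hab h hsub => hleft a b hab hsub fun t ht => ht.2.trans h
  refine ⟨N ∩ N', inter_mem hN hN', fun a b hab hsub => ?_⟩
  rw [subset_inter_iff] at hsub
  rcases le_total t₀ a with h | h
  · exact hright' a b hab h hsub.1
  rcases le_total b t₀ with h' | h'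
  · exact hleft' a b hab h' hsub.2
  · exact (hleft' a t₀ h le_rfl ((Icc_subset_Icc_right h').trans hsub.2)).trans h h'
      (hright' t₀ b h' le_rfl ((Icc_subset_Icc_left h).trans hsub.1))

end Lifts

section Holonomy

variable {E : Type*} [NormedAddCommGroup E] [NormedSpace ℝ E]
  {H : Type*} [TopologicalSpace H] {I : ModelWithCorners ℝ E H}
  {M : Type*} [TopologicalSpace M] [ChartedSpace H M]
  {F : Type*} [NormedAddCommGroup F] [NormedSpace ℝ F]
  {K : Type*} [TopologicalSpace K] {J : ModelWithCorners ℝ F K}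
  {P : Type*} [TopologicalSpace P] [ChartedSpace K P] [MulAction Circle P] [IsManifold J ∞ P]
  {π : P → M} {x : M} {u₀ : P}
  [T2Space M] (hπ : IsPrincipalCircleBundle I J π)

include hπ

theorem IsLiftOn.eq_smul {A : Connection J P} {f : ℝ → M} {u v : ℝ → P} {a b : ℝ}
    (hu : IsLiftOn π A f a b u) (hv : IsLiftOn π A f a b v) {g : Circle} (hab : a ≤ b)
    (h : v a = g • u a) : ∀ t ∈ Icc a b, v t = g • u t := by
  obtain ⟨c, hc⟩ := hu.exists_eq_smul hπ hv
  rwa [hπ.smul_left_injective (u a) ((hc a (left_mem_Icc.2 hab)).symm.trans h)] at hc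

theorem IsPrincipalCircleBundle.existsUnique_isHolonomy [IsManifold I ω M] (hu₀ : π u₀ = x)
    (A : Connection J P) (α : PALoop I x) : ∃! g : Circle, IsHolonomy π A u₀ α.1 g := by
  obtain ⟨u, hu, hu0⟩ := hπ.hasLiftsOn A α.2.hasAnalyticGerms u₀ (by simp [hu₀])
  obtain ⟨g, hg⟩ := hπ.exists_smul_eq (p := u 1) (q := u₀)
    (by rw [hu.proj 1 (by simp), hu₀]; simp)
  refine ⟨g, ⟨u, isHorizontalLift_iff.2 ⟨hu, hu0⟩, hg⟩, ?_⟩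
  rintro g' ⟨v, hv, hg'⟩
  obtain ⟨hv, hv0⟩ := isHorizontalLift_iff.1 hv
  have hend := hu.eq_smul hπ hv (g := 1) zero_le_one (by rw [hu0, hv0, one_smul]) 1 (by simp)
  rw [hend, one_smul] at hg'
  exact hπ.smul_left_injective (u 1) (hg'.symm.trans hg)

theorem IsPrincipalCircleBundle.isHolonomy_holonomy [IsManifold I ω M] (hu₀ : π u₀ = x)
    (A : Connection J P) (α : PALoop I x) : IsHolonomy π A u₀ α.1 (holonomy π A u₀ α.1) :=
  Classical.epsilon_spec (hπ.existsUnique_isHolonomy hu₀ A α).exists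

theorem IsPrincipalCircleBundle.holonomy_eq [IsManifold I ω M] (hu₀ : π u₀ = x)
    (A : Connection J P) (α : PALoop I x) {u : ℝ → P} (hu : IsLiftOn π A α.1.extend 0 1 u)
    (h0 : u 0 = u₀) {g : Circle} (hg : u₀ = g • u 1) : holonomy π A u₀ α.1 = g :=
  (hπ.existsUnique_isHolonomy hu₀ A α).unique (hπ.isHolonomy_holonomy hu₀ A α)
    ⟨u, isHorizontalLift_iff.2 ⟨hu, h0⟩, hg⟩

theorem IsPrincipalCircleBundle.exists_lift_holonomy [IsManifold I ω M] (hu₀ : π u₀ = x)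
    (A : Connection J P) (α : PALoop I x) : ∃ u : ℝ → P, IsLiftOn π A α.1.extend 0 1 u ∧
      u 0 = u₀ ∧ u₀ = holonomy π A u₀ α.1 • u 1 := by
  obtain ⟨u, hu, hg⟩ := hπ.isHolonomy_holonomy hu₀ A α
  exact ⟨u, (isHorizontalLift_iff.1 hu).1, (isHorizontalLift_iff.1 hu).2, hg⟩

theorem IsPrincipalCircleBundle.holonomy_trans [IsManifold I ω M] (hu₀ : π u₀ = x)
    (A : Connection J P) (α β : PALoop I x) :
    holonomy π A u₀ (α.1.trans β.1) = holonomy π A u₀ α.1 * holonomy π A u₀ β.1 := by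
  obtain ⟨u, hu, hu0, hu1⟩ := hπ.exists_lift_holonomy hu₀ A α
  obtain ⟨v, hv, hv0, hv1⟩ := hπ.exists_lift_holonomy hu₀ A β
  set g := holonomy π A u₀ α.1
  set g' := holonomy π A u₀ β.1
  have hfirst : IsLiftOn π A (α.1.trans β.1).extend 0 (1 / 2) (fun t => u (2 * t)) := by
    refine (hu.comp (φ := fun t => 2 * t) (c := 0) (d := 1 / 2) (by fun_prop)
      (fun t ht => ⟨by linarith [ht.1], by linarith [ht.2]⟩)
      (fun t ht => ⟨by linarith [ht.1], by linarith [ht.2]⟩)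
      (fun a _ b _ hab => by simpa using hab) fun t _ => by fun_prop).congr fun t ht => ?_
    have h01 : t ∈ Icc (0 : ℝ) 1 := ⟨ht.1, by linarith [ht.2]⟩
    rw [Path.extend_apply _ h01, Path.trans_apply, dif_pos ht.2, Path.extend_apply]
  have hsecond : IsLiftOn π A (α.1.trans β.1).extend (1 / 2) 1 (fun t => g⁻¹ • v (2 * t - 1)) := by
    refine ((hv.smul hπ g⁻¹).comp (φ := fun t => 2 * t - 1) (c := 1 / 2) (d := 1) (by fun_prop)
      (fun t ht => ⟨by linarith [ht.1], by linarith [ht.2]⟩)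
      (fun t ht => ⟨by linarith [ht.1], by linarith [ht.2]⟩)
      (fun a _ b _ hab => by simpa using hab) fun t _ => by fun_prop).congr fun t ht => ?_
    have h01 : t ∈ Icc (0 : ℝ) 1 := ⟨by linarith [ht.1], ht.2⟩
    rw [Path.extend_apply _ h01, Path.trans_apply]
    split_ifs with h
    · obtain rfl : t = 1 / 2 := le_antisymm h ht.1
      simp
    · rw [Path.extend_apply]
  have hglue := hfirst.glue (by norm_num) (by norm_num) hsecond (by
    norm_num
    rw [hv0, eq_inv_smul_iff, ← hu1])
  refine hπ.holonomy_eq hu₀ A ⟨α.1.trans β.1, α.2.trans β.2⟩ hglue (by simpa using hu0) ?_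
  norm_num
  rw [smul_smul, mul_right_comm, mul_inv_cancel, one_mul, ← hv1]

theorem IsLiftOn.apply_eq_of_const {A : Connection J P} {f : ℝ → M} {u : ℝ → P} {a b : ℝ}
    (hu : IsLiftOn π A f a b u) (hab : a ≤ b) (hf : ∀ τ ∈ Icc a b, f τ = f a) : u b = u a := by
  have hconst : IsLiftOn π A f a b fun _ => u a := by
    refine ⟨continuousOn_const, fun τ hτ => ?_, ∅, finite_empty, fun τ _ _ =>
      ⟨mdifferentiableAt_const, ?_⟩⟩
    · rw [hu.proj _ (left_mem_Icc.2 hab), hf τ hτ]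
    · rw [Connection.along, mfderiv_const]
      exact map_zero (A.form (u a))
  have hend := hconst.eq_smul hπ hu (g := 1) hab (one_smul _ _).symm _ (right_mem_Icc.2 hab)
  rwa [one_smul] at hend

theorem IsLiftOn.exists_comp_eq_smul {A : Connection J P} {f : ℝ → M} {u : ℝ → P} {a b c d : ℝ}
    {φ : ℝ → ℝ} (hu : IsLiftOn π A f a b u) (hu' : IsLiftOn π A f c d u)
    (hφ : IsReparam f a b c d φ) (hf : InjOn f (Icc c d)) :
    ∃ g : Circle, ∀ τ ∈ Icc c d, u (φ τ) = g • u τ := by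
  have hinj : InjOn φ (Ioo c d) := fun σ hσ τ hτ hστ => by
    have hσ' := Ioo_subset_Icc_self hσ
    have hτ' := Ioo_subset_Icc_self hτ
    exact hf hσ' hτ' (by rw [← hφ.comp σ hσ', ← hφ.comp τ hτ', hστ])
  exact hu'.exists_eq_smul hπ ((hu.comp hφ.cont hφ.mapsTo hφ.mapsTo_Ioo hinj hφ.diff).congr
    fun τ hτ => (hφ.comp τ hτ).symm)

theorem IsPrincipalCircleBundle.holonomy_eq_one [IsManifold I ω M] (hu₀ : π u₀ = x)
    (A : Connection J P) (α : PALoop I x) {n : ℕ} {t : ℕ → ℝ}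
    (hP : IsEdgePartition I α.1.extend n t)
    (hcount : ∀ i < n, IsEdge I α.1.extend (t i) (t (i + 1)) → edgeCount α.1.extend n t i = 0) :
    holonomy π A u₀ α.1 = 1 := by
  obtain ⟨u, hu, hu0, -⟩ := hπ.exists_lift_holonomy hu₀ A α
  -- The phase `g` of the lift relative to a (discontinuous) section has increments which are
  -- invariant under reparametrization.
  have hσ := Function.rightInverse_surjInv hπ.surjective
  set σ := Function.surjInv hπ.surjective
  have hex : ∀ τ ∈ Icc (0 : ℝ) 1, ∃ g : Circle, u τ = g • σ (α.1.extend τ) := fun τ hτ =>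
    hπ.exists_smul_eq ((hσ _).trans (hu.proj τ hτ).symm)
  choose! g hg using hex
  have hedge : ∀ {i}, i < n → IsLiftOn π A α.1.extend (t i) (t (i + 1)) u := fun hi =>
    hu.mono (hP.mem_Icc hi.le).1 (hP.mem_Icc (Nat.succ_le_of_lt hi)).2
  have hends : g 1 = g 0 := by
    refine hP.eq_of_edgeCount_eq_zero g hcount (fun i hi hc => ?_) fun i hi j hj hei φ hφ => ?_
    · have hle := (hP.lt i hi).le
      have hlift := (hedge hi).apply_eq_of_const hπ hle hc
      rw [hg _ (hP.mem_Icc hi.le), hg _ (hP.mem_Icc (Nat.succ_le_of_lt hi)),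
        hc _ (right_mem_Icc.2 hle)] at hlift
      exact hπ.smul_left_injective _ hlift
    · have hle := (hP.lt j hj).le
      obtain ⟨c, hc⟩ := (hedge hi).exists_comp_eq_smul hπ (hedge hj) hφ
        (hP.isEdge_of_isReparam hi hj hei hφ).inj
      have hgφ : ∀ τ ∈ Icc (t j) (t (j + 1)), g (φ τ) = c * g τ := fun τ hτ => by
        have hlift := hc τ hτ
        rw [hg _ (hP.Icc_subset hi (hφ.mapsTo hτ)), hg τ (hP.Icc_subset hj hτ), hφ.comp τ hτ,
          smul_smul] at hlift
        exact hπ.smul_left_injective _ hlift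
      rw [hgφ _ (left_mem_Icc.2 hle), hgφ _ (right_mem_Icc.2 hle), mul_div_mul_left_eq_div]
  have hloop : α.1.extend 1 = α.1.extend 0 := by simp
  refine hπ.holonomy_eq hu₀ A α hu hu0 ?_
  rw [one_smul, ← hu0, hg 0 (by simp), hg 1 (by simp), hends, hloop]

variable [FiniteDimensional ℝ E]

theorem IsPrincipalCircleBundle.holonomy_eq_of_thinEquiv [IsManifold I ω M] (hu₀ : π u₀ = x)
    (A : Connection J P) {α β : PALoop I x} (h : ThinEquiv α.1 β.1) :
    holonomy π A u₀ α.1 = holonomy π A u₀ β.1 := by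
  have hthin : ∀ γ : PALoop I x, IsThin γ.1 → holonomy π A u₀ γ.1 = 1 := fun γ hγ => by
    obtain ⟨n, t, hP⟩ := exists_isEdgePartition γ.2.hasAnalyticGerms γ.1.extend.continuous
    exact hπ.holonomy_eq_one hu₀ A γ hP fun i hi he => hγ.edgeCount_eq_zero hP hi he
  have hinv : ∀ γ : PALoop I x, ThinEquiv γ.1 β.1 →
      holonomy π A u₀ γ.1 * holonomy π A u₀ β.1.symm = 1 := fun γ hγ =>
    (hπ.holonomy_trans hu₀ A γ ⟨β.1.symm, β.2.symm⟩).symm.trans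
      (hthin ⟨γ.1.trans β.1.symm, γ.2.trans β.2.symm⟩ hγ)
  exact mul_right_cancel ((hinv α h).trans (hinv β (ThinEquiv.refl _)).symm)

end Holonomy

section Differential

variable {F : Type*} [NormedAddCommGroup F] [NormedSpace ℝ F]
  {K : Type*} [TopologicalSpace K] {J : ModelWithCorners ℝ F K}
  {P : Type*} [TopologicalSpace P] [ChartedSpace K P]
  {V : Type*} [NormedAddCommGroup V] [NormedSpace ℝ V]

variable (J) in
/-- The differential of a vector valued function as a vector valued 1-form. -/
def differential (z : P → V) (p : P) : TangentSpace J p →L[ℝ] V := mfderiv J 𝓘(ℝ, V) z p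

theorem differential_congr {z z' : P → V} {p : P} (h : z =ᶠ[𝓝 p] z') :
    differential J z p = differential J z' p := h.mfderiv_eq

theorem differential_mfderiv {F' : Type*} [NormedAddCommGroup F'] [NormedSpace ℝ F']
    {K' : Type*} [TopologicalSpace K'] {J' : ModelWithCorners ℝ F' K'}
    {Q : Type*} [TopologicalSpace Q] [ChartedSpace K' Q] {z : P → V} {u : Q → P} {q : Q}
    (hz : MDifferentiableAt J 𝓘(ℝ, V) z (u q)) (hu : MDifferentiableAt J' J u q)
    (v : TangentSpace J' q) :
    differential J z (u q) (mfderiv J' J u q v) = differential J' (fun r => z (u r)) q v := by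
  have hcomp : mfderiv J' 𝓘(ℝ, V) (fun r => z (u r)) q = _ := mfderiv_comp q hz hu
  rw [differential, differential, hcomp]
  rfl

theorem differential_real (z : ℝ → V) (t : ℝ) : differential 𝓘(ℝ, ℝ) z t (1 : ℝ) = deriv z t := by
  have hfderiv : differential 𝓘(ℝ, ℝ) z t = fderiv ℝ z t := mfderiv_eq_fderiv
  rw [hfderiv]
  exact fderiv_apply_one_eq_deriv (f := z)

theorem differential_velocity {z : P → V} {u : ℝ → P} {t : ℝ}
    (hz : MDifferentiableAt J 𝓘(ℝ, V) z (u t)) (hu : MDifferentiableAt 𝓘(ℝ, ℝ) J u t) :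
    differential J z (u t) (mfderiv 𝓘(ℝ, ℝ) J u t (1 : ℝ)) = deriv (fun s => z (u s)) t :=
  (differential_mfderiv hz hu (1 : ℝ)).trans (differential_real _ t)

theorem differential_clm_comp {W : Type*} [NormedAddCommGroup W] [NormedSpace ℝ W] (L : V →L[ℝ] W)
    {z : P → V} {p : P} (hz : MDifferentiableAt J 𝓘(ℝ, V) z p) (v : TangentSpace J p) :
    L (differential J z p v) = differential J (fun q => L (z q)) p v := by
  rw [← differential_mfderiv L.differentiableAt.mdifferentiableAt hz]
  have hL : differential 𝓘(ℝ, V) L (z p) = L := mfderiv_eq_fderiv.trans L.fderiv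
  exact (congrArg (fun T : V →L[ℝ] W => T (mfderiv J 𝓘(ℝ, V) z p v)) hL).symm

theorem contMDiffOn_differential [IsManifold J ∞ P] {z : P → V} {s : Set P} (hs : IsOpen s)
    (hz : ContMDiffOn J 𝓘(ℝ, V) ∞ z s) :
    ContMDiffOn J.tangent 𝓘(ℝ, V) ∞ (fun v : TangentBundle J P => differential J z v.proj v.snd)
      (Bundle.TotalSpace.proj ⁻¹' s) := by
  have htangent := hz.contMDiffOn_tangentMapWithin (m := ∞) (by simp) hs.uniqueMDiffOn
  refine ((contMDiff_snd_tangentBundle_modelSpace V 𝓘(ℝ, V)).comp_contMDiffOn htangent).congr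
    fun v hv => ?_
  exact congrArg (fun L : TangentSpace J v.proj →L[ℝ] V => L v.snd)
    (mfderivWithin_of_isOpen hs hv).symm

theorem contMDiff_differential [IsManifold J ∞ P] {z : P → V} (hz : ContMDiff J 𝓘(ℝ, V) ∞ z) :
    ContMDiff J.tangent 𝓘(ℝ, V) ∞
      (fun v : TangentBundle J P => differential J z v.proj v.snd) := by
  simpa only [preimage_univ, contMDiffOn_univ] using
    contMDiffOn_differential isOpen_univ hz.contMDiffOn

variable (J) in
/-- The 1-form `z⁻¹ dz / i` for a function `z` of absolute value one, where `z⁻¹` is the conjugate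
of `z`. For an equivariant `z` it is the flat connection form of a local trivialization. -/
def phaseForm (z : P → ℂ) (p : P) : TangentSpace J p →L[ℝ] ℝ :=
  Complex.imCLM ∘L (starRingEnd ℂ (z p) • differential J z p)

theorem phaseForm_apply (z : P → ℂ) (p : P) (v : TangentSpace J p) :
    phaseForm J z p v = (starRingEnd ℂ (z p) * differential J z p v).im := rfl

theorem contMDiffOn_phaseForm [IsManifold J ∞ P] {z : P → ℂ} {s : Set P} (hs : IsOpen s)
    (hz : ContMDiffOn J 𝓘(ℝ, ℂ) ∞ z s) :
    ContMDiffOn J.tangent 𝓘(ℝ, ℝ) ∞ (fun v : TangentBundle J P => phaseForm J z v.proj v.snd)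
      (Bundle.TotalSpace.proj ⁻¹' s) := by
  have hz' : ContMDiffOn J.tangent 𝓘(ℝ, ℂ) ∞ (fun v : TangentBundle J P => z v.proj)
      (Bundle.TotalSpace.proj ⁻¹' s) :=
    hz.comp (Bundle.contMDiff_proj _).contMDiffOn fun v hv => hv
  have hmul : ContDiff ℝ ∞ fun w : ℂ × ℂ => (starRingEnd ℂ w.1 * w.2).im :=
    Complex.imCLM.contDiff.comp ((Complex.conjCLE.contDiff.comp contDiff_fst).mul contDiff_snd)
  exact hmul.contMDiff.comp_contMDiffOn (hz'.prodMk_space (contMDiffOn_differential hs hz))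

theorem contMDiff_mul_phaseForm [IsManifold J ∞ P] {χ : P → ℝ} {z : P → ℂ} {s : Set P}
    (hs : IsOpen s) (hχ : ContMDiff J 𝓘(ℝ, ℝ) ∞ χ) (hχs : tsupport χ ⊆ s)
    (hz : ContMDiffOn J 𝓘(ℝ, ℂ) ∞ z s) :
    ContMDiff J.tangent 𝓘(ℝ, ℝ) ∞
      (fun v : TangentBundle J P => χ v.proj * phaseForm J z v.proj v.snd) := by
  have hproj : ContMDiff J.tangent J ∞ fun v : TangentBundle J P => v.proj :=
    Bundle.contMDiff_proj _
  refine contMDiff_of_tsupport fun v hv => ?_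
  have hvs : v.proj ∈ s := hχs <| tsupport_comp_subset_preimage χ hproj.continuous
    (tsupport_mul_subset_left hv)
  exact (hχ.comp hproj).contMDiffAt.mul <| (contMDiffOn_phaseForm hs hz).contMDiffAt
    ((hs.preimage hproj.continuous).mem_nhds hvs)

end Differential

section Connections

variable {E : Type*} [NormedAddCommGroup E] [NormedSpace ℝ E]
  {H : Type*} [TopologicalSpace H] {I : ModelWithCorners ℝ E H}
  {M : Type*} [TopologicalSpace M] [ChartedSpace H M]
  {F : Type*} [NormedAddCommGroup F] [NormedSpace ℝ F]
  {K : Type*} [TopologicalSpace K] {J : ModelWithCorners ℝ F K}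
  {P : Type*} [TopologicalSpace P] [ChartedSpace K P] [MulAction Circle P]
  {π : P → M} (hπ : IsPrincipalCircleBundle I J π)

include hπ

theorem IsPrincipalCircleBundle.mdifferentiableAt_smul (g : Circle) (p : P) :
    MDifferentiableAt J J (fun q : P => g • q) p :=
  (hπ.smooth_smul.comp (contMDiff_const.prodMk contMDiff_id)).mdifferentiableAt (by simp)

theorem IsPrincipalCircleBundle.mdifferentiableAt_exp_smul (p : P) (a : ℝ) :
    MDifferentiableAt 𝓘(ℝ, ℝ) J (fun θ : ℝ => Circle.exp θ • p) a :=
  ((contMDiff_exp_smul hπ.smooth_smul).comp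
    (contMDiff_id.prodMk contMDiff_const)).mdifferentiableAt (by simp)

variable [T2Space M]

theorem IsPrincipalCircleBundle.phaseForm_smul {U : Set M} (hU : IsOpen U) {z : P → ℂ}
    (hz : ContMDiffOn J 𝓘(ℝ, ℂ) ∞ z (π ⁻¹' U))
    (hzg : ∀ (g : Circle), ∀ p ∈ π ⁻¹' U, z (g • p) = g * z p) (g : Circle) {p : P}
    (hp : p ∈ π ⁻¹' U) (v : TangentSpace J p) :
    phaseForm J z (g • p) (mfderiv J J (fun q : P => g • q) p v) = phaseForm J z p v := by
  have hO : IsOpen (π ⁻¹' U) := hU.preimage hπ.smooth_proj.continuous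
  have hd : ∀ q ∈ π ⁻¹' U, MDifferentiableAt J 𝓘(ℝ, ℂ) z q := fun q hq =>
    (hz.contMDiffAt (hO.mem_nhds hq)).mdifferentiableAt (by simp)
  have hgp : g • p ∈ π ⁻¹' U := by rwa [mem_preimage, hπ.proj_smul]
  have hchain := differential_mfderiv (u := fun q : P => g • q) (hd _ hgp)
    (hπ.mdifferentiableAt_smul g p) v
  have hequivariant : differential J (fun q => z (g • q)) p v = g * differential J z p v := by
    rw [differential_congr (z' := fun q => ((g : ℂ) • ContinuousLinearMap.id ℝ ℂ) (z q))
      (eventuallyEq_of_mem (hO.mem_nhds hp) fun q hq => hzg g q hq),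
      ← differential_clm_comp ((g : ℂ) • ContinuousLinearMap.id ℝ ℂ) (hd p hp)]
    rfl
  rw [phaseForm_apply, hchain, hequivariant, hzg g p hp, phaseForm_apply, map_mul,
    mul_mul_mul_comm, ← Circle.coe_inv_eq_conj, ← Circle.coe_mul, inv_mul_cancel, Circle.coe_one,
    one_mul]

theorem IsPrincipalCircleBundle.phaseForm_vertical {U : Set M} (hU : IsOpen U) {z : P → ℂ}
    (hz : ContMDiffOn J 𝓘(ℝ, ℂ) ∞ z (π ⁻¹' U)) (hz1 : ∀ p, ‖z p‖ = 1)
    (hzg : ∀ (g : Circle), ∀ p ∈ π ⁻¹' U, z (g • p) = g * z p) {p : P} (hp : p ∈ π ⁻¹' U) :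
    phaseForm J z (Circle.exp 0 • p)
      (mfderiv 𝓘(ℝ, ℝ) J (fun θ : ℝ => Circle.exp θ • p) 0 (1 : ℝ)) = 1 := by
  have hO : IsOpen (π ⁻¹' U) := hU.preimage hπ.smooth_proj.continuous
  have hgp : Circle.exp 0 • p ∈ π ⁻¹' U := by rwa [mem_preimage, hπ.proj_smul]
  have hchain := differential_velocity (u := fun θ : ℝ => Circle.exp θ • p)
    ((hz.contMDiffAt (hO.mem_nhds hgp)).mdifferentiableAt (by simp))
    (hπ.mdifferentiableAt_exp_smul p 0)
  have hrotate : HasDerivAt (fun θ : ℝ => z (Circle.exp θ • p)) (Complex.I * z p) 0 := by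
    simp only [hzg _ p hp, Circle.coe_exp]
    simpa using ((hasDerivAt_id (0 : ℝ)).ofReal_comp.mul_const Complex.I).cexp.mul_const (z p)
  rw [phaseForm_apply, hchain, hrotate.deriv, Circle.exp_zero, one_smul, mul_left_comm,
    ← Complex.normSq_eq_conj_mul_self, Complex.normSq_eq_norm_sq, hz1]
  simp

end Connections

section ConnectionSpace

variable {E : Type*} [NormedAddCommGroup E] [NormedSpace ℝ E]
  {H : Type*} [TopologicalSpace H] {I : ModelWithCorners ℝ E H}
  {M : Type*} [TopologicalSpace M] [ChartedSpace H M]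
  {F : Type*} [NormedAddCommGroup F] [NormedSpace ℝ F]
  {K : Type*} [TopologicalSpace K] {J : ModelWithCorners ℝ F K}
  {P : Type*} [TopologicalSpace P] [ChartedSpace K P] [MulAction Circle P] [IsManifold J ∞ P]
  {π : P → M} [T2Space M] (hπ : IsPrincipalCircleBundle I J π)

include hπ

theorem IsPrincipalCircleBundle.nonempty_connection [FiniteDimensional ℝ E] [IsManifold I ∞ M]
    [SigmaCompactSpace M] : Nonempty (Connection J P) := by
  choose U z hU hmem hz hz1 hzg using hπ.exists_local_phase
  obtain ⟨ρ, hρ⟩ := SmoothPartitionOfUnity.exists_isSubordinate I isClosed_univ U hU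
    fun y _ => mem_iUnion.2 ⟨y, hmem y⟩
  have hπU : ∀ {i : M} {p : P}, ρ i (π p) ≠ 0 → p ∈ π ⁻¹' U i := fun {i p} h =>
    hρ i (subset_tsupport _ h)
  have hsupp : ∀ {i : M} {y : M}, i ∈ ρ.finsupport y → ρ i y ≠ 0 := fun {i y} h => by
    simpa [SmoothPartitionOfUnity.mem_finsupport] using h
  have hval : ∀ (p : P) (v : TangentSpace J p),
      (∑ i ∈ ρ.finsupport (π p), ρ i (π p) • phaseForm J (z i) p) v =
        ∑ i ∈ ρ.finsupport (π p), ρ i (π p) * phaseForm J (z i) p v := fun p v => by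
    rw [sum_apply]
    rfl
  have hfinsum : (fun v : TangentBundle J P => (∑ i ∈ ρ.finsupport (π v.proj),
      ρ i (π v.proj) • phaseForm J (z i) v.proj) v.snd) =
      fun v => ∑ᶠ i, ρ i (π v.proj) * phaseForm J (z i) v.proj v.snd := by
    funext v
    rw [hval, finsum_eq_sum_of_support_subset]
    intro i hi
    rw [SmoothPartitionOfUnity.coe_finsupport]
    exact left_ne_zero_of_mul hi
  refine ⟨⟨fun p => ∑ i ∈ ρ.finsupport (π p), ρ i (π p) • phaseForm J (z i) p, ?_, ?_, ?_⟩⟩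
  · rw [hfinsum]
    refine contMDiff_finsum (fun i => contMDiff_mul_phaseForm
      ((hU i).preimage hπ.smooth_proj.continuous) ((ρ i).contMDiff.comp hπ.smooth_proj)
      ((tsupport_comp_subset_preimage _ hπ.smooth_proj.continuous).trans (preimage_mono (hρ i)))
      (hz i)) ?_
    exact (ρ.locallyFinite.preimage_continuous (hπ.smooth_proj.continuous.comp
      (FiberBundle.continuous_proj F (TangentSpace J)))).subset fun i v hv =>
        left_ne_zero_of_mul hv
  · intro g p v
    rw [hval, hval, hπ.proj_smul]
    refine Finset.sum_congr rfl fun i hi => ?_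
    rw [hπ.phaseForm_smul (hU i) (hz i) (hzg i) g (hπU (hsupp hi))]
  · intro p
    rw [hval, hπ.proj_smul]
    refine (Finset.sum_congr rfl fun i hi => ?_).trans (ρ.sum_finsupport (π p) (mem_univ _))
    rw [hπ.phaseForm_vertical (hU i) (hz i) (hz1 i) (hzg i) (hπU (hsupp hi)), mul_one]

theorem IsPrincipalCircleBundle.exists_connection_add (A : Connection J P) {ψ h : M → ℝ}
    (hψ : ContMDiff I 𝓘(ℝ, ℝ) ∞ ψ) (hh : ContMDiff I 𝓘(ℝ, ℝ) ∞ h) :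
    ∃ A' : Connection J P, ∀ (u : ℝ → P) (t : ℝ), MDifferentiableAt 𝓘(ℝ, ℝ) J u t →
      A'.along u t = A.along u t + ψ (π (u t)) * deriv (fun s => h (π (u s))) t := by
  have hhπ : ContMDiff J 𝓘(ℝ, ℝ) ∞ fun p => h (π p) := hh.comp hπ.smooth_proj
  have hhd : ∀ p, MDifferentiableAt J 𝓘(ℝ, ℝ) (fun p => h (π p)) p := fun p =>
    hhπ.mdifferentiableAt (by simp)
  have hval : ∀ (p : P) (v : TangentSpace J p),
      (A.form p + ψ (π p) • differential J (fun p => h (π p)) p) v =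
        A.form p v + ψ (π p) * differential J (fun p => h (π p)) p v := fun p v => rfl
  refine ⟨⟨fun p => A.form p + ψ (π p) • differential J (fun p => h (π p)) p, ?_, ?_, ?_⟩,
    fun u t hu => ?_⟩
  · have hψπ : ContMDiff J.tangent 𝓘(ℝ, ℝ) ∞ fun v : TangentBundle J P => ψ (π v.proj) :=
      (hψ.comp hπ.smooth_proj).comp (Bundle.contMDiff_proj _)
    exact A.smooth_form.add (hψπ.mul (contMDiff_differential hhπ))
  · intro g p v
    rw [hval, hval, A.invariant, hπ.proj_smul,
      differential_mfderiv (u := fun q : P => g • q) (hhd _) (hπ.mdifferentiableAt_smul g p)]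
    simp only [hπ.proj_smul]
  · intro p
    rw [hval, A.form_vertical, differential_velocity (u := fun θ : ℝ => Circle.exp θ • p) (hhd _)
      (hπ.mdifferentiableAt_exp_smul p 0)]
    simp only [hπ.proj_smul, deriv_const, mul_zero, add_zero]
  · rw [Connection.along, hval, differential_velocity (hhd _) hu]
    rfl

end ConnectionSpace

section Detection

variable {E : Type*} [NormedAddCommGroup E] [NormedSpace ℝ E]
  {H : Type*} [TopologicalSpace H] {I : ModelWithCorners ℝ E H}
  {M : Type*} [TopologicalSpace M] [ChartedSpace H M]

theorem IsEdgePartition.exists_mem_Icc {f : ℝ → M} {n : ℕ} {t : ℕ → ℝ}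
    (hP : IsEdgePartition I f n t) {τ : ℝ} (hτ : τ ∈ Icc (0 : ℝ) 1) :
    ∃ j < n, τ ∈ Icc (t j) (t (j + 1)) := by
  by_contra! hnot
  have hle : ∀ k ≤ n, t k ≤ τ := by
    intro k hk
    induction k with
    | zero => exact hP.zero.le.trans hτ.1
    | succ k ih =>
      by_contra! hlt
      exact hnot k hk ⟨ih (Nat.le_of_succ_le hk), hlt.le⟩
  obtain ⟨k, rfl⟩ : ∃ k, n = k + 1 := Nat.exists_eq_succ_of_ne_zero fun hn =>
    zero_ne_one (hP.zero.symm.trans (hn ▸ hP.one))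
  exact hnot k k.lt_succ_self ⟨hle k k.le_succ, hτ.2.trans hP.one.ge⟩

theorem exists_contMDiff_eventuallyEq [FiniteDimensional ℝ E] [T2Space M] [IsManifold I ω M]
    {h : M → ℝ} {y : M} (hh : ContMDiffAt I 𝓘(ℝ, ℝ) ω h y) :
    ∃ h' : M → ℝ, ContMDiff I 𝓘(ℝ, ℝ) ∞ h' ∧ h' =ᶠ[𝓝 y] h := by
  have : IsManifold I ∞ M := .of_le (n := ω) le_top
  obtain ⟨N, hN, hhN⟩ := (contMDiffAt_iff_contMDiffOn_nhds (by simp)).1 hh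
  obtain ⟨χ, -, hχ⟩ := (SmoothBumpFunction.nhds_basis_tsupport (I := I) y).mem_iff.1
    (interior_mem_nhds.2 hN)
  refine ⟨fun q => χ q * h q, contMDiff_of_tsupport fun q hq => ?_, ?_⟩
  · have hqN := hχ (tsupport_mul_subset_left hq)
    exact χ.contMDiffAt.mul
      ((hhN.contMDiffAt (mem_interior_iff_mem_nhds.1 hqN)).of_le le_top)
  · filter_upwards [χ.eventuallyEq_one] with q hq
    rw [hq, Pi.one_apply, one_mul]

theorem contDiffAt_comp_curve {f : ℝ → M} {h : M → ℝ} (hh : ContMDiff I 𝓘(ℝ, ℝ) ∞ h) {τ : ℝ}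
    (hf : ContMDiffAt 𝓘(ℝ, ℝ) I ω f τ) : ContDiffAt ℝ ∞ (fun s => h (f s)) τ :=
  contMDiffAt_iff_contDiffAt.1 (ContMDiffAt.comp τ hh.contMDiffAt (hf.of_le le_top))

/-- The coefficient of the pullback of the 1-form `ψ dh` along the curve `f`. -/
def formAlong (ψ h : M → ℝ) (f : ℝ → M) (τ : ℝ) : ℝ := ψ (f τ) * deriv (fun s => h (f s)) τ

theorem formAlong_eq_zero {ψ h : M → ℝ} {f : ℝ → M} {τ : ℝ} (hτ : f τ ∉ tsupport ψ) :
    formAlong ψ h f τ = 0 := by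
  rw [formAlong, image_eq_zero_of_notMem_tsupport hτ, zero_mul]

theorem continuous_formAlong {f : ℝ → M} (hfc : Continuous f) {ψ h : M → ℝ}
    (hψ : Continuous ψ) (hh : ContMDiff I 𝓘(ℝ, ℝ) ∞ h)
    (hf : ∀ τ, f τ ∈ tsupport ψ → ContMDiffAt 𝓘(ℝ, ℝ) I ω f τ) :
    Continuous (formAlong ψ h f) := by
  rw [continuous_iff_continuousAt]
  intro τ
  by_cases hτ : f τ ∈ tsupport ψ
  · exact (hψ.comp hfc).continuousAt.mul
      ((contDiffAt_comp_curve hh (hf τ hτ)).derivWithin (m := 0) (by simp)).continuousAt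
  · refine (continuousAt_const (y := (0 : ℝ))).congr ?_
    filter_upwards [hfc.continuousAt.preimage_mem_nhds
      ((isClosed_tsupport ψ).isOpen_compl.mem_nhds hτ)] with s hs
    exact (formAlong_eq_zero hs).symm

omit [TopologicalSpace M] in
theorem IsReparam.formAlong_eq {f : ℝ → M} {a b c d : ℝ} {φ : ℝ → ℝ}
    (hφ : IsReparam f a b c d φ) {ψ h : M → ℝ}
    (hh : ∀ τ ∈ Ioo a b, DifferentiableAt ℝ (fun s => h (f s)) τ) {τ : ℝ} (hτ : τ ∈ Ioo c d) :
    formAlong ψ h f τ = formAlong ψ h f (φ τ) * deriv φ τ := by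
  have hchain := (hh _ (hφ.mapsTo_Ioo hτ)).hasDerivAt.comp τ (hφ.diff τ hτ).hasDerivAt
  have hcomp : (fun s => h (f s)) =ᶠ[𝓝 τ] (fun s => h (f s)) ∘ φ := by
    filter_upwards [isOpen_Ioo.mem_nhds hτ] with s hs
    rw [Function.comp_apply, hφ.comp s (Ioo_subset_Icc_self hs)]
  rw [formAlong, formAlong, hφ.comp τ (Ioo_subset_Icc_self hτ), hcomp.deriv_eq, hchain.deriv,
    mul_assoc]

omit [TopologicalSpace M] in
theorem IsReparam.primitive_sub_eq {f : ℝ → M} {a b c d : ℝ} (hcd : c ≤ d) {φ : ℝ → ℝ}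
    (hφ : IsReparam f a b c d φ) {ψ h : M → ℝ}
    (hh : ∀ τ ∈ Ioo a b, DifferentiableAt ℝ (fun s => h (f s)) τ) {B : ℝ → ℝ}
    (hB : ∀ τ, HasDerivAt B (formAlong ψ h f τ) τ) : B (φ d) - B (φ c) = B d - B c := by
  have hBc : Continuous B := continuous_iff_continuousAt.2 fun τ => (hB τ).continuousAt
  have hconst := eq_of_hasDerivAt_zero_off_finite (g := fun τ => B (φ τ) - B τ)
    ((hBc.comp_continuousOn hφ.cont).sub hBc.continuousOn) finite_empty (fun τ hτ _ => ?_)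
    (right_mem_Icc.2 hcd)
  · linarith
  · have hderiv := ((hB (φ τ)).comp τ (hφ.diff τ hτ).hasDerivAt).sub (hB τ)
    rwa [hφ.formAlong_eq hh hτ, sub_self] at hderiv

theorem primitive_eq_of_disjoint_tsupport {f : ℝ → M} {c d : ℝ} (hcd : c ≤ d) {ψ h : M → ℝ}
    (hψ : Disjoint (tsupport ψ) (f '' Icc c d)) {B : ℝ → ℝ}
    (hB : ∀ τ, HasDerivAt B (formAlong ψ h f τ) τ) : B d = B c := by
  refine eq_of_hasDerivAt_zero_off_finite
    (continuous_iff_continuousAt.2 fun τ => (hB τ).continuousAt).continuousOn finite_empty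
    (fun τ hτ _ => ?_) (right_mem_Icc.2 hcd)
  rw [← formAlong_eq_zero (h := h) fun hmem =>
    Set.disjoint_left.1 hψ hmem ⟨τ, Ioo_subset_Icc_self hτ, rfl⟩]
  exact hB τ

theorem IsEdge.exists_smooth_deriv_pos [FiniteDimensional ℝ E] [T2Space M] [IsManifold I ω M]
    {f : ℝ → M} {a b m : ℝ} (he : IsEdge I f a b) (hm : m ∈ Ioo a b) :
    ∃ h : M → ℝ, ContMDiff I 𝓘(ℝ, ℝ) ∞ h ∧ ∃ O : Set ℝ, IsOpen O ∧ m ∈ O ∧ O ⊆ Ioo a b ∧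
      ∀ τ ∈ O, 0 < deriv (fun s => h (f s)) τ := by
  obtain ⟨h₀, hh₀, hpos₀⟩ := he.immersive m hm
  obtain ⟨h, hh, hheq⟩ := exists_contMDiff_eventuallyEq hh₀
  have hpos : 0 < deriv (fun s => h (f s)) m := by
    have heq : (fun s => h (f s)) =ᶠ[𝓝 m] fun s => h₀ (f s) :=
      (he.analytic m hm).continuousAt.eventually hheq
    rwa [heq.deriv_eq]
  have hcont : ContinuousAt (deriv fun s => h (f s)) m :=
    ((contDiffAt_comp_curve hh (he.analytic m hm)).derivWithin (m := 0) (by simp)).continuousAt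
  obtain ⟨O, hO, hOo, hmO⟩ := mem_nhds_iff.1
    (inter_mem (isOpen_Ioo.mem_nhds hm) (hcont.preimage_mem_nhds (Ioi_mem_nhds hpos)))
  exact ⟨h, hh, O, hOo, hmO, fun τ hτ => (hO hτ).1, fun τ hτ => (hO hτ).2⟩

theorem IsEdge.exists_bump [FiniteDimensional ℝ E] [T2Space M] {f : ℝ → M} {a b m : ℝ}
    (he : IsEdge I f a b) (hf : ContinuousOn f (Icc a b)) (hm : m ∈ Icc a b) {O : Set ℝ}
    (hO : IsOpen O) (hmO : m ∈ O) {C : Set M} (hC : IsClosed C) (hmC : f m ∉ C) :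
    ∃ ψ : SmoothBumpFunction I (f m), Disjoint (tsupport ψ) C ∧
      ∀ τ ∈ Icc a b, f τ ∈ tsupport ψ → τ ∈ O := by
  have hrest : (f '' (Icc a b \ O))ᶜ ∈ 𝓝 (f m) := by
    refine ((isCompact_Icc.diff hO).image_of_continuousOn
      (hf.mono sdiff_subset)).isClosed.isOpen_compl.mem_nhds ?_
    rintro ⟨τ, hτ, hτm⟩
    exact hτ.2 (he.inj hτ.1 hm hτm ▸ hmO)
  obtain ⟨ψ, -, hψ⟩ := (SmoothBumpFunction.nhds_basis_tsupport (I := I) (f m)).mem_iff.1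
    (inter_mem (hC.isOpen_compl.mem_nhds hmC) hrest)
  refine ⟨ψ, Set.disjoint_left.2 fun y hy => (hψ hy).1, fun τ hτ hmem => ?_⟩
  by_contra hτO
  exact (hψ hmem).2 ⟨τ, ⟨hτ, hτO⟩, rfl⟩

/-- The union of the pieces `f '' [t j, t (j + 1)]` that avoid the image of `(t i, t (i + 1))`. A
form that is to detect the `i`-th piece of an edge partition has to vanish there. -/
def otherTracks {X : Type*} (f : ℝ → X) (n : ℕ) (t : ℕ → ℝ) (i : ℕ) : Set X :=
  ⋃ j ∈ {j | j < n ∧ Disjoint (f '' Ioo (t i) (t (i + 1))) (f '' Icc (t j) (t (j + 1)))},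
    f '' Icc (t j) (t (j + 1))

theorem image_subset_otherTracks {X : Type*} {f : ℝ → X} {n : ℕ} {t : ℕ → ℝ} {i j : ℕ}
    (hj : j < n) (hd : Disjoint (f '' Ioo (t i) (t (i + 1))) (f '' Icc (t j) (t (j + 1)))) :
    f '' Icc (t j) (t (j + 1)) ⊆ otherTracks f n t i :=
  subset_biUnion_of_mem (u := fun j => f '' Icc (t j) (t (j + 1))) ⟨hj, hd⟩

theorem disjoint_otherTracks {X : Type*} (f : ℝ → X) (n : ℕ) (t : ℕ → ℝ) (i : ℕ) :
    Disjoint (f '' Ioo (t i) (t (i + 1))) (otherTracks f n t i) :=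
  disjoint_iUnion₂_right.2 fun _ hj => hj.2

theorem isClosed_otherTracks {X : Type*} [TopologicalSpace X] [T2Space X] {f : ℝ → X}
    (hf : Continuous f) (n : ℕ) (t : ℕ → ℝ) (i : ℕ) : IsClosed (otherTracks f n t i) :=
  ((finite_lt_nat n).subset fun _ hj => hj.1).isClosed_biUnion fun _ _ =>
    (isCompact_Icc.image hf).isClosed

theorem IsEdgePartition.exists_mem_Ioo_of_mem {f : ℝ → M} {n : ℕ} {t : ℕ → ℝ}
    (hP : IsEdgePartition I f n t) {i : ℕ} (hi : i < n) (he : IsEdge I f (t i) (t (i + 1)))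
    {S : Set M} (hS : Disjoint S (otherTracks f n t i))
    (hends : ∀ τ ∈ Icc (t i) (t (i + 1)), f τ ∈ S → τ ∈ Ioo (t i) (t (i + 1)))
    {τ : ℝ} (hτ : τ ∈ Icc (0 : ℝ) 1) (hτS : f τ ∈ S) :
    ∃ j < n, τ ∈ Ioo (t j) (t (j + 1)) ∧ IsEdge I f (t j) (t (j + 1)) := by
  obtain ⟨j, hj, hτj⟩ := hP.exists_mem_Icc hτ
  obtain hdisj | ⟨hej, φ, hφ⟩ := hP.disjoint_or i hi he j hj
  · exact (Set.disjoint_left.1 hS hτS (image_subset_otherTracks hj hdisj ⟨τ, hτj, rfl⟩)).elim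
  · have hφτ := hends (φ τ) (hφ.mapsTo hτj) (by rwa [hφ.comp τ hτj])
    refine ⟨j, hj, ⟨lt_of_le_of_ne hτj.1 ?_, lt_of_le_of_ne hτj.2 ?_⟩, hej⟩ <;> rintro rfl <;>
      rcases hφ.ends with h | h
    exacts [hφτ.1.ne' h.1, hφτ.2.ne h.1, hφτ.2.ne h.2, hφτ.1.ne' h.2]

theorem IsEdgePartition.contMDiffAt_extend_of_mem {x y : M} {α : Path x y} {n : ℕ} {t : ℕ → ℝ}
    (hP : IsEdgePartition I α.extend n t) {i : ℕ} (hi : i < n)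
    (he : IsEdge I α.extend (t i) (t (i + 1))) {S : Set M}
    (hS : Disjoint S (otherTracks α.extend n t i))
    (hends : ∀ τ ∈ Icc (t i) (t (i + 1)), α.extend τ ∈ S → τ ∈ Ioo (t i) (t (i + 1)))
    {τ : ℝ} (hτS : α.extend τ ∈ S) : ContMDiffAt 𝓘(ℝ, ℝ) I ω α.extend τ := by
  have hinterior := fun {σ : ℝ} => hP.exists_mem_Ioo_of_mem hi he hS hends (τ := σ)
  rcases lt_or_ge τ 0 with hneg | hnonneg
  · rw [α.extend_of_le_zero hneg.le, ← α.extend_zero] at hτS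
    obtain ⟨j, hj, hj0, -⟩ := hinterior (by simp) hτS
    exact (hj0.1.not_ge (hP.mem_Icc hj.le).1).elim
  rcases lt_or_ge 1 τ with hlarge | hle
  · rw [α.extend_of_one_le hlarge.le, ← α.extend_one] at hτS
    obtain ⟨j, hj, hj1, -⟩ := hinterior (by simp) hτS
    exact (hj1.2.not_ge (hP.mem_Icc (Nat.succ_le_of_lt hj)).2).elim
  obtain ⟨j, -, hτj, hej⟩ := hinterior ⟨hnonneg, hle⟩ hτS
  exact hej.analytic τ hτj

theorem IsEdgePartition.exists_localized_form [FiniteDimensional ℝ E] [T2Space M]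
    [IsManifold I ω M] {x y : M} {α : Path x y} {n : ℕ} {t : ℕ → ℝ}
    (hP : IsEdgePartition I α.extend n t) {i : ℕ} (hi : i < n)
    (he : IsEdge I α.extend (t i) (t (i + 1))) :
    ∃ ψ h : M → ℝ, ContMDiff I 𝓘(ℝ, ℝ) ∞ ψ ∧ ContMDiff I 𝓘(ℝ, ℝ) ∞ h ∧
      Disjoint (tsupport ψ) (otherTracks α.extend n t i) ∧ Continuous (formAlong ψ h α.extend) ∧
      0 < ∫ τ in t i..t (i + 1), formAlong ψ h α.extend τ := by
  have : IsManifold I ∞ M := .of_le (n := ω) le_top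
  have hm := hP.mid_mem hi
  set m := (t i + t (i + 1)) / 2
  obtain ⟨h, hh, O, hO, hmO, hOsub, hpos⟩ := he.exists_smooth_deriv_pos hm
  obtain ⟨ψ, hψdisj, hψO⟩ := he.exists_bump α.extend.continuous.continuousOn
    (Ioo_subset_Icc_self hm) hO hmO (isClosed_otherTracks α.extend.continuous n t i)
    (Set.disjoint_left.1 (disjoint_otherTracks α.extend n t i) ⟨m, hm, rfl⟩)
  have hcont : Continuous (formAlong ψ h α.extend) :=
    continuous_formAlong α.extend.continuous ψ.continuous hh fun _ =>
      hP.contMDiffAt_extend_of_mem hi he hψdisj fun τ hτ hmem => hOsub (hψO τ hτ hmem)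
  refine ⟨ψ, h, ψ.contMDiff, hh, hψdisj, hcont, intervalIntegral.integral_pos (hP.lt i hi)
    hcont.continuousOn (fun τ hτ => ?_) ⟨m, Ioo_subset_Icc_self hm, ?_⟩⟩
  · by_cases hmem : α.extend τ ∈ tsupport ψ
    · exact mul_nonneg ψ.nonneg (hpos τ (hψO τ (Ioc_subset_Icc_self hτ) hmem)).le
    · exact (formAlong_eq_zero hmem).ge
  · rw [formAlong, ψ.eq_one, one_mul]
    exact hpos m hmO

/-- A 1-form `ψ dh` supported near an interior point of an edge integrates over the curve to a
nonzero multiple of the `edgeCount` of this edge. -/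
theorem IsEdgePartition.edgeCount_eq_zero [FiniteDimensional ℝ E] [T2Space M] [IsManifold I ω M]
    {x y : M} {α : Path x y} {n : ℕ} {t : ℕ → ℝ} (hP : IsEdgePartition I α.extend n t)
    (hexact : ∀ ψ h : M → ℝ, ContMDiff I 𝓘(ℝ, ℝ) ∞ ψ → ContMDiff I 𝓘(ℝ, ℝ) ∞ h → ∀ B : ℝ → ℝ,
      (∀ τ, HasDerivAt B (formAlong ψ h α.extend τ) τ) → B 1 = B 0)
    {i : ℕ} (hi : i < n) (he : IsEdge I α.extend (t i) (t (i + 1))) :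
    edgeCount α.extend n t i = 0 := by
  obtain ⟨ψ, h, hψ, hh, hdisj, hcont, hpos⟩ := hP.exists_localized_form hi he
  let B : ℝ → ℝ := fun τ => ∫ s in (0 : ℝ)..τ, formAlong ψ h α.extend s
  have hB : ∀ τ, HasDerivAt B (formAlong ψ h α.extend τ) τ := fun τ =>
    (hcont.integral_hasStrictDerivAt 0 τ).hasDerivAt
  have hincr : B (t (i + 1)) - B (t i) ≠ 0 := by
    rw [intervalIntegral.integral_interval_sub_left (hcont.intervalIntegrable _ _)
      (hcont.intervalIntegrable _ _)]
    exact hpos.ne'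
  have hmultiple := hP.div_eq_zpow_edgeCount (fun τ => Multiplicative.ofAdd (B τ)) hi he
    (fun j hj φ hφ => by
      rw [← ofAdd_sub, ← ofAdd_sub, hφ.primitive_sub_eq (hP.lt j hj).le (fun τ hτ =>
        (contDiffAt_comp_curve hh (he.analytic τ hτ)).differentiableAt (by simp)) hB])
    (fun j hj hjd => by
      rw [primitive_eq_of_disjoint_tsupport (hP.lt j hj).le
        (hdisj.mono_right (image_subset_otherTracks hj hjd)) hB])
  simp only [hexact ψ h hψ hh B hB, div_self'] at hmultiple
  rw [← ofAdd_sub, ← ofAdd_zsmul, ← ofAdd_zero, Multiplicative.ofAdd.injective.eq_iff, eq_comm,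
    smul_eq_zero] at hmultiple
  exact hmultiple.resolve_right hincr

variable {F : Type*} [NormedAddCommGroup F] [NormedSpace ℝ F]
  {K : Type*} [TopologicalSpace K] {J : ModelWithCorners ℝ F K}
  {P : Type*} [TopologicalSpace P] [ChartedSpace K P] [MulAction Circle P] [IsManifold J ∞ P]
  {π : P → M} {x : M} {u₀ : P} [T2Space M] (hπ : IsPrincipalCircleBundle I J π)

include hπ

theorem IsPrincipalCircleBundle.exists_holonomy_eq_exp_mul [IsManifold I ω M] (hu₀ : π u₀ = x)
    (A : Connection J P) (α : PALoop I x) {ψ h : M → ℝ} (hψ : ContMDiff I 𝓘(ℝ, ℝ) ∞ ψ)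
    (hh : ContMDiff I 𝓘(ℝ, ℝ) ∞ h) {B : ℝ → ℝ}
    (hB : ∀ τ, HasDerivAt B (formAlong ψ h α.1.extend τ) τ) :
    ∃ A' : Connection J P,
      holonomy π A' u₀ α.1 = Circle.exp (B 1 - B 0) * holonomy π A u₀ α.1 := by
  obtain ⟨A', hA'⟩ := hπ.exists_connection_add A hψ hh
  obtain ⟨u, hu, hu0, hu1⟩ := hπ.exists_lift_holonomy hu₀ A α
  have hBc : Continuous B := continuous_iff_continuousAt.2 fun τ => (hB τ).continuousAt
  -- rotating the `A`-lift by the accumulated integral makes it `A'`-horizontal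
  have hlift : IsLiftOn π A' α.1.extend 0 1 fun τ => Circle.exp (B 0 - B τ) • u τ := by
    obtain ⟨S, hS, hhor⟩ := hu.horizontal
    refine ⟨?_, fun τ hτ => by rw [hπ.proj_smul, hu.proj τ hτ], S, hS, fun τ hτ hτS => ?_⟩
    · exact (contMDiff_exp_smul hπ.smooth_smul).continuous.comp_continuousOn
        ((continuous_const.sub hBc).continuousOn.prodMk hu.cont)
    · obtain ⟨hdiff, hAu⟩ := hhor τ hτ hτS
      obtain ⟨hdiff', hA'u⟩ := A'.along_exp_smul hπ.smooth_smul hdiff ((hB τ).const_sub (B 0))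
      refine ⟨hdiff', ?_⟩
      have hproj : (fun s => h (π (u s))) =ᶠ[𝓝 τ] fun s => h (α.1.extend s) := by
        filter_upwards [Icc_mem_nhds hτ.1 hτ.2] with s hs
        rw [hu.proj s hs]
      rw [hA'u, hA' u τ hdiff, hAu, hu.proj τ (Ioo_subset_Icc_self hτ), hproj.deriv_eq, zero_add,
        ← formAlong, add_neg_cancel]
  refine ⟨A', hπ.holonomy_eq hu₀ A' α hlift (by simpa using hu0) ?_⟩
  rw [smul_smul, mul_right_comm, ← Circle.exp_add, sub_add_sub_cancel, sub_self, Circle.exp_zero,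
    one_mul, ← hu1]

theorem IsPrincipalCircleBundle.edgeCount_eq_zero [FiniteDimensional ℝ E] [IsManifold I ω M]
    [SigmaCompactSpace M] (hu₀ : π u₀ = x) (α : PALoop I x)
    (hα : ∀ A : Connection J P, holonomy π A u₀ α.1 = 1) {n : ℕ} {t : ℕ → ℝ}
    (hP : IsEdgePartition I α.1.extend n t) {i : ℕ} (hi : i < n)
    (he : IsEdge I α.1.extend (t i) (t (i + 1))) : edgeCount α.1.extend n t i = 0 := by
  have : IsManifold I ∞ M := .of_le (n := ω) le_top
  obtain ⟨A⟩ := hπ.nonempty_connection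
  refine hP.edgeCount_eq_zero (fun ψ h hψ hh B hB => ?_) hi he
  by_contra hne
  have hne' : B 1 - B 0 ≠ 0 := sub_ne_zero.2 hne
  -- scaling `ψ` by `π / (B 1 - B 0)` would give a connection with holonomy `exp (i π) = -1`
  set c := Real.pi / (B 1 - B 0) with hc
  obtain ⟨A', hA'⟩ := hπ.exists_holonomy_eq_exp_mul hu₀ A α (contMDiff_const.mul hψ) hh
    (ψ := fun q => c * ψ q) (B := fun τ => c * B τ) fun τ => by
      simpa only [formAlong, mul_assoc] using (hB τ).const_mul c
  rw [hα, hα, mul_one, ← mul_sub, hc, div_mul_cancel₀ _ hne'] at hA'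
  have hcontra : (1 : ℂ) = -1 := by
    simpa only [Circle.coe_one, Circle.coe_exp, Complex.exp_pi_mul_I] using
      congrArg (fun z : Circle => (z : ℂ)) hA'
  norm_num at hcontra

end Detection

section Wilson

theorem exists_group_of_eq_range {G A : Type*} [Group G] [Monoid A] (ρ : G →* A) {S : Set A}
    (hS : S = range ρ) : ∃ _ : Group S, (∀ f g : S, ((f * g : S) : A) = f * g) ∧
      ∃ τ : G →* S, (∀ a, (τ a : A) = ρ a) ∧ τ.ker = ρ.ker := by
  obtain rfl : S = MonoidHom.mrange ρ := hS
  let groupRange : Group (MonoidHom.mrange ρ) := groupOfIsUnit <| by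
    rintro ⟨_, a, rfl⟩
    exact (Group.isUnit a).map ρ.mrangeRestrict
  exact ⟨groupRange, fun _ _ => rfl, ρ.mrangeRestrict, fun _ => rfl,
    Subgroup.ext fun _ => Subtype.ext_iff⟩

variable {E : Type*} [NormedAddCommGroup E] [NormedSpace ℝ E] [FiniteDimensional ℝ E]
  {H : Type*} [TopologicalSpace H] {I : ModelWithCorners ℝ E H}
  {M : Type*} [TopologicalSpace M] [ChartedSpace H M] [IsManifold I ω M] [T2Space M]
  {F : Type*} [NormedAddCommGroup F] [NormedSpace ℝ F]
  {K : Type*} [TopologicalSpace K] {J : ModelWithCorners ℝ F K}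
  {P : Type*} [TopologicalSpace P] [ChartedSpace K P] [MulAction Circle P] [IsManifold J ∞ P]
  {π : P → M} {x : M} {u₀ : P}

/-- The homomorphism that takes the class of a loop to its holonomies with respect to all
connections. -/
def holonomyHom (hπ : IsPrincipalCircleBundle I J π) (hu₀ : π u₀ = x) :
    LoopGroup I x →* (Connection J P → Circle) :=
  MonoidHom.mk' (Quot.lift (fun α A => holonomy π A u₀ α.1) fun _ _ h =>
      funext fun A => hπ.holonomy_eq_of_thinEquiv hu₀ A h) <| by
    rintro ⟨α⟩ ⟨β⟩
    exact funext fun A => hπ.holonomy_trans hu₀ A α β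

theorem ker_holonomyHom [SigmaCompactSpace M] (hπ : IsPrincipalCircleBundle I J π)
    (hu₀ : π u₀ = x) : (holonomyHom hπ hu₀).ker = commutator (LoopGroup I x) := by
  refine le_antisymm ?_ (Abelianization.commutator_subset_ker _)
  rintro ⟨α⟩ hα
  obtain ⟨n, t, hP⟩ := exists_isEdgePartition α.2.hasAnalyticGerms α.1.extend.continuous
  exact mem_commutator_of_edgeCount_eq_zero α hP fun i hi he =>
    hπ.edgeCount_eq_zero hu₀ α (fun A => congrFun hα A) hP hi he

/-- The homomorphism that takes the class of a loop to its Wilson function. -/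
def wilsonHom (hπ : IsPrincipalCircleBundle I J π) (hu₀ : π u₀ = x) :
    LoopGroup I x →* (Connection J P → ℂ) :=
  (Circle.coeHom.compLeft (Connection J P)).comp (holonomyHom hπ hu₀)

theorem wilsonHom_mk (hπ : IsPrincipalCircleBundle I J π) (hu₀ : π u₀ = x) (α : PALoop I x) :
    wilsonHom hπ hu₀ (LoopGroup.mk α) = wilson J π u₀ α := rfl

theorem range_wilsonHom (hπ : IsPrincipalCircleBundle I J π) (hu₀ : π u₀ = x) :
    range (wilsonHom hπ hu₀) = Hoop I J π u₀ x :=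
  (Quot.mk_surjective.range_comp (wilsonHom hπ hu₀)).symm

theorem ker_wilsonHom (hπ : IsPrincipalCircleBundle I J π) (hu₀ : π u₀ = x) :
    (wilsonHom hπ hu₀).ker = (holonomyHom hπ hu₀).ker :=
  MonoidHom.ker_comp_of_injective _ _ Circle.coe_injective.comp_left

end Wilson

end LoopHoop

end

open LoopHoop in
theorem mainTheorem3_general
    {E : Type*} [NormedAddCommGroup E] [NormedSpace ℝ E] [FiniteDimensional ℝ E]
    {H : Type*} [TopologicalSpace H] (I : ModelWithCorners ℝ E H)
    {M : Type*} [TopologicalSpace M] [ChartedSpace H M] [IsManifold I ω M]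
    [T2Space M] [SecondCountableTopology M]
    {F : Type*} [NormedAddCommGroup F] [NormedSpace ℝ F]
    {K : Type*} [TopologicalSpace K] (J : ModelWithCorners ℝ F K)
    {P : Type*} [TopologicalSpace P] [ChartedSpace K P] [IsManifold J ∞ P]
    [MulAction Circle P] (π : P → M) (hπ : IsPrincipalCircleBundle I J π)
    (x : M) (u₀ : P) (hu₀ : π u₀ = x) :
    (∀ (A : Connection J P) (α : PALoop I x), ∃! g : Circle, IsHolonomy π A u₀ α.1 g) ∧
    ∃ _ : Group (Hoop I J π u₀ x),
      (∀ f g : Hoop I J π u₀ x,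
        ((f * g : Hoop I J π u₀ x) : Connection J P → ℂ) = fun A => f.1 A * g.1 A) ∧
      ∃ τ : LoopGroup I x →* Hoop I J π u₀ x,
        (∀ α : PALoop I x, (τ (LoopGroup.mk α) : Connection J P → ℂ) = wilson J π u₀ α) ∧
        τ.ker = commutator (LoopGroup I x) := by
  have : LocallyCompactSpace M := Manifold.locallyCompact_of_finiteDimensional I
  obtain ⟨hgroup, hmul, τ, hτ, hker⟩ :=
    exists_group_of_eq_range (wilsonHom hπ hu₀) (range_wilsonHom hπ hu₀).symm
  refine ⟨hπ.existsUnique_isHolonomy hu₀, hgroup, hmul, τ, fun α => ?_, ?_⟩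
  · rw [hτ, wilsonHom_mk]
  · rw [hker, ker_wilsonHom, ker_holonomyHom]

open LoopHoop in
/-- `M` is a real analytic manifold, `π : P → M` a smooth principal `U(1)`-bundle, `u₀` a point of
the fibre over the base point `x`. Holonomies exist and are unique, the Wilson functions form a group
under pointwise multiplication, and `α ↦ T_α` descends to a homomorphism on the group of loops whose
kernel is the commutator subgroup. -/
theorem mainTheorem3
    {E : Type*} [NormedAddCommGroup E] [NormedSpace ℝ E] [FiniteDimensional ℝ E]
    {H : Type*} [TopologicalSpace H] (I : ModelWithCorners ℝ E H) [I.Boundaryless]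
    {M : Type*} [TopologicalSpace M] [ChartedSpace H M] [IsManifold I ω M]
    [T2Space M] [SecondCountableTopology M]
    {F : Type*} [NormedAddCommGroup F] [NormedSpace ℝ F] [FiniteDimensional ℝ F]
    {K : Type*} [TopologicalSpace K] (J : ModelWithCorners ℝ F K) [J.Boundaryless]
    {P : Type*} [TopologicalSpace P] [ChartedSpace K P] [IsManifold J ∞ P]
    [MulAction Circle P] (π : P → M) (hπ : IsPrincipalCircleBundle I J π)
    (x : M) (u₀ : P) (hu₀ : π u₀ = x) :
    (∀ (A : Connection J P) (α : PALoop I x), ∃! g : Circle, IsHolonomy π A u₀ α.1 g) ∧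
    ∃ _ : Group (Hoop I J π u₀ x),
      (∀ f g : Hoop I J π u₀ x,
        ((f * g : Hoop I J π u₀ x) : Connection J P → ℂ) = fun A => f.1 A * g.1 A) ∧
      ∃ τ : LoopGroup I x →* Hoop I J π u₀ x,
        (∀ α : PALoop I x, (τ (LoopGroup.mk α) : Connection J P → ℂ) = wilson J π u₀ α) ∧
        τ.ker = commutator (LoopGroup I x) :=
  mainTheorem3_general I J π hπ x u₀ hu₀
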